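/- Let $p$ be a prime, let $L/\mathbb{Q}_p$ be a finite extension (possibly ramified) with ring of integers $O_L$, uniformizer $\pi$, residue field $k_L$, ramification index $e$ and residue degree $f$, and let $L^{nr}\subset L$ be the maximal unramified subextension, with ring of integers $O_{L^{nr}}$. Let $k$ be a perfect field of characteristic $p$ containing $k_L$, let $\sigma$ be the Frobenius of the ring of Witt vectors $W(k)$, and let $\mathcal{T}$ be the set of the $f$ embeddings $O_{L^{nr}}\to W(k)$. For $\tau\in\mathcal{T}$ put $W_\tau = W(k)\otimes_{O_{L^{nr}},\tau}O_L$, a discrete valuation ring with uniformizer $\pi$ and valuation $v$ normalized by $v(p)=1$. Let $(M,F)$ be an $F$-crystal over $k$ with an action of $O_L$: $M$ is a free $W(k)$-module of finite rank, $F:M\to M$ is an injective $\sigma$-linear map, and $O_L$ acts on $M$ by $W(k)$-linear maps that commute with $F$. Let $M_\tau\subset M$ be the submodule on which $O_{L^{nr}}$ acts through $\tau$; it is a free $W_\tau$-module whose rank $h$ does not depend on $\tau$ and is called the rank of $(M,F)$. One has $M=\bigoplus_\tau M_\tau$, and $F$ induces $F_\tau:M_{\sigma^{-1}\tau}\to M_\tau$.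 * Hodge polygon. Write $M_\tau/F_\tau M_{\sigma^{-1}\tau}\simeq\bigoplus_{j=1}^h W_\tau/a_{\tau,j}W_\tau$ with $v(a_{\tau,1})\le\dots\le v(a_{\tau,h})$. Then $\mathrm{Hdg}_{O_L}(M,F)(i)=\frac1f\sum_{\tau\in\mathcal{T}}\sum_{j\le i}v(a_{\tau,j})$ for $0\le i\le h$. * Newton polygon. Let $\tau\in\mathcal{T}$. The isocrystal $(M_\tau[1/p],F^f)$ is the direct sum of its isoclinic components; a component is isoclinic of slope $v(\pi^m)/s=\frac{m}{es}$ if it contains a $W_\tau$-lattice $\Lambda$ with $F^{fs}\Lambda=\pi^m\Lambda$, where $s\ge1$. Let $\mu_1\le\dots\le\mu_h$ be the slopes, each repeated according to the dimension of its component over $W_\tau[1/p]$. Then $\mathrm{Newt}_{O_L}(M,F)(i)=\frac1f\sum_{j\le i}\mu_j$ for $0\le i\le h$; this does not depend on $\tau$. * Pappas–Rapoport polygon. For each $\tau\in\mathcal{T}$ let $r_\tau\ge1$ and $d_{\tau,1},\dots,d_{\tau,r_\tau}\in\{0,\dots,h\}$ be integers. Then $\mathrm{PR}(d_\bullet)(i)=\frac1f\sum_{\tau\in\mathcal{T}}\frac1e\sum_{l=1}^{r_\tau}\max(i-h+d_{\tau,l},0)$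 for $0\le i\le h$. Suppose that $(M,F)$ satisfies the Pappas–Rapoport condition for $(d_\bullet)$: for every $\tau\in\mathcal{T}$ there are $W_\tau$-submodules $$F_\tau M_{\sigma^{-1}\tau}=\mathrm{Fil}^{[0]}\subset\mathrm{Fil}^{[1]}\subset\dots\subset\mathrm{Fil}^{[r_\tau]}=M_\tau$$ such that, for $1\le l\le r_\tau$, $\pi\,\mathrm{Fil}^{[l]}\subset\mathrm{Fil}^{[l-1]}$ and $\mathrm{Fil}^{[l]}/\mathrm{Fil}^{[l-1]}$ is a $k$-vector space of dimension $d_{\tau,l}$. Then, for every integer $0\le i\le h$, $$\mathrm{Newt}_{O_L}(M,F)(i)\ \ge\ \mathrm{Hdg}_{O_L}(M,F)(i)\ \ge\ \mathrm{PR}(d_\bullet)(i).$$ -/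

import Mathlib

noncomputable section

namespace PRCrystal

open scoped TensorProduct

/-- The ring of integers `O_L` of a finite extension `L` of `ℚ_p`. -/
abbrev OL (p : ℕ) [Fact p.Prime] (L : Type*) [Field L] [Algebra ℤ_[p] L] :
    Subalgebra ℤ_[p] L :=
  integralClosure ℤ_[p] L

section Ramification

variable {p : ℕ} [Fact p.Prime] {L : Type*} [Field L] [Algebra ℤ_[p] L] (π : OL p L)

/-- The ramification index `e` of `L / ℚ_p`, where `π` is a uniformizer of `L`. -/
def ramIdx : ℕ := (Ideal.span {π}).ramificationIdx ℤ_[p]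

/-- The residue degree `f` of `L / ℚ_p`, where `π` is a uniformizer of `L`. -/
def resDeg : ℕ := (Ideal.span {π}).inertiaDeg ℤ_[p]

end Ramification

/-- The ring of integers of the maximal unramified subextension `L^nr` of `L`: the largest
unramified `ℤ_p`-subalgebra of `O_L`. -/
def ONr (p : ℕ) [Fact p.Prime] (L : Type*) [Field L] [Algebra ℤ_[p] L] :
    Subalgebra ℤ_[p] (OL p L) :=
  sSup {S | Algebra.FormallyUnramified ℤ_[p] S}

/-- The set `𝒯` of embeddings of `O_{L^nr}` into `W(k)`.  (A ring homomorphism between these rings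
is automatically injective and `ℤ_p`-linear.) -/
abbrev Emb (p : ℕ) [Fact p.Prime] (k : Type*) [Field k] (L : Type*) [Field L] [Algebra ℤ_[p] L] :
    Type _ :=
  ONr p L →+* WittVector p k

section Twist

variable {A W : Type*} [CommRing A] [CommRing W]

/-- The ring `W`, regarded as an `A`-algebra through `τ : A → W`. -/
def Twist (_ : A →+* W) : Type _ := W

variable (τ : A →+* W)

instance : CommRing (Twist τ) := inferInstanceAs (CommRing W)

instance : Algebra W (Twist τ) := inferInstanceAs (Algebra W W)

instance : Algebra A (Twist τ) := τ.toAlgebra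

instance : SMulCommClass A W (Twist τ) := ⟨fun a w x => mul_left_comm (τ a) w (id x : W)⟩

/-- Commuting actions of `W` and `O` on `N`, for which `A` acts through `τ`, define an action of
`W ⊗_{A, τ} O`, for which `w ⊗ b` acts as `x ↦ w • (b • x)`. -/
def liftAction {O N : Type*} [CommRing O] [Algebra A O] [AddCommGroup N] [Module W N]
    (act : O →+* Module.End W N)
    (hact : ∀ (a : A) (x : N), act (algebraMap A O a) x = τ a • x) :
    Twist τ ⊗[A] O →+* Module.End W N :=
  letI : Algebra A (Module.End W N) :=
    ((algebraMap W (Module.End W N)).comp τ).toAlgebra' fun c x => by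
      ext y
      simp
  (Algebra.TensorProduct.lift
    ({ (algebraMap W (Module.End W N) : W →+* Module.End W N) with
        commutes' := fun _ => rfl } : Twist τ →ₐ[A] Module.End W N)
    ({ act with
        commutes' := fun a => by
          ext y
          exact hact a y } : O →ₐ[A] Module.End W N)
    (fun w b => by
      ext y
      exact ((act b).map_smul (id w : W) y).symm)).toRingHom

theorem liftAction_tmul {O N : Type*} [CommRing O] [Algebra A O] [AddCommGroup N] [Module W N]
    (act : O →+* Module.End W N)
    (hact : ∀ (a : A) (x : N), act (algebraMap A O a) x = τ a • x) (w : W) (b : O) (x : N) :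
    liftAction τ act hact ((show Twist τ from w) ⊗ₜ[A] b) x = w • act b x := by
  let : Algebra A (Module.End W N) :=
    ((algebraMap W (Module.End W N)).comp τ).toAlgebra' fun c x => by
      ext y
      simp
  unfold liftAction
  erw [Algebra.TensorProduct.lift_tmul]
  rfl

end Twist

section WOL

variable {p : ℕ} [Fact p.Prime] {k : Type*} [Field k] {L : Type*} [Field L] [Algebra ℤ_[p] L]

/-- The ring `W_{O_L,τ}(k) = W(k) ⊗_{O_{L^nr}, τ} O_L`. -/
def WOL (τ : Emb p k L) : Type _ := Twist τ ⊗[ONr p L] OL p L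

variable (τ : Emb p k L)

instance : CommRing (WOL τ) := inferInstanceAs (CommRing (Twist τ ⊗[ONr p L] OL p L))

instance : Algebra (WittVector p k) (WOL τ) :=
  inferInstanceAs (Algebra (WittVector p k) (Twist τ ⊗[ONr p L] OL p L))

/-- The element `w ⊗ a` of `W_{O_L,τ}(k)`. -/
def WOL.tmul (w : WittVector p k) (a : OL p L) : WOL τ :=
  (show Twist τ from w) ⊗ₜ[ONr p L] a

/-- The ring homomorphism `O_L → W_{O_L,τ}(k)`, `a ↦ 1 ⊗ a`. -/
def ofOL : OL p L →+* WOL τ :=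
  (Algebra.TensorProduct.includeRight : OL p L →ₐ[ONr p L] Twist τ ⊗[ONr p L] OL p L).toRingHom

/-- The valuation on `W_{O_L,τ}(k)`, for which `π` is a uniformizer, normalized by `v(p) = 1`
(it is only meant for nonzero arguments). -/
def val (π : OL p L) (a : WOL τ) : ℚ :=
  (multiplicity (ofOL τ π) a : ℚ) / ramIdx π

end WOL

/-- An `F`-crystal structure on the finite free `W(k)`-module `M`. -/
structure FCrystal (p : ℕ) [Fact p.Prime] (k : Type*) [Field k] [CharP k p]
    (M : Type*) [AddCommGroup M] [Module (WittVector p k) M]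
    [Module.Free (WittVector p k) M] [Module.Finite (WittVector p k) M] where
  /-- The Frobenius of the crystal, which is `σ`-linear. -/
  F : M →ₛₗ[(WittVector.frobenius : WittVector p k →+* WittVector p k)] M
  injective : Function.Injective F

/-- An `F`-crystal with an action of `O_L`.  (A ring homomorphism from `O_L` to the endomorphisms
of `M` is automatically `ℤ_p`-linear.) -/
structure FCrystalOL (p : ℕ) [Fact p.Prime] (k : Type*) [Field k] [CharP k p]
    (L : Type*) [Field L] [Algebra ℤ_[p] L]
    (M : Type*) [AddCommGroup M] [Module (WittVector p k) M]
    [Module.Free (WittVector p k) M] [Module.Finite (WittVector p k) M]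
    extends FCrystal p k M where
  /-- The action of `O_L`. -/
  act : OL p L →+* Module.End (WittVector p k) M
  /-- `O_L` acts by endomorphisms of the crystal. -/
  F_act : ∀ (a : OL p L) (x : M), F (act a x) = act a (F x)

namespace FCrystalOL

variable {p : ℕ} [Fact p.Prime] {k : Type*} [Field k] [CharP k p]
  {L : Type*} [Field L] [Algebra ℤ_[p] L]
  {M : Type*} [AddCommGroup M] [Module (WittVector p k) M]
  [Module.Free (WittVector p k) M] [Module.Finite (WittVector p k) M]
  (X : FCrystalOL p k L M)

/-- The submodule `M_τ` of `M` on which `O_{L^nr}` acts through `τ`. -/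
def comp (τ : Emb p k L) : Submodule (WittVector p k) M where
  carrier := {x | ∀ a : ONr p L, X.act a x = τ a • x}
  add_mem' hx hy a := by rw [map_add, hx a, hy a, smul_add]
  zero_mem' a := by simp
  smul_mem' w x hx a := by rw [map_smul, hx a, smul_comm]

theorem act_mem_comp (τ : Emb p k L) (b : OL p L) {x : M} (hx : x ∈ X.comp τ) :
    X.act b x ∈ X.comp τ := by
  intro a
  have h : X.act a (X.act b x) = X.act b (X.act a x) := by
    rw [← Module.End.mul_apply, ← Module.End.mul_apply, ← map_mul, ← map_mul, mul_comm]
  rw [h, hx a, map_smul]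

/-- The action of `O_L` on `M_τ`. -/
def actComp (τ : Emb p k L) : OL p L →+* Module.End (WittVector p k) (X.comp τ) where
  toFun b := (X.act b).restrict fun _ hx => X.act_mem_comp τ b hx
  map_one' := by ext; simp
  map_mul' a b := by ext; simp
  map_zero' := by ext; simp
  map_add' a b := by ext; simp

/-- The action of `W_{O_L,τ}(k)` on `M_τ`: `w ⊗ a` acts as `x ↦ w • (a • x)`. -/
def actWOL (τ : Emb p k L) : WOL τ →+* Module.End (WittVector p k) (X.comp τ) :=
  liftAction τ (X.actComp τ) fun a x => Subtype.ext (x.2 a)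

instance (τ : Emb p k L) : Module (WOL τ) (X.comp τ) := Module.compHom _ (X.actWOL τ)

theorem tmul_smul (τ : Emb p k L) (w : WittVector p k) (a : OL p L) (x : X.comp τ) :
    ((WOL.tmul τ w a • x : X.comp τ) : M) = w • X.act a x :=
  congrArg Subtype.val (liftAction_tmul τ (X.actComp τ) (fun a x => Subtype.ext (x.2 a)) w a x)

instance (τ : Emb p k L) : IsScalarTower (WittVector p k) (WOL τ) (X.comp τ) :=
  IsScalarTower.of_algebraMap_smul fun w x => by
    apply Subtype.ext
    refine (X.tmul_smul τ w 1 x).trans ?_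
    simp

section Perfect

variable [PerfectRing k p]

/-- The embedding `σ⁻¹ ∘ τ`. -/
def sigmaInv (τ : Emb p k L) : Emb p k L :=
  ((WittVector.frobeniusEquiv p k).symm : WittVector p k →+* WittVector p k).comp τ

theorem frobenius_frobeniusEquiv_symm (w : WittVector p k) :
    WittVector.frobenius ((WittVector.frobeniusEquiv p k).symm w) = w :=
  (WittVector.frobeniusEquiv p k).apply_symm_apply w

theorem F_mem_comp (τ : Emb p k L) {x : M} (hx : x ∈ X.comp (sigmaInv τ)) :
    X.F x ∈ X.comp τ := by
  intro a
  rw [← X.F_act, hx a, map_smulₛₗ]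
  congr 1
  exact frobenius_frobeniusEquiv_symm (τ a)

theorem F_symm_smul (w : WittVector p k) (a : OL p L) (x : M) :
    X.F ((WittVector.frobeniusEquiv p k).symm w • X.act a x) = w • X.act a (X.F x) := by
  rw [map_smulₛₗ, X.F_act, frobenius_frobeniusEquiv_symm]

/-- The submodule `F_τ M_{σ⁻¹τ}` of `M_τ`. -/
def imF (τ : Emb p k L) : Submodule (WOL τ) (X.comp τ) where
  carrier := {y | ∃ x ∈ X.comp (sigmaInv τ), X.F x = y}
  add_mem' := by
    rintro _ _ ⟨x, hx, hx'⟩ ⟨y, hy, hy'⟩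
    exact ⟨x + y, add_mem hx hy, by rw [map_add, hx', hy']; rfl⟩
  zero_mem' := ⟨0, zero_mem _, by simp⟩
  smul_mem' c y hy := by
    refine TensorProduct.induction_on c ?_ ?_ ?_
    · refine ⟨0, zero_mem _, ?_⟩
      rw [map_zero]
      exact congrArg Subtype.val (zero_smul (WOL τ) y).symm
    · intro w a
      obtain ⟨x, hx, hx'⟩ := hy
      refine ⟨(WittVector.frobeniusEquiv p k).symm w • X.act a x,
        Submodule.smul_mem _ _ (X.act_mem_comp _ a hx), ?_⟩
      exact (X.F_symm_smul w a x).trans (hx' ▸ (X.tmul_smul τ w a y).symm)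
    · intro c d hc hd
      obtain ⟨x, hx, hx'⟩ := hc
      obtain ⟨z, hz, hz'⟩ := hd
      refine ⟨x + z, add_mem hx hz, ?_⟩
      rw [map_add, hx', hz']
      exact congrArg Subtype.val (add_smul (R := WOL τ) c d y).symm

/-- `M` has rank `h`: the rank of `M_τ` over `W_{O_L,τ}(k)`, which does not depend on the choice
of `τ`, is equal to `h`. -/
def HasRank (h : ℕ) : Prop :=
  ∃ τ : Emb p k L, Module.finrank (WOL τ) (X.comp τ) = h

variable (π : OL p L) (h : ℕ)

/-- `M_τ / F_τ M_{σ⁻¹τ} ≃ ⨁ W_{O_L,τ}(k) / a_i`, with `v(a_1) ≤ ⋯ ≤ v(a_h)`. -/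
def IsElementaryDivisors (τ : Emb p k L) (a : Fin h → WOL τ) : Prop :=
  Nonempty ((X.comp τ ⧸ X.imF τ) ≃ₗ[WOL τ] (Π i, WOL τ ⧸ Ideal.span {a i})) ∧
    Monotone fun i => val τ π (a i)

open Classical in
/-- Elementary divisors `a_{τ,1}, …, a_{τ,h}` of `F_τ M_{σ⁻¹τ} ⊂ M_τ`; only their valuations,
which are unique, are used below. -/
def elementaryDivisors (τ : Emb p k L) : Fin h → WOL τ :=
  if H : ∃ a, X.IsElementaryDivisors π h τ a then H.choose else 0

/-- The Hodge polygon relative to `τ`. -/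
def hodgeAt (τ : Emb p k L) (i : ℕ) : ℚ :=
  ∑ j : Fin h with j.val < i, val τ π (X.elementaryDivisors π h τ j)

/-- The Hodge polygon, the mean of the Hodge polygons relative to the `f` embeddings `τ`. -/
def hodge (i : ℕ) : ℚ :=
  (∑ᶠ τ : Emb p k L, X.hodgeAt π h τ i) / resDeg π

/-- The Pappas-Rapoport condition for the datum `d`.  The `k`-dimension of the graded pieces, on
which `W(k)` acts through `k`, is their length over `W(k)`. -/
def PRCondition (r : Emb p k L → ℕ) (d : (τ : Emb p k L) → Fin (r τ) → ℕ) : Prop :=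
  ∀ τ : Emb p k L, ∃ Fil : Fin (r τ + 1) → Submodule (WOL τ) (X.comp τ),
    Fil 0 = X.imF τ ∧ Fil (Fin.last (r τ)) = ⊤ ∧
    ∀ i : Fin (r τ),
      Fil i.castSucc ≤ Fil i.succ ∧
      (∀ x ∈ Fil i.succ, ofOL τ π • x ∈ Fil i.castSucc) ∧
      Module.length (WittVector p k)
        (Fil i.succ ⧸ (Fil i.castSucc).submoduleOf (Fil i.succ)) = d τ i

end Perfect

/-- The part of slope `q` of `M_τ` for `F^f`, where the slope is divided by `f`: the sum of the
`W_{O_L,τ}(k)`-submodules `Λ` such that `F^{fs} Λ = π^m Λ` for some integers `s ≥ 1` and `m` with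
`q = v(π^m) / (f s) = m / (e f s)`.
Since every lattice of the isocrystal `M_τ[1/p]` has a multiple in `M_τ`, this is a lattice in the
isoclinic component of slope `q` in the Dieudonné-Manin decomposition of `M_τ[1/p]`. -/
def slopePart (π : OL p L) (τ : Emb p k L) (q : ℚ) : Submodule (WOL τ) (X.comp τ) :=
  sSup {Λ | ∃ s m : ℕ, 0 < s ∧ q = m / (ramIdx π * resDeg π * s) ∧
    (fun x : X.comp τ => X.F^[resDeg π * s] (x : M)) '' Λ =
      (fun x : X.comp τ => ((ofOL τ π ^ m • x : X.comp τ) : M)) '' Λ}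

/-- `q_1 ≤ ⋯ ≤ q_h` are the Newton slopes relative to `τ`: each slope `q` occurs as often as the
dimension of the part of slope `q`. -/
def IsNewtonSlopes (π : OL p L) (h : ℕ) (τ : Emb p k L) (q : Fin h → ℚ) : Prop :=
  Monotone q ∧ ∀ t : ℚ,
    Finset.card {j : Fin h | q j = t} = Module.finrank (WOL τ) (X.slopePart π τ t)

open Classical in
/-- The Newton slopes relative to `τ`, in increasing order. -/
def newtonSlopes (π : OL p L) (h : ℕ) (τ : Emb p k L) : Fin h → ℚ :=
  if H : ∃ q, X.IsNewtonSlopes π h τ q then H.choose else 0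

/-- The Newton polygon relative to `τ`. -/
def newtonAt (π : OL p L) (h : ℕ) (τ : Emb p k L) (i : ℕ) : ℚ :=
  ∑ j : Fin h with j.val < i, X.newtonSlopes π h τ j

end FCrystalOL

section PR

variable {p : ℕ} [Fact p.Prime] {k : Type*} [Field k] {L : Type*} [Field L] [Algebra ℤ_[p] L]
  (π : OL p L) (h : ℕ) {r : Emb p k L → ℕ} (d : (τ : Emb p k L) → Fin (r τ) → ℕ)

/-- The Pappas-Rapoport polygon relative to `τ`: the sum over `i` of the convex polygons with
slopes `0` (`h - d_{τ,i}` times) and `1/e` (`d_{τ,i}` times). -/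
def prAt (τ : Emb p k L) (j : ℕ) : ℚ :=
  (∑ i, max ((j : ℚ) - h + d τ i) 0) / ramIdx π

/-- The Pappas-Rapoport polygon, the mean of the polygons relative to the `f` embeddings `τ`. -/
def pr (j : ℕ) : ℚ :=
  (∑ᶠ τ : Emb p k L, prAt π h d τ j) / resDeg π

end PR

end PRCrystal

end

/-! Every inequality here is a count of lengths over `W(k)`. The ring `W_τ` is a discrete valuation
ring with uniformizer `π` and residue field `k`, and `F` is injective and semilinear over an
automorphism of `W(k)`, so it preserves lengths of subquotients.

Hodge above Pappas-Rapoport, for one `τ` at a time (`HasRank.prAt_le_hodgeAt`). Project `M_τ / F M ≃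
⨁ W_τ / a_j` to its last `h - i` factors. The image of the given filtration has graded pieces killed
by `π`. Each has length at most `d_l`, and at most `h - i`, because over a principal ideal domain a
submodule needs no more generators than the module. So the last `h - i` exponents add up to at most
`∑ min (d_l, h - i)`. The sum of all exponents is `∑ d_l`, hence the first `i` add up to at least `∑
max (i - h + d_l, 0)`.

Newton above Hodge. The averaged Hodge slopes increase, so it suffices to compare at break points of
the Newton polygon (`sum_le_sum_of_breakPoints`). There the first `i` slopes are those in a set `T`,
with full multiplicity. Let `N_τ` be the saturation in `M_τ` of the sum of the parts with slope in
`T`; it has rank `i` and is stable under `F`. The module `M_τ / (N_τ + F M)` is a quotient of `M_τ /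
F M` with `h - i` generators, so its length is at most the sum of the `h - i` largest exponents
(`length_le_sum_multiplicity`). Hence `N_τ / F N_{σ⁻¹τ}` has length at least the sum of the `i`
smallest. Adding this up along the `σ`-orbit of `τ`, which is all of `𝒯`, bounds the length of `N_τ
/ F^f N_τ` from below. From above it is bounded by `e f` times the sum of the slopes in `T`
(`exists_relLength_map_eq`), because the length may be computed on the commensurable sum of slope
parts.

That the Newton slopes exist is the slope decomposition up to isogeny,
`exists_pow_smul_mem_sSup_slopes`. A maximal slope is realized on a lattice where `F^{fs}` is
divisible by `π^m`. Fitting's lemma for `π^{-m} F^{fs}` splits off an isoclinic part. The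
topologically nilpotent rest has smaller rank: otherwise a pigeonhole argument
(`exists_stable_lattice`) would give a larger slope whose denominator is still bounded by the rank.
-/

noncomputable section

namespace PRCrystal

open scoped TensorProduct

set_option linter.unusedSectionVars false

/-! ### Lengths of quotients of submodules. -/

section RelLength

variable (R : Type*) {A M N : Type*} [CommRing R] [CommRing A] [Algebra R A]
  [AddCommGroup M] [Module R M] [Module A M] [IsScalarTower R A M]
  [AddCommGroup N] [Module R N] [Module A N] [IsScalarTower R A N]

/-- The length over `R` of the quotient `B / (B ⊓ C)`. -/
def relLength (B C : Submodule A M) : ℕ∞ :=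
  Module.length R (B ⧸ C.submoduleOf B)

variable {R}

theorem relLength_add {B C D : Submodule A M} (hDC : D ≤ C) (hCB : C ≤ B) :
    relLength R B D = relLength R B C + relLength R C D := by
  have h1 : D.submoduleOf C ≤ (D.submoduleOf B).comap (Submodule.inclusion hCB) := fun x hx => hx
  have h2 : D.submoduleOf B ≤ C.submoduleOf B := fun x hx => hDC hx
  let f := Submodule.mapQ _ _ (Submodule.inclusion hCB) h1
  let g := Submodule.factor h2
  rw [relLength, relLength, relLength, add_comm]
  refine Module.length_eq_add_of_exact (f.restrictScalars R) (g.restrictScalars R) ?_ ?_ ?_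
  · intro x y hxy
    obtain ⟨x, rfl⟩ := Submodule.Quotient.mk_surjective _ x
    obtain ⟨y, rfl⟩ := Submodule.Quotient.mk_surjective _ y
    exact (Submodule.Quotient.eq _).2 ((Submodule.Quotient.eq (D.submoduleOf B)).1 hxy)
  · exact Submodule.factor_surjective h2
  · intro y
    obtain ⟨y, rfl⟩ := Submodule.Quotient.mk_surjective _ y
    constructor
    · intro hy
      have hy' : (y : M) ∈ C := (Submodule.Quotient.mk_eq_zero (C.submoduleOf B)).1 hy
      exact ⟨Submodule.Quotient.mk ⟨y, hy'⟩, rfl⟩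
    · rintro ⟨x, hx⟩
      obtain ⟨x, rfl⟩ := Submodule.Quotient.mk_surjective _ x
      rw [← hx]
      exact (Submodule.Quotient.mk_eq_zero (C.submoduleOf B)).2 x.2

theorem relLength_eq_zero {B C : Submodule A M} : relLength R B C = 0 ↔ B ≤ C := by
  rw [relLength, Module.length_eq_zero_iff, Submodule.Quotient.subsingleton_iff,
    Submodule.submoduleOf_eq_top]

theorem relLength_self (B : Submodule A M) : relLength R B B = 0 :=
  relLength_eq_zero.2 le_rfl

theorem relLength_sup_right (B C : Submodule A M) :
    relLength R (B ⊔ C) C = relLength R B C := by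
  have e := LinearMap.quotientInfEquivSupQuotient B C
  have h : Submodule.comap B.subtype (B ⊓ C) = C.submoduleOf B := by
    ext x
    simp [Submodule.submoduleOf]
  rw [relLength, relLength, ← h]
  exact (e.symm.restrictScalars R).length_eq

theorem relLength_anti_right (B : Submodule A M) {C D : Submodule A M} (h : D ≤ C) :
    relLength R B C ≤ relLength R B D := by
  have h2 : D.submoduleOf B ≤ C.submoduleOf B := fun x hx => h hx
  exact Module.length_le_of_surjective ((Submodule.factor h2).restrictScalars R)
    (Submodule.factor_surjective h2)

theorem relLength_sup_sup_le {B C B' C' : Submodule A M} (h : C ≤ B) (h' : C' ≤ B') :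
    relLength R (B ⊔ B') (C ⊔ C') ≤ relLength R B C + relLength R B' C' := by
  rw [relLength_add (C := C ⊔ B') (sup_le_sup_left h' C) (sup_le_sup_right h B')]
  refine add_le_add ?_ ?_
  · have : B ⊔ B' = B ⊔ (C ⊔ B') := by rw [← sup_assoc, sup_eq_left.2 h]
    rw [this, relLength_sup_right]
    exact relLength_anti_right _ le_sup_left
  · have : C ⊔ B' = B' ⊔ (C ⊔ C') := by
      rw [sup_left_comm, sup_eq_left.2 h']
    rw [this, relLength_sup_right]
    exact relLength_anti_right _ le_sup_right

theorem relLength_iSup_iSup_le {ι : Type*} (s : Finset ι) (B C : ι → Submodule A M)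
    (h : ∀ i, C i ≤ B i) :
    relLength R (⨆ i ∈ s, B i) (⨆ i ∈ s, C i) ≤ ∑ i ∈ s, relLength R (B i) (C i) := by
  classical
  induction s using Finset.induction_on with
  | empty => simp [relLength_self]
  | insert a s ha ih =>
    rw [Finset.iSup_insert, Finset.iSup_insert, Finset.sum_insert ha]
    refine (relLength_sup_sup_le (h a) (iSup₂_mono fun i _ => h i)).trans ?_
    gcongr

theorem relLength_map_le (g : M →ₗ[A] N) (B C : Submodule A M) :
    relLength R (B.map g) (C.map g) ≤ relLength R B C := by
  have h1 : C.submoduleOf B ≤ ((C.map g).submoduleOf (B.map g)).comap (g.submoduleMap B) :=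
    fun x hx => ⟨x, hx, rfl⟩
  refine Module.length_le_of_surjective
    ((Submodule.mapQ _ _ (g.submoduleMap B) h1).restrictScalars R) ?_
  intro y
  obtain ⟨⟨_, x, hx, rfl⟩, rfl⟩ := Submodule.Quotient.mk_surjective _ y
  exact ⟨Submodule.Quotient.mk ⟨x, hx⟩, rfl⟩

theorem relLength_top (C : Submodule A M) :
    relLength R ⊤ C = Module.length R (M ⧸ C) := by
  refine le_antisymm ?_ ?_
  · refine Module.length_le_of_injective
      ((Submodule.mapQ (C.submoduleOf ⊤) C (Submodule.subtype ⊤)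
        fun x hx => hx).restrictScalars R) ?_
    intro x y hxy
    obtain ⟨x, rfl⟩ := Submodule.Quotient.mk_surjective _ x
    obtain ⟨y, rfl⟩ := Submodule.Quotient.mk_surjective _ y
    exact (Submodule.Quotient.eq _).2 ((Submodule.Quotient.eq C).1 hxy)
  · refine Module.length_le_of_surjective
      ((Submodule.mapQ (C.submoduleOf ⊤) C (Submodule.subtype ⊤)
        fun x hx => hx).restrictScalars R) ?_
    intro y
    obtain ⟨y, rfl⟩ := Submodule.Quotient.mk_surjective _ y
    exact ⟨Submodule.Quotient.mk ⟨y, trivial⟩, rfl⟩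

theorem relLength_top_bot : relLength R (⊤ : Submodule A M) ⊥ = Module.length R M := by
  rw [relLength_top]
  exact ((Submodule.quotEquivOfEqBot (⊥ : Submodule A M) rfl).restrictScalars R).length_eq

theorem relLength_telescope {r : ℕ} (B : Fin (r + 1) → Submodule A M)
    (h : ∀ i : Fin r, B i.castSucc ≤ B i.succ) :
    relLength R (B (Fin.last r)) (B 0) = ∑ i : Fin r, relLength R (B i.succ) (B i.castSucc) := by
  induction r with
  | zero => simpa using relLength_self _
  | succ r ih =>
    have hm : Monotone B := Fin.monotone_iff_le_succ.2 h
    have h0 := ih (fun i => B i.castSucc) fun i => h i.castSucc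
    rw [Fin.sum_univ_castSucc, relLength_add (C := B (Fin.last r).castSucc) (hm (Fin.zero_le _))
      (hm (Fin.le_last _)), add_comm]
    congr 1

/-- Relative lengths of images under an injective semilinear map. -/
theorem relLength_semilinear {P : Type*} [AddCommGroup P] [Module R P] {σ : R →+* R}
    [RingHomSurjective σ] {Q : Type*} [AddCommGroup Q] [Module R Q]
    (F : P →ₛₗ[σ] Q) (hF : Function.Injective F) (B C : Submodule R P) :
    relLength R (B.map F) (C.map F) = relLength R B C := by
  let G : B →ₛₗ[σ] (B.map F ⧸ (C.map F).submoduleOf (B.map F)) :=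
    (Submodule.mkQ _).comp
      { toFun := fun x => (⟨F x, x, x.2, rfl⟩ : B.map F)
        map_add' := fun x y => Subtype.ext (map_add F (x : P) y)
        map_smul' := fun a x => Subtype.ext (map_smulₛₗ F a (x : P)) }
  have hG : LinearMap.ker G = C.submoduleOf B := by
    ext x
    rw [LinearMap.mem_ker]
    refine (Submodule.Quotient.mk_eq_zero _).trans ⟨?_, fun hx => ⟨x, hx, rfl⟩⟩
    rintro ⟨y, hy, hxy⟩
    have hyx : y = x := hF hxy
    exact (hyx ▸ hy : (x : P) ∈ C)
  let H : (B ⧸ C.submoduleOf B) →ₛₗ[σ] (B.map F ⧸ (C.map F).submoduleOf (B.map F)) :=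
    Submodule.liftQ _ G hG.ge
  have hH : Function.Bijective H := by
    constructor
    · rw [← LinearMap.ker_eq_bot]
      exact Submodule.ker_liftQ_eq_bot _ _ _ hG.le
    · intro y
      obtain ⟨⟨_, x, hx, rfl⟩, rfl⟩ := Submodule.Quotient.mk_surjective _ y
      exact ⟨Submodule.Quotient.mk ⟨x, hx⟩, rfl⟩
  -- Length is the Krull dimension of the lattice of submodules, and a bijective semilinear map
  -- identifies the two lattices.
  rw [relLength, relLength, Module.length, Module.length, WithBot.unbot_inj,
    Order.krullDim_eq_of_orderIso (Submodule.orderIsoMapComapOfBijective H hH)]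

end RelLength

/-! ### Bounding lengths by numbers of generators. -/

section Generators

variable {R A M : Type*} [CommRing R] [CommRing A] [Algebra R A]
  [AddCommGroup M] [Module R M] [Module A M] [IsScalarTower R A M] {ϖ : A}

/-- Being killed by `ϖ`, the module is a quotient of `(A / ϖ)^ι`. -/
theorem length_le_card_of_span_eq_top (hϖ : Module.length R (A ⧸ Ideal.span {ϖ}) ≤ 1)
    {ι : Type*} [Fintype ι] (v : ι → M) (hv : Submodule.span A (Set.range v) = ⊤)
    (h0 : ∀ x : M, ϖ • x = 0) : Module.length R M ≤ Fintype.card ι := by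
  classical
  let g (i : ι) : (A ⧸ Ideal.span {ϖ}) →ₗ[A] M :=
    Submodule.liftQ (Ideal.span {ϖ}) (LinearMap.toSpanSingleton A M (v i)) <| by
      rw [Ideal.span, Submodule.span_le, Set.singleton_subset_iff]
      exact h0 (v i)
  let G : (ι → A ⧸ Ideal.span {ϖ}) →ₗ[A] M := LinearMap.lsum A _ ℕ g
  have hG : Function.Surjective G := by
    rw [← LinearMap.range_eq_top, eq_top_iff, ← hv, Submodule.span_le]
    rintro _ ⟨i, rfl⟩
    refine ⟨Pi.single i (Submodule.Quotient.mk 1), ?_⟩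
    rw [LinearMap.lsum_piSingle]
    exact one_smul A (v i)
  refine (Module.length_le_of_surjective (G.restrictScalars R) hG).trans ?_
  rw [Module.length_pi_of_fintype]
  refine (Finset.sum_le_sum fun i _ => hϖ).trans ?_
  simp

/-- Over a principal ideal domain the preimage of `B` in `A^c` is free of rank at most `c`. So `B`
has `c` generators as well, and they generate `B / (B ⊓ C)`, which is killed by `ϖ`. -/
theorem relLength_le_of_span [IsDomain A] [IsPrincipalIdealRing A]
    (hϖ : Module.length R (A ⧸ Ideal.span {ϖ}) ≤ 1) {c : ℕ} (v : Fin c → M)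
    (hv : Submodule.span A (Set.range v) = ⊤) {B C : Submodule A M}
    (h : ∀ x ∈ B, ϖ • x ∈ C) : relLength R B C ≤ c := by
  let g : (Fin c → A) →ₗ[A] M := Fintype.linearCombination A v
  have hg : Function.Surjective g := by
    rw [← LinearMap.range_eq_top, Fintype.range_linearCombination, hv]
  let P := B.comap g
  let b := Module.finBasis A P
  have hP : Module.finrank A P ≤ c := (Submodule.finrank_le P).trans (by simp)
  let G : P →ₗ[A] (B ⧸ C.submoduleOf B) :=
    (Submodule.mkQ _).comp (g.restrict (p := P) (q := B) fun x hx => hx)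
  have hG : Function.Surjective G := by
    intro y
    obtain ⟨⟨y, hy⟩, rfl⟩ := Submodule.Quotient.mk_surjective _ y
    obtain ⟨x, rfl⟩ := hg y
    exact ⟨⟨x, hy⟩, rfl⟩
  refine (length_le_card_of_span_eq_top hϖ (G ∘ b) ?_ ?_).trans ?_
  · rw [Set.range_comp, ← Submodule.map_span, b.span_eq, Submodule.map_top,
      LinearMap.range_eq_top.2 hG]
  · intro y
    obtain ⟨⟨y, hy⟩, rfl⟩ := Submodule.Quotient.mk_surjective _ y
    exact (Submodule.Quotient.mk_eq_zero (C.submoduleOf B)).2 (h y hy)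
  · simpa using hP

/-- If `M` has a filtration whose graded pieces are killed by `ϖ`, then the length of a quotient of
`M` with `c` generators is at most `∑ min (d i) c`, where `d i` bounds the length of the `i`-th
graded piece. -/
theorem length_le_sum_min [IsDomain A] [IsPrincipalIdealRing A]
    (hϖ : Module.length R (A ⧸ Ideal.span {ϖ}) ≤ 1)
    {Q : Type*} [AddCommGroup Q] [Module R Q] [Module A Q] [IsScalarTower R A Q]
    (g : M →ₗ[A] Q) (hg : Function.Surjective g) {c : ℕ} (v : Fin c → Q)
    (hv : Submodule.span A (Set.range v) = ⊤) {r : ℕ} (B : Fin (r + 1) → Submodule A M)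
    (h0 : B 0 ≤ LinearMap.ker g) (hr : B (Fin.last r) = ⊤)
    (hB : ∀ i : Fin r, B i.castSucc ≤ B i.succ)
    (hB' : ∀ i : Fin r, ∀ x ∈ B i.succ, ϖ • x ∈ B i.castSucc) (d : Fin r → ℕ)
    (hd : ∀ i, relLength R (B i.succ) (B i.castSucc) ≤ d i) :
    Module.length R Q ≤ ∑ i, ((min (d i) c : ℕ) : ℕ∞) := by
  -- The filtration is pushed forward to `Q`. A graded piece of the image is a quotient of the
  -- original one, which gives the bound `d i`, and a subquotient of `Q` killed by `ϖ`, which gives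
  -- the bound `c`.
  have h := relLength_telescope (R := R) (fun i => (B i).map g) fun i => Submodule.map_mono (hB i)
  rw [hr, Submodule.map_top, LinearMap.range_eq_top.2 hg, LinearMap.le_ker_iff_map.1 h0,
    relLength_top_bot] at h
  rw [h]
  refine Finset.sum_le_sum fun i _ => ?_
  rw [Nat.mono_cast.map_min]
  refine le_min ((relLength_map_le g _ _).trans (hd i)) (relLength_le_of_span hϖ v hv ?_)
  rintro _ ⟨x, hx, rfl⟩
  exact ⟨ϖ • x, hB' i x hx, map_smul g ϖ x⟩

open scoped Pointwise

theorem relLength_le_finrank [IsDomain A] [IsPrincipalIdealRing A] [Module.Finite A M]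
    [Module.IsTorsionFree A M] (hϖ : Module.length R (A ⧸ Ideal.span {ϖ}) ≤ 1)
    {B C : Submodule A M} (h : ∀ x ∈ B, ϖ • x ∈ C) :
    relLength R B C ≤ Module.finrank A B := by
  let b := Module.finBasis A B
  refine (length_le_card_of_span_eq_top hϖ ((C.submoduleOf B).mkQ ∘ b) ?_ ?_).trans ?_
  · rw [Set.range_comp, ← Submodule.map_span, b.span_eq, Submodule.map_top, Submodule.range_mkQ]
  · intro y
    obtain ⟨⟨y, hy⟩, rfl⟩ := Submodule.Quotient.mk_surjective _ y
    exact (Submodule.Quotient.mk_eq_zero (C.submoduleOf B)).2 (h y hy)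
  · simp

/-- Multiplication by `ϖ` maps `B / ϖ ^ n B` onto `ϖ B / ϖ ^ (n + 1) B`. Only this upper bound is
needed later. -/
theorem relLength_pow_smul_le [IsDomain A] [IsPrincipalIdealRing A] [Module.Finite A M]
    [Module.IsTorsionFree A M] (hϖ : Module.length R (A ⧸ Ideal.span {ϖ}) ≤ 1)
    (B : Submodule A M) (n : ℕ) :
    relLength R B (ϖ ^ n • B) ≤ n * Module.finrank A B := by
  induction n with
  | zero => simp [relLength_self]
  | succ n ih =>
    rw [pow_succ', mul_smul, relLength_add (C := ϖ • B) (D := ϖ • ϖ ^ n • B)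
      (Submodule.map_mono (Submodule.smul_le_self_of_tower _ _))
      (Submodule.smul_le_self_of_tower _ _), Nat.cast_succ, add_mul, one_mul, add_comm]
    refine add_le_add ?_ (relLength_le_finrank hϖ fun x hx =>
      Submodule.smul_mem_pointwise_smul x ϖ B hx)
    exact (relLength_map_le (LinearMap.lsmul A M ϖ) B (ϖ ^ n • B)).trans ih

end Generators

/-! ### Completeness with respect to a principal ideal. -/

section Complete

open scoped Pointwise

variable {A M : Type*} [CommRing A] [AddCommGroup M] [Module A M]

theorem span_singleton_pow_smul_top (ϖ : A) (n : ℕ) :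
    (Ideal.span {ϖ} ^ n • ⊤ : Submodule A M) = ϖ ^ n • ⊤ := by
  rw [Ideal.span_singleton_pow, Submodule.ideal_span_singleton_smul]

theorem mem_smul_top {a : A} {x : M} : x ∈ (a • ⊤ : Submodule A M) ↔ ∃ y, a • y = x := by
  rw [Submodule.mem_smul_pointwise_iff_exists]
  simp

theorem pow_smul_top_anti (ϖ : A) {m n : ℕ} (h : m ≤ n) :
    (ϖ ^ n • ⊤ : Submodule A M) ≤ ϖ ^ m • ⊤ := by
  intro x hx
  obtain ⟨y, rfl⟩ := mem_smul_top.1 hx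
  exact mem_smul_top.2 ⟨ϖ ^ (n - m) • y, by rw [smul_smul, ← pow_add, Nat.add_sub_cancel' h]⟩

theorem isPrecomplete_span_singleton_iff (ϖ : A) :
    IsPrecomplete (Ideal.span {ϖ}) M ↔
      ∀ f : ℕ → M, (∀ n, f (n + 1) - f n ∈ (ϖ ^ n • ⊤ : Submodule A M)) →
        ∃ L, ∀ n, L - f n ∈ (ϖ ^ n • ⊤ : Submodule A M) := by
  rw [isPrecomplete_iff]
  simp only [span_singleton_pow_smul_top, SModEq.sub_mem]
  constructor
  · intro H f hf
    obtain ⟨L, hL⟩ := H f <| by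
      intro m n hmn
      induction n, hmn using Nat.le_induction with
      | base => simp
      | succ n hmn ih =>
        have := Submodule.neg_mem _ (pow_smul_top_anti ϖ hmn (hf n))
        have h := add_mem ih this
        rwa [neg_sub, sub_add_sub_cancel] at h
    exact ⟨L, fun n => by rw [← neg_sub]; exact Submodule.neg_mem _ (hL n)⟩
  · intro H f hf
    obtain ⟨L, hL⟩ := H f fun n => by
      rw [← neg_sub]
      exact Submodule.neg_mem _ (hf n.le_succ)
    exact ⟨L, fun n => by rw [← neg_sub]; exact Submodule.neg_mem _ (hL n)⟩

/-- Consecutive differences are `ϖ ^ n` times combinations of generators. The resulting series in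
`ϖ` converge in `A`, one for each generator. -/
theorem IsPrecomplete.of_finite (ϖ : A) [IsPrecomplete (Ideal.span {ϖ}) A] [Module.Finite A M] :
    IsPrecomplete (Ideal.span {ϖ}) M := by
  rw [isPrecomplete_span_singleton_iff]
  intro f hf
  obtain ⟨c, v, hv⟩ := Module.Finite.exists_fin (R := A) (M := M)
  have hy (n : ℕ) : ∃ a : Fin c → A, ϖ ^ n • ∑ i, a i • v i = f (n + 1) - f n := by
    obtain ⟨y, hy⟩ := mem_smul_top.1 (hf n)
    have : y ∈ Submodule.span A (Set.range v) := hv ▸ trivial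
    obtain ⟨a, ha⟩ := (Submodule.mem_span_range_iff_exists_fun A).1 this
    exact ⟨a, by rw [ha, hy]⟩
  choose a ha using hy
  have hL (i : Fin c) : ∃ L : A, ∀ n,
      L - ∑ j ∈ Finset.range n, ϖ ^ j * a j i ∈ (ϖ ^ n • ⊤ : Submodule A A) := by
    refine (isPrecomplete_span_singleton_iff ϖ).1 inferInstance
      (fun n => ∑ j ∈ Finset.range n, ϖ ^ j * a j i) fun n => ?_
    rw [Finset.sum_range_succ, add_sub_cancel_left]
    exact mem_smul_top.2 ⟨a n i, rfl⟩
  choose L hL using hL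
  refine ⟨f 0 + ∑ i, L i • v i, fun n => ?_⟩
  have hfn : f n = f 0 + ∑ i, (∑ j ∈ Finset.range n, ϖ ^ j * a j i) • v i := by
    have : ∑ j ∈ Finset.range n, (f (j + 1) - f j) = f n - f 0 := Finset.sum_range_sub f n
    rw [← sub_eq_iff_eq_add', ← this]
    simp_rw [← ha, Finset.smul_sum, Finset.sum_smul]
    rw [Finset.sum_comm]
    simp_rw [mul_smul]
  rw [hfn, add_sub_add_left_eq_sub, ← Finset.sum_sub_distrib]
  refine sum_mem fun i _ => ?_
  obtain ⟨b, hb⟩ := mem_smul_top.1 (hL i n)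
  exact mem_smul_top.2 ⟨b • v i, by rw [← sub_smul, ← hb, smul_assoc]⟩

/-- A Cauchy sequence `f` for `ϖ` contains the subsequence `f (e * n)`, which is Cauchy for `ϖ ^ e`;
its limit is also a limit of `f`. -/
theorem IsPrecomplete.of_pow {ϖ : A} {e : ℕ} (he : 0 < e)
    [IsPrecomplete (Ideal.span {ϖ ^ e}) M] : IsPrecomplete (Ideal.span {ϖ}) M := by
  rw [isPrecomplete_iff]
  simp only [span_singleton_pow_smul_top, SModEq.sub_mem]
  intro f hf
  obtain ⟨L, hL⟩ := (isPrecomplete_span_singleton_iff (M := M) (ϖ ^ e)).1 inferInstance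
    (fun n => f (e * n)) fun n => by
      rw [← pow_mul, ← neg_sub]
      exact Submodule.neg_mem _ (hf (Nat.mul_le_mul_left e n.le_succ))
  refine ⟨L, fun n => ?_⟩
  have h1 : n ≤ e * n := Nat.le_mul_of_pos_left n he
  have h2 := hL n
  rw [← pow_mul] at h2
  have h3 := sub_mem (hf h1) (pow_smul_top_anti ϖ h1 h2)
  rwa [sub_sub_eq_add_sub, sub_add_cancel] at h3

end Complete

/-! ### Semilinear endomorphisms and the Fitting decomposition. -/

section Semilinear

open scoped Pointwise

variable {A N : Type*} [CommRing A] [AddCommGroup N] [Module A N]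

theorem addEnd_mul_apply (φ ψ : AddMonoid.End N) (x : N) : (φ * ψ) x = φ (ψ x) := rfl

/-- The additive endomorphism `φ` is semilinear with respect to an automorphism of `A` that
fixes `ϖ`. -/
def IsSemilinear (ϖ : A) (φ : AddMonoid.End N) : Prop :=
  ∃ σ : A ≃+* A, σ ϖ = ϖ ∧ ∀ (a : A) (x : N), φ (a • x) = σ a • φ x

namespace IsSemilinear

variable {ϖ : A} {φ : AddMonoid.End N}

theorem one : IsSemilinear ϖ (1 : AddMonoid.End N) :=
  ⟨RingEquiv.refl A, rfl, fun _ _ => rfl⟩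

theorem mul {ψ : AddMonoid.End N} (hφ : IsSemilinear ϖ φ) (hψ : IsSemilinear ϖ ψ) :
    IsSemilinear ϖ (φ * ψ) := by
  obtain ⟨σ, h1, h2⟩ := hφ
  obtain ⟨ρ, h3, h4⟩ := hψ
  exact ⟨ρ.trans σ, by simp [h1, h3], fun a x => by simp [h2, h4]⟩

theorem pow (hφ : IsSemilinear ϖ φ) (n : ℕ) : IsSemilinear ϖ (φ ^ n) := by
  induction n with
  | zero => exact one
  | succ n ih => exact pow_succ φ n ▸ ih.mul hφ

theorem map_pow_smul (hφ : IsSemilinear ϖ φ) (n : ℕ) (x : N) :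
    φ (ϖ ^ n • x) = ϖ ^ n • φ x := by
  obtain ⟨σ, h1, h2⟩ := hφ
  rw [h2, map_pow, h1]

theorem map_mem_pow_smul_top (hφ : IsSemilinear ϖ φ) {n : ℕ} {x : N}
    (hx : x ∈ (ϖ ^ n • ⊤ : Submodule A N)) : φ x ∈ (ϖ ^ n • ⊤ : Submodule A N) := by
  obtain ⟨y, rfl⟩ := mem_smul_top.1 hx
  exact mem_smul_top.2 ⟨φ y, (hφ.map_pow_smul n y).symm⟩

/-- The image of a submodule under a semilinear map. -/
def map (hφ : IsSemilinear ϖ φ) (B : Submodule A N) : Submodule A N where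
  carrier := φ '' B
  add_mem' := by
    rintro _ _ ⟨x, hx, rfl⟩ ⟨y, hy, rfl⟩
    exact ⟨x + y, add_mem hx hy, map_add φ x y⟩
  zero_mem' := ⟨0, zero_mem B, map_zero φ⟩
  smul_mem' := by
    rintro a _ ⟨x, hx, rfl⟩
    obtain ⟨σ, h1, h2⟩ := hφ
    exact ⟨σ.symm a • x, B.smul_mem _ hx, by rw [h2, σ.apply_symm_apply]⟩

theorem coe_map (hφ : IsSemilinear ϖ φ) (B : Submodule A N) : (hφ.map B : Set N) = φ '' B := rfl

theorem mem_map (hφ : IsSemilinear ϖ φ) {B : Submodule A N} {y : N} :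
    y ∈ hφ.map B ↔ ∃ x ∈ B, φ x = y := Iff.rfl

theorem map_mono (hφ : IsSemilinear ϖ φ) {B C : Submodule A N} (h : B ≤ C) :
    hφ.map B ≤ hφ.map C := Set.image_mono h

/-- The preimage of a submodule under a semilinear map. -/
def comap (hφ : IsSemilinear ϖ φ) (B : Submodule A N) : Submodule A N where
  carrier := φ ⁻¹' B
  add_mem' hx hy := by
    simp only [Set.mem_preimage, map_add]
    exact add_mem hx hy
  zero_mem' := by simp
  smul_mem' a x hx := by
    obtain ⟨σ, h1, h2⟩ := hφ
    simp only [Set.mem_preimage, h2]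
    exact B.smul_mem _ hx

theorem mem_comap (hφ : IsSemilinear ϖ φ) {B : Submodule A N} {x : N} :
    x ∈ hφ.comap B ↔ φ x ∈ B := Iff.rfl

theorem map_sup (hφ : IsSemilinear ϖ φ) (B C : Submodule A N) :
    hφ.map (B ⊔ C) = hφ.map B ⊔ hφ.map C := by
  refine le_antisymm ?_ (sup_le (hφ.map_mono le_sup_left) (hφ.map_mono le_sup_right))
  rintro _ ⟨x, hx, rfl⟩
  obtain ⟨y, hy, z, hz, rfl⟩ := Submodule.mem_sup.1 hx
  rw [map_add]
  exact Submodule.add_mem_sup ⟨y, hy, rfl⟩ ⟨z, hz, rfl⟩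

theorem map_pow_smul_submodule (hφ : IsSemilinear ϖ φ) (n : ℕ) (B : Submodule A N) :
    hφ.map (ϖ ^ n • B) = ϖ ^ n • hφ.map B := by
  ext y
  simp only [mem_map, Submodule.mem_smul_pointwise_iff_exists]
  constructor
  · rintro ⟨_, ⟨x, hx, rfl⟩, rfl⟩
    exact ⟨φ x, ⟨x, hx, rfl⟩, (hφ.map_pow_smul n x).symm⟩
  · rintro ⟨_, ⟨x, hx, rfl⟩, rfl⟩
    exact ⟨ϖ ^ n • x, ⟨x, hx, rfl⟩, hφ.map_pow_smul n x⟩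

/-- Fitting decomposition: the module is the sum of a submodule on which the semilinear map `φ`
is surjective and the set of elements on which `φ` is topologically nilpotent. -/
theorem exists_fitting [IsNoetherian A N] (hφ : IsSemilinear ϖ φ)
    (hart : ∀ n : ℕ, IsArtinian A (N ⧸ (ϖ ^ n • ⊤ : Submodule A N)))
    (hcomp : IsPrecomplete (Ideal.span {ϖ}) N) (hhaus : IsHausdorff (Ideal.span {ϖ}) N) :
    ∃ Λ : Submodule A N, hφ.map Λ = Λ ∧
      ∀ x, ∃ u ∈ Λ, ∀ n, ∃ r, (φ ^ r) (x - u) ∈ (ϖ ^ n • ⊤ : Submodule A N) := by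
  let P (n : ℕ) : Submodule A N := ϖ ^ n • ⊤
  -- `I r n` is the preimage in `N` of the image of `φ ^ r` on the Artinian module `N / ϖ ^ n`, so
  -- it is eventually constant in `r`.
  let I (r n : ℕ) : Submodule A N := (hφ.pow r).map ⊤ ⊔ P n
  have hPanti {m n : ℕ} (h : m ≤ n) : P n ≤ P m := pow_smul_top_anti ϖ h
  have hIanti {r r' : ℕ} (n : ℕ) (h : r ≤ r') : I r' n ≤ I r n := by
    refine sup_le_sup_right ?_ _
    rintro _ ⟨x, -, rfl⟩
    refine ⟨(φ ^ (r' - r)) x, trivial, ?_⟩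
    rw [← addEnd_mul_apply, ← pow_add, Nat.add_sub_cancel' h]
  have hstab (n : ℕ) : ∃ R, ∀ r, R ≤ r → I R n = I r n := by
    have := hart n
    let g : ℕ →o (Submodule A (N ⧸ P n))ᵒᵈ :=
      ⟨fun r => OrderDual.toDual ((I r n).map (P n).mkQ), fun r r' h =>
        Submodule.map_mono (hIanti n h)⟩
    obtain ⟨R, hR⟩ := IsArtinian.monotone_stabilizes g
    refine ⟨R, fun r hr => ?_⟩
    have h1 : (I R n).map (P n).mkQ = (I r n).map (P n).mkQ := hR r hr
    have h2 := congrArg (Submodule.comap (P n).mkQ) h1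
    rwa [Submodule.comap_map_mkQ, Submodule.comap_map_mkQ, sup_eq_right.2 le_sup_right,
      sup_eq_right.2 le_sup_right] at h2
  choose R hR using hstab
  -- The stable image modulo `ϖ ^ n`. The submodule sought is the intersection of all `D n`.
  let D (n : ℕ) : Submodule A N := ⨅ r, I r n
  have hD (n r : ℕ) (hr : R n ≤ r) : D n = I r n := by
    refine le_antisymm (iInf_le _ r) (le_iInf fun r' => ?_)
    rcases le_total r r' with h | h
    · rw [← hR n r hr, hR n r' (hr.trans h)]
    · exact hIanti n h
  have hPD (n : ℕ) : P n ≤ D n := le_iInf fun r => le_sup_right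
  have hDanti {m n : ℕ} (h : m ≤ n) : D n ≤ D m := iInf_mono fun r => sup_le_sup_left (hPanti h) _
  have hUD (n : ℕ) {x : N} (hx : x ∈ D n) : φ x ∈ D n := by
    rw [hD n (R n) le_rfl] at hx
    obtain ⟨_, ⟨y, -, rfl⟩, z, hz, rfl⟩ := Submodule.mem_sup.1 hx
    rw [hD n (R n) le_rfl, map_add]
    refine Submodule.add_mem_sup ⟨φ y, trivial, ?_⟩ (hφ.map_mem_pow_smul_top hz)
    rw [← addEnd_mul_apply, ← addEnd_mul_apply, ← pow_succ, ← pow_succ']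
  -- `φ` is injective on `D n` modulo `P n`
  have hinj (n r : ℕ) {x : N} (hx : x ∈ D n) (hr : (φ ^ r) x ∈ P n) : x ∈ P n := by
    -- The kernels of `φ ^ j` on `N / ϖ ^ n` stabilize too. Modulo `ϖ ^ n`, `x` is `φ ^ j'` of some
    -- `y`, and `y` lies in the stable kernel, so `φ ^ j'` already sends it to zero.
    let g : ℕ →o Submodule A N := ⟨fun j => (hφ.pow j).comap (P n), monotone_nat_of_le_succ
      fun j y hy => by
        rw [mem_comap, pow_succ', addEnd_mul_apply]
        exact hφ.map_mem_pow_smul_top hy⟩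
    obtain ⟨j, hj⟩ := monotone_stabilizes_iff_noetherian.2 ‹_› g
    let j' := max j (R n)
    rw [hD n j' (le_max_right _ _)] at hx
    obtain ⟨_, ⟨y, -, rfl⟩, z, hz, rfl⟩ := Submodule.mem_sup.1 hx
    refine add_mem ?_ hz
    rw [map_add] at hr
    have h1 : (φ ^ r) ((φ ^ j') y) ∈ P n :=
      (Submodule.add_mem_iff_left _ ((hφ.pow r).map_mem_pow_smul_top hz)).1 hr
    rw [← addEnd_mul_apply, ← pow_add] at h1
    have h2 : y ∈ g (r + j') := h1
    rw [← hj _ ((le_max_left j (R n)).trans (Nat.le_add_left _ _)),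
      hj j' (le_max_left _ _)] at h2
    exact h2
  -- Passage to the limit: conditions that are solvable at each level, compatible, and determine the
  -- solution modulo `ϖ ^ n` have a common solution by completeness.
  have hlim (S : ℕ → N → Prop) (hne : ∀ n, ∃ x, S n x) (hS : ∀ n x, S (n + 1) x → S n x)
      (hu : ∀ n x y, S n x → S n y → x - y ∈ P n) (hc : ∀ n x y, S n x → y - x ∈ P n → S n y) :
      ∃ x, ∀ n, S n x := by
    choose f hf using hne
    obtain ⟨L, hL⟩ := (isPrecomplete_span_singleton_iff ϖ).1 hcomp f fun n =>
      hu n _ _ (hS n _ (hf (n + 1))) (hf n)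
    exact ⟨L, fun n => hc n _ _ (hf n) (hL n)⟩
  refine ⟨⨅ n, D n, ?_, ?_⟩
  · apply le_antisymm
    · rintro _ ⟨x, hx, rfl⟩
      exact (Submodule.mem_iInf _).2 fun n => hUD n ((Submodule.mem_iInf _).1 hx n)
    · intro y hy
      rw [Submodule.mem_iInf] at hy
      have hx : ∃ x, ∀ n, x ∈ D n ∧ φ x - y ∈ P n := by
        refine hlim (fun n x => x ∈ D n ∧ φ x - y ∈ P n) ?_ ?_ ?_ ?_
        · intro n
          have hy' := hy n
          rw [hD n (R n + 1) (Nat.le_succ _)] at hy'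
          obtain ⟨_, ⟨w, -, rfl⟩, z, hz, rfl⟩ := Submodule.mem_sup.1 hy'
          refine ⟨(φ ^ R n) w, ?_, ?_⟩
          · rw [hD n (R n) le_rfl]
            exact Submodule.mem_sup_left ⟨w, trivial, rfl⟩
          · rw [pow_succ', addEnd_mul_apply, sub_add_cancel_left]
            exact Submodule.neg_mem _ hz
        · exact fun n x hx => ⟨hDanti n.le_succ hx.1, hPanti n.le_succ hx.2⟩
        · intro n x z hx hz
          refine hinj n 1 (sub_mem hx.1 hz.1) ?_
          rw [pow_one, map_sub]
          have := sub_mem hx.2 hz.2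
          rwa [sub_sub_sub_cancel_right] at this
        · intro n x z hx hz
          refine ⟨by simpa using add_mem (hPD n hz) hx.1, ?_⟩
          have := add_mem (hφ.map_mem_pow_smul_top hz) hx.2
          rwa [map_sub, sub_add_sub_cancel] at this
      obtain ⟨x, hx⟩ := hx
      refine ⟨x, (Submodule.mem_iInf _).2 fun n => (hx n).1, ?_⟩
      rw [← sub_eq_zero]
      refine hhaus.haus _ fun n => ?_
      rw [span_singleton_pow_smul_top, SModEq.sub_mem, sub_zero]
      exact (hx n).2
  · intro x
    have hu : ∃ u, ∀ n, u ∈ D n ∧ ∃ r, (φ ^ r) (x - u) ∈ P n := by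
      refine hlim (fun n u => u ∈ D n ∧ ∃ r, (φ ^ r) (x - u) ∈ P n) ?_ ?_ ?_ ?_
      · intro n
        -- Fitting's argument: `φ ^ R x` is congruent to `φ ^ (2R) w`, so `u = φ ^ R w` lies in the
        -- stable image and `φ ^ R` kills `x - u` modulo `ϖ ^ n`.
        have h1 : (φ ^ R n) x ∈ I (R n + R n) n := by
          rw [← hR n _ (Nat.le_add_left _ _)]
          exact Submodule.mem_sup_left ⟨x, trivial, rfl⟩
        obtain ⟨_, ⟨w, -, rfl⟩, z, hz, hwz⟩ := Submodule.mem_sup.1 h1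
        refine ⟨(φ ^ R n) w, ?_, R n, ?_⟩
        · rw [hD n (R n) le_rfl]
          exact Submodule.mem_sup_left ⟨w, trivial, rfl⟩
        · rw [map_sub, ← addEnd_mul_apply, ← pow_add, ← hwz, add_sub_cancel_left]
          exact hz
      · rintro n u ⟨h1, r, h2⟩
        exact ⟨hDanti n.le_succ h1, r, hPanti n.le_succ h2⟩
      · rintro n u u' ⟨h1, r, h2⟩ ⟨h1', r', h2'⟩
        refine hinj n (r + r') (sub_mem h1 h1') ?_
        have e : u - u' = (x - u') - (x - u) := by abel
        rw [e, map_sub]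
        refine sub_mem ?_ ?_
        · rw [pow_add, addEnd_mul_apply]
          exact (hφ.pow r).map_mem_pow_smul_top h2'
        · rw [add_comm, pow_add, addEnd_mul_apply]
          exact (hφ.pow r').map_mem_pow_smul_top h2
      · rintro n u u' ⟨h1, r, h2⟩ h3
        refine ⟨by simpa using add_mem (hPD n h3) h1, r, ?_⟩
        have e : x - u' = (x - u) - (u' - u) := by abel
        rw [e, map_sub]
        exact sub_mem h2 ((hφ.pow r).map_mem_pow_smul_top h3)
    obtain ⟨u, hu⟩ := hu
    exact ⟨u, (Submodule.mem_iInf _).2 fun n => (hu n).1, fun n => (hu n).2⟩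

end IsSemilinear

end Semilinear

/-! ### Slopes realized on lattices. -/

section Slopes

open scoped Pointwise

variable {A : Type*} [CommRing A] [IsDomain A] [IsDiscreteValuationRing A] {ϖ : A}

theorem length_quotient_span_irreducible_le_one (hϖ : Irreducible ϖ) :
    Module.length A (A ⧸ Ideal.span {ϖ}) ≤ 1 := by
  rw [← hϖ.maximalIdeal_eq]
  have : IsSimpleModule A (A ⧸ IsLocalRing.maximalIdeal A) :=
    isSimpleModule_iff_isCoatom.2 (IsLocalRing.maximalIdeal.isMaximal A).out
  exact (Module.length_eq_one A _).le

theorem span_irreducible_le_jacobson (hϖ : Irreducible ϖ) :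
    Ideal.span {ϖ} ≤ Ideal.jacobson (⊥ : Ideal A) := by
  rw [← hϖ.maximalIdeal_eq, IsLocalRing.jacobson_eq_maximalIdeal _ bot_ne_top]

variable {N : Type*} [AddCommGroup N] [Module A N]

theorem exists_pow_smul_top_le_of_forall [Module.Finite A N] {B : Submodule A N}
    (h : ∀ x, ∃ n : ℕ, ϖ ^ n • x ∈ B) : ∃ c : ℕ, (ϖ ^ c • ⊤ : Submodule A N) ≤ B := by
  obtain ⟨n, v, hv⟩ := Module.Finite.exists_fin (R := A) (M := N)
  choose f hf using fun i => h (v i)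
  refine ⟨∑ i, f i, fun y hy => ?_⟩
  obtain ⟨x, rfl⟩ := mem_smul_top.1 hy
  have hx : x ∈ Submodule.span A (Set.range v) := hv ▸ trivial
  induction hx using Submodule.span_induction with
  | mem x hx =>
    obtain ⟨i, rfl⟩ := hx
    rw [← Finset.sum_erase_add _ _ (Finset.mem_univ i), pow_add, mul_smul]
    exact B.smul_mem _ (hf i)
  | zero => simp
  | add x y _ _ hx' hy' =>
    rw [smul_add]
    exact add_mem (hx' (mem_smul_top.2 ⟨x, rfl⟩)) (hy' (mem_smul_top.2 ⟨y, rfl⟩))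
  | smul a x _ hx =>
    rw [smul_comm]
    exact B.smul_mem _ (hx (mem_smul_top.2 ⟨x, rfl⟩))

/-- Equal ranks make `N ⧸ B` torsion, and over a discrete valuation ring a torsion element is killed
by a power of `ϖ`. -/
theorem exists_pow_smul_top_le_of_finrank_eq [Module.Finite A N] (hϖ : Irreducible ϖ)
    {B : Submodule A N} (h : Module.finrank A B = Module.finrank A N) :
    ∃ c : ℕ, (ϖ ^ c • ⊤ : Submodule A N) ≤ B := by
  refine exists_pow_smul_top_le_of_forall fun x => ?_
  have h1 : Module.finrank A (N ⧸ B) = 0 := by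
    have := B.finrank_quotient_add_finrank
    omega
  obtain ⟨a, ha, hax⟩ := Module.finrank_eq_zero_iff.1 h1 (B.mkQ x)
  obtain ⟨n, u, rfl⟩ := IsDiscreteValuationRing.eq_unit_mul_pow_irreducible ha hϖ
  refine ⟨n, ?_⟩
  have h2 : (u * ϖ ^ n : A) • x ∈ B := (Submodule.Quotient.mk_eq_zero B).1 hax
  rw [mul_smul] at h2
  have h3 := B.smul_mem ((u⁻¹ : Aˣ) : A) h2
  rwa [smul_smul, Units.inv_mul, one_smul] at h3

variable [Module.IsTorsionFree A N]

theorem pow_smul_cancel (hϖ : Irreducible ϖ) {n : ℕ} {x y : N}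
    (h : ϖ ^ n • x = ϖ ^ n • y) : x = y :=
  smul_right_injective N (pow_ne_zero n hϖ.ne_zero) h

theorem pow_smul_mem_pow_smul_top (hϖ : Irreducible ϖ) {m n : ℕ} {x : N} :
    ϖ ^ m • x ∈ (ϖ ^ (m + n) • ⊤ : Submodule A N) ↔ x ∈ (ϖ ^ n • ⊤ : Submodule A N) := by
  constructor
  · intro h
    obtain ⟨y, hy⟩ := mem_smul_top.1 h
    rw [pow_add, mul_smul] at hy
    exact mem_smul_top.2 ⟨y, pow_smul_cancel hϖ hy⟩
  · intro h
    obtain ⟨y, rfl⟩ := mem_smul_top.1 h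
    exact mem_smul_top.2 ⟨y, by rw [pow_add, mul_smul]⟩

variable [Module.Finite A N]

theorem eq_zero_of_forall_mem_pow_smul_top (hϖ : Irreducible ϖ) {x : N}
    (h : ∀ n : ℕ, x ∈ (ϖ ^ n • ⊤ : Submodule A N)) : x = 0 := by
  refine (IsHausdorff.of_le_jacobson (Ideal.span {ϖ}) N (span_irreducible_le_jacobson hϖ)).haus x
    fun n => ?_
  rw [span_singleton_pow_smul_top, SModEq.sub_mem, sub_zero]
  exact h n

theorem isArtinian_quotient_pow_smul_top (hϖ : Irreducible ϖ) (n : ℕ) :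
    IsArtinian A (N ⧸ (ϖ ^ n • ⊤ : Submodule A N)) := by
  have h := relLength_pow_smul_le (length_quotient_span_irreducible_le_one hϖ)
    (⊤ : Submodule A N) n
  rw [relLength_top] at h
  have h' : Module.length A (N ⧸ (ϖ ^ n • ⊤ : Submodule A N)) ≠ ⊤ :=
    ne_top_of_le_ne_top (by exact_mod_cast ENat.natCast_ne_top _) h
  exact (isFiniteLength_iff_isNoetherian_isArtinian.1 (Module.length_ne_top_iff.1 h')).2

variable {φ : AddMonoid.End N}

/-- If `φ ^ s` is divisible by `ϖ ^ m`, then there is a lattice on which `φ ^ s'` is divisible by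
`ϖ ^ m'`, with `m' / s' ≥ m / s` and `s'` bounded by the rank. -/
theorem exists_stable_lattice [Nontrivial N] (hϖ : Irreducible ϖ) (hφ : IsSemilinear ϖ φ)
    {s m : ℕ} (hs : 0 < s) (h : ∀ x, (φ ^ s) x ∈ (ϖ ^ m • ⊤ : Submodule A N)) :
    ∃ s' m' c : ℕ, 0 < s' ∧ s' ≤ Module.finrank A N ∧ m * s' ≤ m' * s ∧
      ∃ B : Submodule A N, ϖ ^ c • ⊤ ≤ B ∧ ∀ x ∈ B, (φ ^ s') x ∈ ϖ ^ m' • B := by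
  -- With `v` the `ϖ`-adic order on `N`, `x ∈ L c` means `v (φ ^ i x) ≥ (c + m i) / s` for all `i`:
  -- the inequality on `j` says that `j` is at most the ceiling of this fraction. Thus `ϖ` raises
  -- the index `c` by `s` and `φ` raises it by at least `m`, as for an operator of slope `m / s`.
  let L (c : ℕ) : Submodule A N :=
    ⨅ (i : ℕ) (j : ℕ) (_ : j * s < c + m * i + s), (hφ.pow i).comap (ϖ ^ j • ⊤)
  have mem_L {c : ℕ} {x : N} : x ∈ L c ↔
      ∀ i j, j * s < c + m * i + s → (φ ^ i) x ∈ (ϖ ^ j • ⊤ : Submodule A N) := by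
    simp only [L, Submodule.mem_iInf, IsSemilinear.mem_comap]
  have hLanti {c c' : ℕ} (hc : c ≤ c') : L c' ≤ L c := fun x hx =>
    mem_L.2 fun i j hij => mem_L.1 hx i j (by omega)
  have hLs (c : ℕ) : L (c + s) = ϖ • L c := by
    apply le_antisymm
    · intro x hx
      rw [mem_L] at hx
      have h1 := hx 0 1 (by omega)
      rw [pow_one, pow_zero] at h1
      obtain ⟨y, rfl⟩ := mem_smul_top.1 h1
      refine Submodule.smul_mem_pointwise_smul y ϖ _ (mem_L.2 fun i j hij => ?_)
      have h2 := hx i (1 + j) (by rw [add_mul]; omega)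
      have h3 := (hφ.pow i).map_pow_smul 1 y
      rw [pow_one] at h3
      rw [h3] at h2
      have h4 := pow_smul_mem_pow_smul_top (N := N) hϖ (m := 1) (n := j) (x := (φ ^ i) y)
      rw [pow_one] at h4
      exact h4.1 h2
    · intro x hx
      obtain ⟨y, hy, rfl⟩ := (Submodule.mem_smul_pointwise_iff_exists _ _ _).1 hx
      refine mem_L.2 fun i j hij => ?_
      rcases j with _ | j
      · simp
      · have h3 := (hφ.pow i).map_pow_smul 1 y
        have h4 := pow_smul_mem_pow_smul_top (N := N) hϖ (m := 1) (n := j) (x := (φ ^ i) y)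
        rw [pow_one] at h3 h4
        rw [h3, add_comm j 1]
        exact h4.2 (mem_L.1 hy i j (by rw [add_mul] at hij; omega))
  have hLks (c k : ℕ) : L (c + k * s) = ϖ ^ k • L c := by
    induction k with
    | zero => simp
    | succ k ih => rw [add_mul, one_mul, ← add_assoc, hLs, ih, smul_smul, pow_succ']
  have hLφ {c : ℕ} {x : N} (hx : x ∈ L c) : φ x ∈ L (c + m) := by
    refine mem_L.2 fun i j hij => ?_
    have := mem_L.1 hx (i + 1) j (by rw [mul_add]; omega)
    rwa [pow_succ, addEnd_mul_apply] at this
  have hpow (r : ℕ) (x : N) : (φ ^ (s * r)) x ∈ (ϖ ^ (m * r) • ⊤ : Submodule A N) := by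
    induction r generalizing x with
    | zero => simp
    | succ r ih =>
      rw [show s * (r + 1) = s * r + s by ring, pow_add φ, addEnd_mul_apply]
      obtain ⟨y, hy⟩ := mem_smul_top.1 (h x)
      rw [← hy, (hφ.pow _).map_pow_smul, mul_add, mul_one, add_comm]
      exact (pow_smul_mem_pow_smul_top hϖ).2 (ih y)
  have hLfull (c : ℕ) : (ϖ ^ (c + m + 1) • ⊤ : Submodule A N) ≤ L c := by
    intro y hy
    obtain ⟨x, rfl⟩ := mem_smul_top.1 hy
    refine mem_L.2 fun i j hij => ?_
    rw [(hφ.pow i).map_pow_smul]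
    have h1 : (φ ^ i) x ∈ (ϖ ^ (m * (i / s)) • ⊤ : Submodule A N) := by
      have h2 := hpow (i / s) ((φ ^ (i % s)) x)
      rwa [← addEnd_mul_apply, ← pow_add, Nat.div_add_mod] at h2
    refine pow_smul_top_anti ϖ ?_ ((pow_smul_mem_pow_smul_top hϖ).2 h1)
    by_contra hlt
    have hlt' : c + m + 1 + m * (i / s) + 1 ≤ j := by omega
    have h3 := Nat.mul_le_mul_right s hlt'
    have h4 : m * i ≤ m * (i / s) * s + m * s := by
      calc m * i = m * (s * (i / s) + i % s) := by rw [Nat.div_add_mod]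
        _ = m * (i / s) * s + m * (i % s) := by ring
        _ ≤ _ := Nat.add_le_add_left (Nat.mul_le_mul_left m (Nat.mod_lt i hs).le) _
    have h5 : c ≤ c * s := Nat.le_mul_of_pos_right c hs
    have h6 : (c + m + 1 + m * (i / s) + 1) * s =
        c * s + m * s + s + m * (i / s) * s + s := by ring
    omega
  -- The first jump of the filtration `L` at or after `c`. One exists: otherwise `L c = ϖ L c`, so
  -- `L c = 0` by Nakayama, although `L c` contains a power of `ϖ` times `N`.
  have hjump (c : ℕ) : ∃ c', c ≤ c' ∧ L (c' + 1) ≠ L c' ∧ L c' = L c := by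
    classical
    have hex : ∃ c', c ≤ c' ∧ L (c' + 1) ≠ L c' := by
      by_contra hcon
      push Not at hcon
      have hconst (d : ℕ) : L (c + d) = L c := by
        induction d with
        | zero => rfl
        | succ d ih => rw [← add_assoc, hcon (c + d) (Nat.le_add_right _ _), ih]
      have h1 : L c ≤ Ideal.span {ϖ} • L c := by
        rw [Submodule.ideal_span_singleton_smul, ← hLs, hconst]
      have h2 := Submodule.eq_bot_of_le_smul_of_le_jacobson_bot _ _
        (IsNoetherian.noetherian (L c)) h1 (span_irreducible_le_jacobson hϖ)
      obtain ⟨x, hx⟩ := exists_ne (0 : N)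
      have h3 := hLfull c (mem_smul_top.2 ⟨x, rfl⟩)
      rw [h2, Submodule.mem_bot, ← smul_zero (ϖ ^ (c + m + 1))] at h3
      exact hx (pow_smul_cancel hϖ h3)
    refine ⟨Nat.find hex, (Nat.find_spec hex).1, (Nat.find_spec hex).2, ?_⟩
    have hconst (d : ℕ) (hd : c + d ≤ Nat.find hex) : L (c + d) = L c := by
      induction d with
      | zero => rfl
      | succ d ih =>
        have h1 := Nat.find_min hex (m := c + d) (by omega)
        push Not at h1
        rw [← add_assoc, h1 (Nat.le_add_right _ _), ih (by omega)]
    obtain ⟨d, hd⟩ := Nat.exists_eq_add_of_le (Nat.find_spec hex).1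
    rw [hd]
    exact hconst d hd.ge
  choose nxt hnxt1 hnxt2 hnxt3 using hjump
  -- A sequence of jumps along which `φ` maps `L (J k)` into `L (J k + m) = L (J (k + 1))`.
  let J (k : ℕ) : ℕ := Nat.rec (nxt 0) (fun _ j => nxt (j + m)) k
  have hJsucc (k : ℕ) : J (k + 1) = nxt (J k + m) := rfl
  have hJjump (k : ℕ) : L (J k + 1) ≠ L (J k) := by
    cases k with
    | zero => exact hnxt2 0
    | succ k => exact hnxt2 _
  have hJle (k d : ℕ) : J k + m * d ≤ J (k + d) := by
    induction d with
    | zero => simp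
    | succ d ih =>
      have := hnxt1 (J (k + d) + m)
      rw [← add_assoc, hJsucc, mul_add, mul_one]
      omega
  have hJφ (k d : ℕ) {x : N} (hx : x ∈ L (J k)) : (φ ^ d) x ∈ L (J (k + d)) := by
    induction d with
    | zero => exact hx
    | succ d ih =>
      rw [← add_assoc, hJsucc, hnxt3, pow_succ', addEnd_mul_apply]
      exact hLφ ih
  classical
  have hcount (n : ℕ) : ((Finset.card {c ∈ Finset.range n | L (c + 1) ≠ L c} : ℕ) : ℕ∞) ≤
      relLength A (L 0) (L n) := by
    induction n with
    | zero => simp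
    | succ n ih =>
      rw [relLength_add (hLanti n.le_succ) (hLanti n.zero_le), Finset.range_add_one,
        Finset.filter_insert]
      split_ifs with hn
      · rw [Finset.card_insert_of_notMem (by simp), Nat.cast_add]
        refine add_le_add ih ?_
        rw [Nat.cast_one, Order.one_le_iff_ne_zero, Ne, relLength_eq_zero]
        exact fun hle => hn (le_antisymm (hLanti n.le_succ) hle)
      · exact ih.trans le_self_add
  -- Since `L s = ϖ L 0`, the length of `L 0 / L s` is at most the rank, so at most that many
  -- residues modulo `s` are jumps.
  have hcard : Finset.card {c ∈ Finset.range s | L (c + 1) ≠ L c} ≤ Module.finrank A N := by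
    have h1 := hcount s
    have h2 : relLength A (L 0) (L s) ≤ Module.finrank A (L 0) := by
      refine relLength_le_finrank (length_quotient_span_irreducible_le_one hϖ) fun x hx => ?_
      have := hLs 0
      rw [zero_add] at this
      rw [this]
      exact Submodule.smul_mem_pointwise_smul x ϖ _ hx
    have h3 := h1.trans h2
    exact (Nat.cast_le.1 h3).trans (Submodule.finrank_le _)
  have hmaps : ∀ k ∈ Finset.range (Module.finrank A N + 1),
      J k % s ∈ ({c ∈ Finset.range s | L (c + 1) ≠ L c} : Finset ℕ) := by
    intro k _
    refine Finset.mem_filter.2 ⟨Finset.mem_range.2 (Nat.mod_lt _ hs), fun heq => hJjump k ?_⟩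
    have h1 : J k = J k % s + J k / s * s := by rw [mul_comm]; exact (Nat.mod_add_div _ _).symm
    rw [h1, add_right_comm, hLks, hLks, heq]
  -- Among `J 0, …, J (rank)` two agree modulo `s`. If `J (k + d) = J k + b * s`, then `φ ^ d` maps
  -- `L (J k)` into `ϖ ^ b L (J k)`, and `J (k + d) ≥ J k + m * d` gives `b / d ≥ m / s`.
  obtain ⟨k, hk, k', hk', hne, heq⟩ := Finset.exists_ne_map_eq_of_card_lt_of_maps_to
    (by rw [Finset.card_range]; exact Nat.lt_succ_of_le hcard) hmaps
  wlog hlt : k < k' generalizing k k'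
  · exact this k' hk' k hk hne.symm heq.symm (lt_of_le_of_ne (not_lt.1 hlt) hne.symm)
  obtain ⟨d, rfl⟩ := Nat.exists_eq_add_of_le hlt.le
  have hle := hJle k d
  have hJle' : J k ≤ J (k + d) := by omega
  obtain ⟨b, hb⟩ := (Nat.modEq_iff_dvd' hJle').1 heq
  have hb' : J (k + d) = J k + b * s := by
    rw [mul_comm]
    omega
  refine ⟨d, b, _, by omega, ?_, ?_, L (J k), hLfull _, fun x hx => ?_⟩
  · rw [Finset.mem_range] at hk'
    omega
  · omega
  · rw [← hLks, ← hb']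
    exact hJφ k d hx

/-- The elements on which `ϖ ^ (-m) φ ^ s` is topologically nilpotent. -/
def nilPart (hφ : IsSemilinear ϖ φ) (s m : ℕ) : Submodule A N where
  carrier := {x | ∀ j, ∃ r₀, ∀ r, r₀ ≤ r → (φ ^ (s * r)) x ∈ (ϖ ^ (m * r + j) • ⊤ : Submodule A N)}
  add_mem' := by
    intro x y hx hy j
    obtain ⟨r₀, h⟩ := hx j
    obtain ⟨r₁, h'⟩ := hy j
    refine ⟨max r₀ r₁, fun r hr => ?_⟩
    rw [map_add]
    exact add_mem (h r ((le_max_left _ _).trans hr)) (h' r ((le_max_right _ _).trans hr))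
  zero_mem' := fun j => ⟨0, fun r _ => by simp⟩
  smul_mem' := by
    intro a x hx j
    obtain ⟨r₀, h⟩ := hx j
    refine ⟨r₀, fun r hr => ?_⟩
    obtain ⟨σ, -, h2⟩ := hφ.pow (s * r)
    rw [h2]
    exact Submodule.smul_mem _ _ (h r hr)

/-- `U` is `ϖ ^ (-m) ψ`; torsion-freeness lets it be defined on `B` without inverting `ϖ`. -/
theorem exists_divided_map (hϖ : Irreducible ϖ) {ψ : AddMonoid.End N} (hψ : IsSemilinear ϖ ψ)
    {m : ℕ} {B : Submodule A N} (hB : ∀ x ∈ B, ψ x ∈ ϖ ^ m • B) :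
    ∃ U : AddMonoid.End B, IsSemilinear ϖ U ∧
      ∀ (r : ℕ) (x : B), ϖ ^ (m * r) • ((U ^ r) x : N) = (ψ ^ r) x := by
  have h (x : B) : ∃ y : B, ϖ ^ m • (y : N) = ψ x := by
    obtain ⟨y, hy, hyx⟩ := (Submodule.mem_smul_pointwise_iff_exists _ _ _).1 (hB x x.2)
    exact ⟨⟨y, hy⟩, hyx⟩
  choose f hf using h
  let U : AddMonoid.End B :=
    { toFun := f
      map_zero' := Subtype.ext (pow_smul_cancel hϖ (n := m) (by rw [hf]; simp))
      map_add' := fun x y => Subtype.ext (pow_smul_cancel hϖ (n := m) (by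
        rw [hf, Submodule.coe_add, map_add, Submodule.coe_add, smul_add, hf, hf])) }
  have hU (x : B) : ϖ ^ m • (U x : N) = ψ x := hf x
  refine ⟨U, ?_, ?_⟩
  · obtain ⟨σ, h1, h2⟩ := hψ
    refine ⟨σ, h1, fun a x => Subtype.ext (pow_smul_cancel hϖ (n := m) ?_)⟩
    rw [hU, Submodule.coe_smul, h2, ← hU, Submodule.coe_smul, smul_comm]
  · intro r
    induction r with
    | zero => intro x; simp
    | succ r ih =>
      intro x
      rw [pow_succ, pow_succ, addEnd_mul_apply, addEnd_mul_apply, ← hU, hψ.pow r |>.map_pow_smul,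
        ← ih, smul_smul, ← pow_add, mul_add, mul_one, add_comm]

/-- Fitting decomposition of `ϖ ^ (-m) φ ^ s` on `B`: it is surjective on `Λ` and topologically
nilpotent on the remainder, which therefore lies in `nilPart`. -/
theorem exists_slope_submodule (hϖ : Irreducible ϖ) [IsPrecomplete (Ideal.span {ϖ}) A]
    (hφ : IsSemilinear ϖ φ) {s m : ℕ} {B : Submodule A N}
    (hB : ∀ x ∈ B, (φ ^ s) x ∈ ϖ ^ m • B) :
    ∃ Λ : Submodule A N, (hφ.pow s).map Λ = ϖ ^ m • Λ ∧
      ∀ x ∈ B, ∃ u ∈ Λ, x - u ∈ nilPart hφ s m := by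
  obtain ⟨U, hU, hUφ⟩ := exists_divided_map hϖ (hφ.pow s) hB
  obtain ⟨Λ, hΛ, hx⟩ := hU.exists_fitting (isArtinian_quotient_pow_smul_top hϖ)
    (IsPrecomplete.of_finite ϖ)
    (IsHausdorff.of_le_jacobson _ _ (span_irreducible_le_jacobson hϖ))
  have hU1 (x : B) : ϖ ^ m • (U x : N) = (φ ^ s) x := by simpa using hUφ 1 x
  refine ⟨Λ.map B.subtype, ?_, fun x hxB => ?_⟩
  · ext y
    rw [IsSemilinear.mem_map, Submodule.mem_smul_pointwise_iff_exists]
    constructor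
    · rintro ⟨_, ⟨x, hx, rfl⟩, rfl⟩
      refine ⟨U x, ⟨U x, ?_, rfl⟩, hU1 x⟩
      rw [← hΛ]
      exact ⟨x, hx, rfl⟩
    · rintro ⟨_, ⟨x, hx, rfl⟩, rfl⟩
      obtain ⟨z, hz, rfl⟩ := hU.mem_map.1 (hΛ.ge hx)
      exact ⟨z, ⟨z, hz, rfl⟩, (hU1 z).symm⟩
  · obtain ⟨u, hu, hn⟩ := hx ⟨x, hxB⟩
    refine ⟨u, ⟨u, hu, rfl⟩, fun j => ?_⟩
    obtain ⟨r₀, hr₀⟩ := hn j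
    refine ⟨r₀, fun r hr => ?_⟩
    rw [pow_mul]
    have h1 := hUφ r (⟨x, hxB⟩ - u)
    rw [Submodule.coe_sub] at h1
    rw [← h1]
    refine (pow_smul_mem_pow_smul_top hϖ).2 ?_
    have h2 : (U ^ r) (⟨x, hxB⟩ - u) ∈ (ϖ ^ j • ⊤ : Submodule A B) := by
      rw [← Nat.sub_add_cancel hr, pow_add, addEnd_mul_apply]
      exact (hU.pow _).map_mem_pow_smul_top hr₀
    obtain ⟨z, hz⟩ := mem_smul_top.1 h2
    exact mem_smul_top.2 ⟨z, by rw [← hz]; rfl⟩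

theorem exists_pow_apply_eq (hφ : IsSemilinear ϖ φ) {l : ℕ}
    (hl : ∀ x, ∃ y, φ y = ϖ ^ l • x) (r : ℕ) (x : N) : ∃ y, (φ ^ r) y = ϖ ^ (l * r) • x := by
  induction r generalizing x with
  | zero => exact ⟨x, by simp⟩
  | succ r ih =>
    obtain ⟨y, hy⟩ := ih x
    obtain ⟨z, hz⟩ := hl y
    refine ⟨z, ?_⟩
    rw [pow_succ, addEnd_mul_apply, hz, (hφ.pow r).map_pow_smul, hy, smul_smul, ← pow_add, mul_add,
      mul_one, add_comm]

/-- The slope is bounded by the cokernel exponent `l`. If `m > l s`, then high powers of `φ ^ s` are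
more divisible on `B` than `ϖ ^ l • N ⊆ φ N` permits, and every `x` would be divisible by all powers
of `ϖ`. -/
theorem slope_le_of_stable [Nontrivial N] (hϖ : Irreducible ϖ) (hφ : IsSemilinear ϖ φ) {l : ℕ}
    (hl : ∀ x, ∃ y, φ y = ϖ ^ l • x) {s m c : ℕ} {B : Submodule A N}
    (hc : ϖ ^ c • ⊤ ≤ B) (hB : ∀ x ∈ B, (φ ^ s) x ∈ ϖ ^ m • B) : m ≤ l * s := by
  by_contra hlt
  obtain ⟨x, hx⟩ := exists_ne (0 : N)
  refine hx (eq_zero_of_forall_mem_pow_smul_top hϖ fun n => ?_)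
  obtain ⟨U, hU, hUφ⟩ := exists_divided_map hϖ (hφ.pow s) hB
  obtain ⟨y, hy⟩ := exists_pow_apply_eq hφ hl (s * (n + c)) x
  have hyB : ϖ ^ c • y ∈ B := hc (mem_smul_top.2 ⟨y, rfl⟩)
  have h1 := hUφ (n + c) ⟨_, hyB⟩
  rw [← pow_mul, (hφ.pow _).map_pow_smul, hy, smul_smul, ← pow_add] at h1
  have h2 : ϖ ^ (c + l * (s * (n + c))) • x ∈ (ϖ ^ (c + l * (s * (n + c)) + n) • ⊤ :
      Submodule A N) := by
    refine pow_smul_top_anti ϖ ?_ (mem_smul_top.2 ⟨_, h1⟩)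
    have h3 : (l * s + 1) * (n + c) ≤ m * (n + c) := Nat.mul_le_mul_right _ (by omega)
    have h4 : (l * s + 1) * (n + c) = l * (s * (n + c)) + n + c := by ring
    omega
  exact (pow_smul_mem_pow_smul_top hϖ).1 h2

end Slopes

/-! ### The slope decomposition up to isogeny. -/

section DieudonneManin

open scoped Pointwise

universe u v

variable {A : Type u} [CommRing A] [IsDomain A] [IsDiscreteValuationRing A] {ϖ : A}

/-- The restriction of an additive endomorphism to a stable submodule. -/
def restrictEnd {N : Type*} [AddCommGroup N] [Module A N] (φ : AddMonoid.End N)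
    (T : Submodule A N) (hT : ∀ x ∈ T, φ x ∈ T) : AddMonoid.End T where
  toFun x := ⟨φ x, hT x x.2⟩
  map_zero' := Subtype.ext (map_zero φ)
  map_add' x y := Subtype.ext (map_add φ (x : N) y)

theorem coe_restrictEnd_pow {N : Type*} [AddCommGroup N] [Module A N] (φ : AddMonoid.End N)
    (T : Submodule A N) (hT : ∀ x ∈ T, φ x ∈ T) (n : ℕ) (x : T) :
    ((restrictEnd φ T hT ^ n) x : N) = (φ ^ n) x := by
  induction n generalizing x with
  | zero => rfl
  | succ n ih =>
    rw [pow_succ, pow_succ, addEnd_mul_apply, addEnd_mul_apply, ih]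
    rfl

theorem IsSemilinear.restrictEnd {N : Type*} [AddCommGroup N] [Module A N] {φ : AddMonoid.End N}
    (hφ : IsSemilinear ϖ φ) (T : Submodule A N) (hT : ∀ x ∈ T, φ x ∈ T) :
    IsSemilinear ϖ (PRCrystal.restrictEnd φ T hT) := by
  obtain ⟨σ, h1, h2⟩ := hφ
  exact ⟨σ, h1, fun a x => Subtype.ext (h2 a x)⟩

/-- Up to isogeny, a semilinear endomorphism with finite cokernel decomposes into isoclinic
parts. -/
theorem exists_pow_smul_mem_sSup_slopes (hϖ : Irreducible ϖ) [IsPrecomplete (Ideal.span {ϖ}) A]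
    (n : ℕ) : ∀ {N : Type v} [AddCommGroup N] [Module A N] [Module.IsTorsionFree A N]
      [Module.Finite A N] {φ : AddMonoid.End N} (hφ : IsSemilinear ϖ φ) {l : ℕ}
      (_ : ∀ x, ∃ y, φ y = ϖ ^ l • x) (_ : Module.finrank A N = n) (x : N), ∃ c : ℕ, ϖ ^ c • x ∈
        sSup {Λ : Submodule A N | ∃ s m : ℕ, 0 < s ∧ (hφ.pow s).map Λ = ϖ ^ m • Λ} := by
  induction n using Nat.strong_induction_on with
  | _ n ih =>
  intro N _ _ _ _ φ hφ l hl hn x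
  rcases subsingleton_or_nontrivial N with hN | hN
  · exact ⟨0, by rw [Subsingleton.elim x 0, smul_zero]; exact zero_mem _⟩
  have hpos : 0 < Module.finrank A N := Module.finrank_pos
  -- Pairs `(s, m)` such that the slope `m / s` is realized on a lattice, with denominator at most
  -- the rank. By `slope_le_of_stable` there are finitely many, and `(1, 0)` is one, so a largest
  -- slope exists.
  let S : Set (ℕ × ℕ) := {q | 0 < q.1 ∧ q.1 ≤ Module.finrank A N ∧
    ∃ (c : ℕ) (B : Submodule A N), ϖ ^ c • ⊤ ≤ B ∧ ∀ x ∈ B, (φ ^ q.1) x ∈ ϖ ^ q.2 • B}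
  have hS : S.Finite := by
    refine ((Set.finite_Iic (Module.finrank A N)).prod
      (Set.finite_Iic (l * Module.finrank A N))).subset ?_
    rintro ⟨s, m⟩ ⟨-, h2, c, B, hc, hB⟩
    exact ⟨h2, (slope_le_of_stable hϖ hφ hl hc hB).trans (Nat.mul_le_mul_left l h2)⟩
  obtain ⟨⟨s, m⟩, ⟨hs, -, c, B, hc, hB⟩, hmax⟩ := Set.exists_max_image S
    (fun q => (q.2 : ℚ) / q.1) hS ⟨(1, 0), one_pos, hpos, 0, ⊤, le_top, fun x _ => by simp⟩
  obtain ⟨Λ, hΛ, hBΛ⟩ := exists_slope_submodule hϖ hφ hB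
  let T := nilPart hφ s m
  have hTφ : ∀ x ∈ T, φ x ∈ T := by
    intro x hx j
    obtain ⟨r₀, h⟩ := hx j
    refine ⟨r₀, fun r hr => ?_⟩
    rw [← addEnd_mul_apply, ← pow_succ, pow_succ', addEnd_mul_apply]
    exact hφ.map_mem_pow_smul_top (h r hr)
  -- If `T` had full rank, then for some `r > 0` all of `N` would be mapped by `φ ^ (s r)` into `ϖ ^
  -- (m r + 1) N`. The lattice from `exists_stable_lattice` then realizes a slope larger than `m /
  -- s` within `S`, against maximality.
  have hT : Module.finrank A T < n := by
    rw [← hn]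
    refine lt_of_le_of_ne (Submodule.finrank_le T) fun heq => ?_
    obtain ⟨c', hc'⟩ := exists_pow_smul_top_le_of_finrank_eq hϖ heq
    obtain ⟨k, v, hv⟩ := Module.Finite.exists_fin (R := A) (M := N)
    have h1 (i : Fin k) : ∃ r₀, ∀ r, r₀ ≤ r →
        (φ ^ (s * r)) (v i) ∈ (ϖ ^ (m * r + 1) • ⊤ : Submodule A N) := by
      obtain ⟨r₀, h⟩ := hc' (mem_smul_top.2 ⟨v i, rfl⟩) (c' + 1)
      refine ⟨r₀, fun r hr => ?_⟩
      have h2 := h r hr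
      rw [(hφ.pow _).map_pow_smul, show m * r + (c' + 1) = c' + (m * r + 1) by ring] at h2
      exact (pow_smul_mem_pow_smul_top hϖ).1 h2
    choose r₀ hr₀ using h1
    let r := 1 + ∑ i, r₀ i
    have h2 : Submodule.span A (Set.range v) ≤
        (hφ.pow (s * r)).comap (ϖ ^ (m * r + 1) • ⊤ : Submodule A N) := by
      rw [Submodule.span_le]
      rintro _ ⟨i, rfl⟩
      refine hr₀ i r ?_
      have := Finset.single_le_sum (f := r₀) (fun j _ => Nat.zero_le _) (Finset.mem_univ i)
      omega
    have hr : 0 < r := by omega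
    obtain ⟨s', m', c'', hs', hs'h, hle, B', hB', hB''⟩ := exists_stable_lattice hϖ hφ
      (Nat.mul_pos hs hr) fun x => h2 (hv.ge (Submodule.mem_top (x := x)))
    have h3 : (m' : ℚ) / s' ≤ m / s := hmax (s', m') ⟨hs', hs'h, c'', B', hB', hB''⟩
    rw [div_le_div_iff₀ (by exact_mod_cast hs') (by exact_mod_cast hs)] at h3
    have h4 : m' * s ≤ m * s' := by exact_mod_cast h3
    have h5 := Nat.mul_le_mul_right r h4
    replace hle : (m * r + 1) * s' ≤ m' * (s * r) := hle
    have h6 : (m * r + 1) * s' = m * s' * r + s' := by ring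
    have h7 : m' * (s * r) = m' * s * r := by ring
    omega
  have hlT : ∀ x : T, ∃ y : T, PRCrystal.restrictEnd φ T hTφ y = ϖ ^ l • x := by
    rintro ⟨x, hx⟩
    obtain ⟨y, hy⟩ := hl x
    refine ⟨⟨y, fun j => ?_⟩, Subtype.ext hy⟩
    -- Since `φ y = ϖ ^ l • x`, the step from `r` to `r + 1` for `y` asks for `m` more in the
    -- exponent for `x`.
    obtain ⟨r₀, h⟩ := hx (m + j)
    refine ⟨r₀ + 1, fun r hr => ?_⟩
    obtain ⟨r, rfl⟩ : ∃ r', r = r' + 1 := ⟨r - 1, by omega⟩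
    have h1 := h r (by omega)
    obtain ⟨s, rfl⟩ : ∃ s', s = s' + 1 := ⟨s - 1, by omega⟩
    rw [show (s + 1) * (r + 1) = s + ((s + 1) * r + 1) by ring, pow_add φ s, pow_succ φ,
      addEnd_mul_apply, addEnd_mul_apply, hy, (hφ.pow _).map_pow_smul,
      show m * (r + 1) + j = m * r + (m + j) by ring]
    exact (hφ.pow s).map_mem_pow_smul_top (Submodule.smul_mem _ _ h1)
  -- A multiple of `x` lies in `B` and splits into an isoclinic element of `Λ` and an element of
  -- `T`, to which the induction hypothesis applies.
  obtain ⟨u, hu, hxu⟩ := hBΛ _ (hc (mem_smul_top.2 ⟨x, rfl⟩))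
  obtain ⟨c', hc'⟩ := ih _ hT (hφ.restrictEnd T hTφ) hlT rfl ⟨_, hxu⟩
  have hmap : sSup {Λ : Submodule A T | ∃ s m : ℕ, 0 < s ∧
      ((hφ.restrictEnd T hTφ).pow s).map Λ = ϖ ^ m • Λ} ≤
        Submodule.comap T.subtype (sSup {Λ : Submodule A N | ∃ s m : ℕ, 0 < s ∧
          (hφ.pow s).map Λ = ϖ ^ m • Λ}) := by
    refine sSup_le ?_
    rintro Λ' ⟨s', m', hs', h'⟩
    rw [← Submodule.map_le_iff_le_comap]
    refine le_sSup ⟨s', m', hs', ?_⟩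
    ext y
    rw [IsSemilinear.mem_map, Submodule.mem_smul_pointwise_iff_exists]
    constructor
    · rintro ⟨_, ⟨z, hz, rfl⟩, rfl⟩
      have h1 := h'.le ⟨z, hz, rfl⟩
      obtain ⟨w, hw, hwz⟩ := (Submodule.mem_smul_pointwise_iff_exists _ _ _).1 h1
      refine ⟨w, ⟨w, hw, rfl⟩, ?_⟩
      have h2 := congrArg Subtype.val hwz
      rw [coe_restrictEnd_pow] at h2
      exact h2
    · rintro ⟨_, ⟨z, hz, rfl⟩, rfl⟩
      obtain ⟨w, hw, hwz⟩ := h'.ge (Submodule.smul_mem_pointwise_smul z (ϖ ^ m') _ hz)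
      refine ⟨w, ⟨w, hw, rfl⟩, ?_⟩
      have h2 := congrArg Subtype.val hwz
      rw [coe_restrictEnd_pow] at h2
      exact h2
  refine ⟨c' + c, ?_⟩
  have h1 : ϖ ^ (c' + c) • x = ϖ ^ c' • u + ϖ ^ c' • (ϖ ^ c • x - u) := by
    rw [← smul_add, add_sub_cancel, smul_smul, pow_add]
  rw [h1]
  refine add_mem (Submodule.smul_mem _ _ ?_) (hmap hc')
  have hmem : Λ ∈ {Λ : Submodule A N | ∃ s m : ℕ, 0 < s ∧ (hφ.pow s).map Λ = ϖ ^ m • Λ} :=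
    ⟨s, m, hs, hΛ⟩
  exact le_sSup hmem hu

end DieudonneManin

/-! ### Isoclinic parts and their independence. -/

section SlopePart

open scoped Pointwise

variable {A N : Type*} [CommRing A] [IsDomain A] [IsDiscreteValuationRing A] {ϖ : A}
  [AddCommGroup N] [Module A N] [Module.IsTorsionFree A N] [Module.Finite A N]
  {φ : AddMonoid.End N}

/-- The sum of the submodules on which `φ` is isoclinic of slope `κ * t`. -/
def isoclinicPart (hφ : IsSemilinear ϖ φ) (κ t : ℚ) : Submodule A N :=
  sSup {Λ : Submodule A N | ∃ s m : ℕ, 0 < s ∧ t = m / (κ * s) ∧ (hφ.pow s).map Λ = ϖ ^ m • Λ}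

theorem map_pow_mul_eq (hφ : IsSemilinear ϖ φ) {s m : ℕ} {Λ : Submodule A N}
    (h : (hφ.pow s).map Λ = ϖ ^ m • Λ) (k : ℕ) :
    (hφ.pow (s * k)).map Λ = ϖ ^ (m * k) • Λ := by
  induction k with
  | zero =>
    ext y
    simp [IsSemilinear.mem_map]
  | succ k ih =>
    have h1 : (hφ.pow (s * (k + 1))).map Λ = (hφ.pow (s * k)).map ((hφ.pow s).map Λ) := by
      ext y
      simp only [IsSemilinear.mem_map]
      constructor
      · rintro ⟨x, hx, rfl⟩
        exact ⟨_, ⟨x, hx, rfl⟩, by rw [← addEnd_mul_apply, ← pow_add, mul_add, mul_one]⟩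
      · rintro ⟨_, ⟨x, hx, rfl⟩, rfl⟩
        exact ⟨x, hx, by rw [← addEnd_mul_apply, ← pow_add, mul_add, mul_one]⟩
    rw [h1, h, (hφ.pow _).map_pow_smul_submodule, ih, smul_smul, ← pow_add, mul_add, mul_one,
      add_comm]

/-- Passing to common exponents `s * s'` and `m * s'` shows that the family of isoclinic submodules
of slope `t` is closed under sums. By the ascending chain condition its supremum belongs to it,
unless the family is empty. -/
theorem isoclinicPart_spec (hφ : IsSemilinear ϖ φ) {κ : ℚ} (hκ : 0 < κ) (t : ℚ) :
    isoclinicPart hφ κ t = ⊥ ∨ ∃ s m : ℕ, 0 < s ∧ t = m / (κ * s) ∧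
      (hφ.pow s).map (isoclinicPart hφ κ t) = ϖ ^ m • isoclinicPart hφ κ t := by
  let S := {Λ : Submodule A N | ∃ s m : ℕ, 0 < s ∧ t = m / (κ * s) ∧
    (hφ.pow s).map Λ = ϖ ^ m • Λ}
  rcases S.eq_empty_or_nonempty with hS | hS
  · left
    change sSup S = ⊥
    rw [hS, sSup_empty]
  · right
    have hc : SupClosed S := by
      rintro Λ ⟨s, m, hs, ht, h⟩ Λ' ⟨s', m', hs', ht', h'⟩
      have e : m * s' = m' * s := by
        have h1 : (m : ℚ) / (κ * s) = m' / (κ * s') := ht.symm.trans ht'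
        have hs1 : (s : ℚ) ≠ 0 := by exact_mod_cast hs.ne'
        have hs1' : (s' : ℚ) ≠ 0 := by exact_mod_cast hs'.ne'
        rw [div_eq_div_iff (by positivity) (by positivity)] at h1
        have h2 : κ * ((m : ℚ) * s') = κ * (m' * s) := by linarith
        exact_mod_cast mul_left_cancel₀ hκ.ne' h2
      refine ⟨s * s', m * s', Nat.mul_pos hs hs', ?_, ?_⟩
      · have hs1' : (s' : ℚ) ≠ 0 := by exact_mod_cast hs'.ne'
        rw [ht]
        push_cast
        rw [← mul_assoc, mul_div_mul_right _ _ hs1']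
      · rw [IsSemilinear.map_sup, map_pow_mul_eq hφ h, Submodule.smul_sup']
        congr 1
        have h3 (n : ℕ) (hn : n = s' * s) : (hφ.pow n).map Λ' = ϖ ^ (m' * s) • Λ' := by
          subst hn
          exact map_pow_mul_eq hφ h' s
        rw [e, h3 _ (mul_comm s s')]
    have := CompleteLattice.WellFoundedGT.isSupClosedCompact (Submodule A N) inferInstance S hS hc
    exact this

theorem isoclinicPart_le_nilPart (hφ : IsSemilinear ϖ φ) {κ : ℚ} (hκ : 0 < κ)
    {s m : ℕ} (hs : 0 < s) {t : ℚ} (ht : (m : ℚ) / (κ * s) < t) :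
    isoclinicPart hφ κ t ≤ nilPart hφ s m := by
  refine sSup_le ?_
  rintro Λ ⟨s', m', hs', rfl, h⟩ x hx j
  have e : m * s' < m' * s := by
    have hs1 : (0 : ℚ) < s := by exact_mod_cast hs
    have hs1' : (0 : ℚ) < s' := by exact_mod_cast hs'
    rw [div_lt_div_iff₀ (by positivity) (by positivity)] at ht
    have h2 : κ * ((m : ℚ) * s') < κ * (m' * s) := by linarith
    exact_mod_cast lt_of_mul_lt_mul_left h2 hκ.le
  -- Each step of `φ ^ s` gains at least `1 / s'` over `m`, as `m' s ≥ m s' + 1`, while rounding `s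
  -- * r` down to a multiple of `s'` loses at most `m'`. So `r ≥ s' * (m' + j)` would be enough.
  refine ⟨s' * (m' * s + j), fun r hr => ?_⟩
  have h1 : (φ ^ (s' * (s * r / s'))) x ∈
      (ϖ ^ (m' * (s * r / s')) • ⊤ : Submodule A N) := by
    have h2 := (map_pow_mul_eq hφ h (s * r / s')).le ⟨x, hx, rfl⟩
    obtain ⟨y, -, hy⟩ := (Submodule.mem_smul_pointwise_iff_exists _ _ _).1 h2
    exact mem_smul_top.2 ⟨y, hy⟩
  have h3 := (hφ.pow (s * r % s')).map_mem_pow_smul_top h1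
  rw [← addEnd_mul_apply, ← pow_add, Nat.mod_add_div] at h3
  refine pow_smul_top_anti ϖ ?_ h3
  by_contra hlt
  have hlt' : m' * (s * r / s') + 1 ≤ m * r + j := by omega
  have h4 := Nat.mul_le_mul_right s' hlt'
  have h5 : s * r < s' * (s * r / s') + s' := by
    conv_lhs => rw [← Nat.div_add_mod (s * r) s']
    exact Nat.add_lt_add_left (Nat.mod_lt _ hs') _
  have h6 : m' * (s * r) ≤ m' * (s' * (s * r / s') + s') := Nat.mul_le_mul_left _ h5.le
  have h7 : (m * s' + 1) * r ≤ m' * s * r := Nat.mul_le_mul_right _ e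
  have h8 : s' * (m' * s + j) ≥ s' * (m' + j) :=
    Nat.mul_le_mul_left _ (Nat.add_le_add_right (Nat.le_mul_of_pos_right _ hs) _)
  nlinarith

/-- On the isoclinic part `Λ` the operator `ϖ ^ (-m) φ ^ s` is, up to a power, bijective. It sends
`x` deep into `ϖ ^ (n + c) N`, hence into `ϖ ^ n Λ` by Artin-Rees, and bijectivity pulls this
divisibility back to `x`, for every `n`. -/
theorem isoclinicPart_inf_nilPart (hϖ : Irreducible ϖ) (hφ : IsSemilinear ϖ φ)
    (hinj : Function.Injective φ) {κ : ℚ} (hκ : 0 < κ) {s m : ℕ} (hs : 0 < s) {t : ℚ}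
    (ht : t = (m : ℚ) / (κ * s)) {x : N} (hx : x ∈ isoclinicPart hφ κ t)
    (hx' : x ∈ nilPart hφ s m) : x = 0 := by
  obtain h | ⟨s', m', hs', ht', h⟩ := isoclinicPart_spec hφ hκ t
  · rwa [h] at hx
  set Λ := isoclinicPart hφ κ t
  have e : m * s' = m' * s := by
    have h1 : (m : ℚ) / (κ * s) = m' / (κ * s') := ht.symm.trans ht'
    have hs1 : (s : ℚ) ≠ 0 := by exact_mod_cast hs.ne'
    have hs1' : (s' : ℚ) ≠ 0 := by exact_mod_cast hs'.ne'
    rw [div_eq_div_iff (by positivity) (by positivity)] at h1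
    have h2 : κ * ((m : ℚ) * s') = κ * (m' * s) := by linarith
    exact_mod_cast mul_left_cancel₀ hκ.ne' h2
  obtain ⟨c, hc⟩ := Ideal.exists_pow_inf_eq_pow_smul (Ideal.span {ϖ}) Λ
  refine eq_zero_of_forall_mem_pow_smul_top hϖ fun n => ?_
  obtain ⟨r₀, hr₀⟩ := hx' (n + c)
  have h1 := hr₀ (s' * r₀) (Nat.le_mul_of_pos_left _ hs')
  have h2 := (map_pow_mul_eq hφ h (s * r₀)).le ⟨x, hx, rfl⟩
  obtain ⟨u, hu, hux⟩ := (Submodule.mem_smul_pointwise_iff_exists _ _ _).1 h2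
  have e1 : s * (s' * r₀) = s' * (s * r₀) := by ring
  have e2 : m * (s' * r₀) = m' * (s * r₀) := by
    rw [← mul_assoc, e, mul_assoc]
  rw [e1, e2, ← hux, pow_smul_mem_pow_smul_top hϖ] at h1
  have h3 : u ∈ (Ideal.span {ϖ} ^ (n + c) • ⊤ ⊓ Λ : Submodule A N) := by
    rw [span_singleton_pow_smul_top]
    exact ⟨h1, hu⟩
  rw [hc _ (Nat.le_add_left _ _), Nat.add_sub_cancel, Ideal.span_singleton_pow,
    Submodule.ideal_span_singleton_smul] at h3
  obtain ⟨w, ⟨-, hw⟩, rfl⟩ := (Submodule.mem_smul_pointwise_iff_exists _ _ _).1 h3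
  obtain ⟨w', hw', hww'⟩ := (map_pow_mul_eq hφ h (s * r₀)).ge
    (Submodule.smul_mem_pointwise_smul w _ _ hw)
  refine mem_smul_top.2 ⟨w', ?_⟩
  have hinj' : Function.Injective (φ ^ (s' * (s * r₀))) := by
    rw [AddMonoid.End.coe_pow]
    exact hinj.iterate _
  apply hinj'
  rw [(hφ.pow _).map_pow_smul, hww', ← hux, smul_comm]

/-- In a relation, the component of smallest slope equals minus a sum of components of larger slope.
It is thus topologically nilpotent for its own slope, hence zero. -/
theorem iSupIndep_isoclinicPart (hϖ : Irreducible ϖ) (hφ : IsSemilinear ϖ φ)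
    (hinj : Function.Injective φ) {κ : ℚ} (hκ : 0 < κ) : iSupIndep (isoclinicPart hφ κ) := by
  classical
  apply iSupIndep_of_dfinsupp_lsum_injective
  rw [← LinearMap.ker_eq_bot, LinearMap.ker_eq_bot']
  intro x hx
  by_contra hne
  have hsupp : x.support.Nonempty := by
    rw [Finset.nonempty_iff_ne_empty, Ne, DFinsupp.support_eq_empty]
    exact hne
  let t := x.support.min' hsupp
  have ht : t ∈ x.support := Finset.min'_mem _ _
  have hxt : x t ≠ 0 := DFinsupp.mem_support_iff.1 ht
  apply hxt
  obtain h | ⟨s, m, hs, hts, h⟩ := isoclinicPart_spec hφ hκ t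
  · have h1 := (x t).2
    exact Subtype.ext (h.le h1)
  · refine Subtype.ext (isoclinicPart_inf_nilPart hϖ hφ hinj hκ hs hts (x t).2 ?_)
    rw [DFinsupp.lsum_apply_apply, DFinsupp.sumAddHom_apply, DFinsupp.sum] at hx
    rw [← Finset.add_sum_erase _ _ ht] at hx
    have h2 : ((x t : N)) = -∑ t' ∈ x.support.erase t, (x t' : N) := eq_neg_of_add_eq_zero_left hx
    rw [h2]
    refine Submodule.neg_mem _ (Submodule.sum_mem _ fun t' ht' => ?_)
    refine isoclinicPart_le_nilPart hφ hκ hs ?_ (x t').2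
    rw [← hts]
    exact lt_of_le_of_ne (Finset.min'_le _ _ (Finset.mem_of_mem_erase ht'))
      (Finset.ne_of_mem_erase ht').symm

end SlopePart

/-! ### The ring of integers `O_L`: discrete valuation, completeness, Teichmüller lifts. -/

section LocalField

open IsLocalRing

theorem isHausdorff_of_span_le_jacobson {A : Type*} [CommRing A] [IsNoetherianRing A] {a : A}
    (h : a ∈ Ideal.jacobson (⊥ : Ideal A)) : IsHausdorff (Ideal.span {a}) A :=
  IsHausdorff.of_le_jacobson _ _ ((Ideal.span_singleton_le_iff_mem _).2 h)

/-- A Dedekind domain that is complete with respect to a nonzero element `a` contained in all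
maximal ideals is local. -/
theorem isLocalRing_of_isAdicComplete {O : Type*} [CommRing O] [IsDedekindDomain O] {a : O}
    (ha : a ≠ 0) [IsAdicComplete (Ideal.span {a}) O] : IsLocalRing O := by
  have hjac := IsAdicComplete.le_jacobson_bot (Ideal.span {a})
  have hmax (P : Ideal O) (hP : P.IsMaximal) : Ideal.span {a} ≤ P :=
    hjac.trans (sInf_le ⟨bot_le, hP⟩)
  obtain ⟨P, hP⟩ := Ideal.exists_maximal O
  refine IsLocalRing.of_unique_max_ideal ⟨P, hP, fun Q hQ => ?_⟩
  by_contra hne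
  have hbot : Ideal.span {a} ≠ ⊥ := by rwa [Ne, Ideal.span_singleton_eq_bot]
  obtain ⟨J, hJ, hPJ⟩ := Ideal.eq_prime_pow_mul_coprime hbot P
  set n := Multiset.count P (UniqueFactorizationMonoid.normalizedFactors (Ideal.span {a}))
  have hn : n ≠ 0 := by
    intro h0
    rw [h0, pow_zero, one_mul] at hPJ
    rw [← hPJ, sup_eq_left.2 (hmax P hP)] at hJ
    exact hP.ne_top hJ
  have hJQ : J ≤ Q := by
    have h1 : P ^ n * J ≤ Q := hPJ ▸ hmax Q hQ
    rcases hQ.isPrime.mul_le.1 h1 with h | h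
    · have h2 := (hQ.isPrime.pow_le_iff hn).1 h
      exact absurd (hP.eq_of_le hQ.ne_top h2).symm hne
    · exact h
  have hcop : P ^ n ⊔ J = ⊤ := by
    have : IsCoprime P J := Ideal.isCoprime_iff_sup_eq.2 hJ
    exact Ideal.isCoprime_iff_sup_eq.1 this.pow_left
  -- With `(a) = P ^ n * J` coprime, `y = 1 - x` is idempotent modulo `a` and nontrivial because `J
  -- ≤ Q`. Hensel's lemma lifts it to an idempotent of a domain, which must be `0` or `1`; then `P`
  -- or `Q` would be the unit ideal.
  obtain ⟨x, hx, y, hy, hxy⟩ := Submodule.mem_sup.1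
    (hcop ▸ Submodule.mem_top : (1 : O) ∈ P ^ n ⊔ J)
  have hmul : x * y ∈ Ideal.span {a} := hPJ ▸ Ideal.mul_mem_mul hx hy
  have hroot : y ^ 2 - y ∈ Ideal.span {a} := by
    have : y ^ 2 - y = -(x * y) := by rw [← sub_eq_iff_eq_add.2 hxy.symm]; ring
    rw [this]
    exact Ideal.neg_mem_iff _ |>.2 hmul
  open Polynomial in
  obtain ⟨e, he, hey⟩ := HenselianRing.is_henselian (I := Ideal.span {a}) (X ^ 2 - X : O[X])
    (by monicity!) y (by simpa using hroot) (by
      refine IsUnit.of_mul_eq_one (Ideal.Quotient.mk _ (2 * y - 1)) ?_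
      simp only [derivative_sub, derivative_X_pow, derivative_X, eval_sub, eval_mul, eval_one]
      rw [← map_mul, ← map_one (Ideal.Quotient.mk (Ideal.span {a})), Ideal.Quotient.eq]
      have : (eval y (C ((2 : ℕ) : O)) * eval y (X ^ (2 - 1)) - 1) * (2 * y - 1) - 1 =
          4 * (y ^ 2 - y) := by
        simp
        ring
      rw [this]
      exact Ideal.mul_mem_left _ _ hroot)
  have he' : e * (e - 1) = 0 := by
    have : e ^ 2 - e = 0 := by simpa [Polynomial.IsRoot] using he
    rw [← this]
    ring
  rcases mul_eq_zero.1 he' with h0 | h1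
  · rw [h0, zero_sub] at hey
    have hyP : y ∈ P := by simpa using hmax P hP hey
    exact hP.ne_top ((Ideal.eq_top_iff_one P).2
      (hxy ▸ add_mem (Ideal.pow_le_self hn hx) hyP))
  · rw [sub_eq_zero.1 h1] at hey
    have hxa : x ∈ Ideal.span {a} := by
      rwa [← sub_eq_iff_eq_add.2 hxy.symm]
    exact hQ.ne_top ((Ideal.eq_top_iff_one Q).2 (hxy ▸ add_mem (hmax Q hQ hxa) (hJQ hy)))

variable {p : ℕ} [Fact p.Prime] {L : Type*} [Field L] [Algebra ℚ_[p] L] [FiniteDimensional ℚ_[p] L]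
  [Algebra ℤ_[p] L] [IsScalarTower ℤ_[p] ℚ_[p] L]

variable (p L) in
theorem finite_OL : Module.Finite ℤ_[p] (OL p L) :=
  IsIntegralClosure.finite ℤ_[p] ℚ_[p] L (OL p L)

variable (p L) in
theorem isDedekindDomain_OL : IsDedekindDomain (OL p L) :=
  integralClosure.isDedekindDomain ℤ_[p] ℚ_[p] L

variable (p L) in
theorem faithfulSMul_OL : FaithfulSMul ℤ_[p] (OL p L) := by
  have h : Function.Injective (algebraMap ℤ_[p] L) := by
    rw [IsScalarTower.algebraMap_eq ℤ_[p] ℚ_[p] L]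
    exact (algebraMap ℚ_[p] L).injective.comp (IsFractionRing.injective ℤ_[p] ℚ_[p])
  rw [faithfulSMul_iff_algebraMap_injective]
  intro x y hxy
  exact h (congrArg Subtype.val hxy)

theorem span_p_eq_maximalIdeal : Ideal.span {(p : ℤ_[p])} = maximalIdeal ℤ_[p] :=
  PadicInt.maximalIdeal_eq_span_p.symm

variable (p) in
theorem natCast_p_mem_jacobson (S : Type*) [CommRing S] [Algebra ℤ_[p] S]
    [Algebra.IsIntegral ℤ_[p] S] : (p : S) ∈ Ideal.jacobson (⊥ : Ideal S) := by
  refine Ideal.mem_jacobson_bot.2 fun y => ?_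
  by_contra hnu
  obtain ⟨P, hP, hmem⟩ := exists_max_ideal_of_mem_nonunits hnu
  have h1 : (Ideal.comap (algebraMap ℤ_[p] S) P).IsMaximal :=
    Ideal.isMaximal_comap_of_isIntegral_of_isMaximal P
  have h2 : (p : ℤ_[p]) ∈ Ideal.comap (algebraMap ℤ_[p] S) P := by
    rw [IsLocalRing.eq_maximalIdeal h1, ← span_p_eq_maximalIdeal]
    exact Ideal.mem_span_singleton_self _
  rw [Ideal.mem_comap, map_natCast] at h2
  have h3 := Ideal.sub_mem _ hmem (P.mul_mem_right y h2)
  rw [add_sub_cancel_left] at h3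
  exact hP.ne_top ((Ideal.eq_top_iff_one P).2 h3)

variable (p L) in
theorem charZero_OL : CharZero (OL p L) := by
  have := faithfulSMul_OL p L
  exact charZero_of_injective_algebraMap (FaithfulSMul.algebraMap_injective ℤ_[p] (OL p L))

variable (p L) in
theorem natCast_p_ne_zero : (p : OL p L) ≠ 0 := by
  have := charZero_OL p L
  exact_mod_cast (Fact.out : p.Prime).ne_zero

variable (p L) in
theorem isPrecomplete_OL : IsPrecomplete (Ideal.span {(p : OL p L)}) (OL p L) := by
  have := finite_OL p L
  have h0 : IsPrecomplete (Ideal.span {(p : ℤ_[p])}) ℤ_[p] := by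
    rw [span_p_eq_maximalIdeal]
    infer_instance
  have h1 : IsPrecomplete (Ideal.span {(p : ℤ_[p])}) (OL p L) := IsPrecomplete.of_finite _
  rw [← IsPrecomplete.map_algebraMap_iff (S := OL p L), Ideal.map_span, Set.image_singleton,
    map_natCast] at h1
  exact h1

variable (p L) in
theorem isAdicComplete_OL : IsAdicComplete (Ideal.span {(p : OL p L)}) (OL p L) := by
  have := isDedekindDomain_OL p L
  have := isPrecomplete_OL p L
  have := isHausdorff_of_span_le_jacobson (natCast_p_mem_jacobson p (OL p L))
  constructor

variable (p L) in
theorem isLocalRing_OL : IsLocalRing (OL p L) := by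
  have := isDedekindDomain_OL p L
  have := isAdicComplete_OL p L
  exact isLocalRing_of_isAdicComplete (natCast_p_ne_zero p L)

variable (p L) in
theorem isDiscreteValuationRing_OL : IsDiscreteValuationRing (OL p L) := by
  have := isDedekindDomain_OL p L
  have := isLocalRing_OL p L
  refine ((IsDiscreteValuationRing.TFAE (OL p L) ?_).out 0 2).2 ‹IsDedekindDomain (OL p L)›
  intro hf
  have h1 := natCast_p_mem_jacobson p (OL p L)
  rw [IsLocalRing.jacobson_eq_maximalIdeal (⊥ : Ideal (OL p L)) bot_ne_top,
    (IsLocalRing.isField_iff_maximalIdeal_eq (R := OL p L)).1 hf] at h1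
  exact natCast_p_ne_zero p L h1

variable {π : OL p L}

theorem span_eq_maximalIdeal [IsLocalRing (OL p L)] (hπ : Irreducible π) :
    Ideal.span {π} = maximalIdeal (OL p L) := by
  have := isDiscreteValuationRing_OL p L
  exact hπ.maximalIdeal_eq.symm

theorem isMaximal_span (hπ : Irreducible π) : (Ideal.span {π}).IsMaximal := by
  have := isLocalRing_OL p L
  rw [span_eq_maximalIdeal hπ]
  infer_instance

/-- The exponent `n` is the ramification index, but only its positivity matters: `ramIdx π` enters
the polygons only as a positive normalizing factor. -/
theorem exists_p_eq (hπ : Irreducible π) :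
    ∃ (n : ℕ) (u : (OL p L)ˣ), 0 < n ∧ (p : OL p L) = u * π ^ n := by
  have := isDiscreteValuationRing_OL p L
  obtain ⟨n, u, h⟩ :=
    IsDiscreteValuationRing.eq_unit_mul_pow_irreducible (natCast_p_ne_zero p L) hπ
  refine ⟨n, u, Nat.pos_of_ne_zero ?_, h⟩
  rintro rfl
  have h1 := natCast_p_mem_jacobson p (OL p L)
  rw [IsLocalRing.jacobson_eq_maximalIdeal _ bot_ne_top, IsLocalRing.mem_maximalIdeal, h] at h1
  exact h1 (by simp)

theorem p_mem_span (hπ : Irreducible π) : (p : OL p L) ∈ Ideal.span {π} := by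
  obtain ⟨n, u, hn, h⟩ := exists_p_eq hπ
  rw [h]
  exact Ideal.mul_mem_left _ _ (Ideal.pow_mem_of_mem _ (Ideal.mem_span_singleton_self π) n hn)

theorem isAdicComplete_span (hπ : Irreducible π) : IsAdicComplete (Ideal.span {π}) (OL p L) := by
  have := isDiscreteValuationRing_OL p L
  obtain ⟨n, u, hn, h⟩ := exists_p_eq hπ
  have h1 : Ideal.span {(p : OL p L)} = Ideal.span {π ^ n} := by
    rw [h]
    exact Ideal.span_singleton_mul_left_unit u.isUnit _
  have h2 := isPrecomplete_OL p L
  rw [h1] at h2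
  have := IsPrecomplete.of_pow (M := OL p L) (ϖ := π) hn
  have := isHausdorff_of_span_le_jacobson (span_irreducible_le_jacobson hπ
    (Ideal.mem_span_singleton_self π))
  constructor

theorem ramIdx_pos (hπ : Irreducible π) : 0 < ramIdx π := by
  have := finite_OL p L
  have := (isMaximal_span hπ).isPrime
  exact Ideal.ramificationIdx_pos _ _

theorem resDeg_pos (hπ : Irreducible π) : 0 < resDeg π := by
  have := finite_OL p L
  have := (isMaximal_span hπ).isPrime
  exact Ideal.inertiaDeg_pos _ _

theorem liesOver_span (hπ : Irreducible π) : (Ideal.span {π}).LiesOver (maximalIdeal ℤ_[p]) := by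
  have := isMaximal_span hπ
  constructor
  have : (Ideal.under ℤ_[p] (Ideal.span {π})).IsMaximal :=
    Ideal.isMaximal_comap_of_isIntegral_of_isMaximal (Ideal.span {π})
  exact (IsLocalRing.eq_maximalIdeal this).symm

theorem natCard_quotient_eq_pow {R S : Type*} [CommRing R] [CommRing S] [Algebra R S]
    [Module.Finite R S] (m : Ideal R) [m.IsMaximal] (P : Ideal S) [P.IsMaximal] [P.LiesOver m] :
    Nat.card (S ⧸ P) = Nat.card (R ⧸ m) ^ P.inertiaDeg R := by
  rw [Ideal.inertiaDeg_eq_of_isMaximal m P]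
  let : DivisionRing (R ⧸ m) := Ideal.Quotient.divisionRing m
  exact Module.natCard_eq_pow_finrank (K := R ⧸ m)

theorem natCard_residue (hπ : Irreducible π) :
    Nat.card (OL p L ⧸ Ideal.span {π}) = p ^ resDeg π := by
  have := finite_OL p L
  have := isMaximal_span hπ
  have := liesOver_span hπ
  rw [natCard_quotient_eq_pow (maximalIdeal ℤ_[p]) (Ideal.span {π}), resDeg]
  congr 1
  have e := Nat.card_congr (PadicInt.residueField (p := p)).toEquiv
  rw [Nat.card_zmod] at e
  exact e

theorem pow_sub_mem_span (hπ : Irreducible π) (x : OL p L) :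
    x ^ p ^ resDeg π - x ∈ Ideal.span {π} := by
  have := isMaximal_span hπ
  let : Field (OL p L ⧸ Ideal.span {π}) := Ideal.Quotient.field _
  have hc := natCard_residue hπ
  have : Finite (OL p L ⧸ Ideal.span {π}) := Nat.finite_of_card_ne_zero (by
    rw [hc]
    exact pow_ne_zero _ (Fact.out : p.Prime).ne_zero)
  rw [← Ideal.Quotient.eq, map_pow, ← hc]
  have := Fintype.ofFinite (OL p L ⧸ Ideal.span {π})
  rw [Nat.card_eq_fintype_card, FiniteField.pow_card]

/-- Hensel's lemma for `X ^ q - X`, whose derivative is `-1` modulo `π` because `p` lies in `(π)`.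
-/
theorem exists_teichmuller (hπ : Irreducible π) (x : OL p L) :
    ∃ y : OL p L, y ^ p ^ resDeg π = y ∧ y - x ∈ Ideal.span {π} := by
  have := isAdicComplete_span hπ
  have hq : 1 < p ^ resDeg π := Nat.one_lt_pow (resDeg_pos hπ).ne' (Fact.out : p.Prime).one_lt
  open Polynomial in
  obtain ⟨y, hy, hyx⟩ := HenselianRing.is_henselian (I := Ideal.span {π})
    (X ^ p ^ resDeg π - X : (OL p L)[X])
    (monic_X_pow_sub (by rw [degree_X]; exact_mod_cast hq)) x
    (by simpa using pow_sub_mem_span hπ x) (by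
      have hp : (Ideal.Quotient.mk (Ideal.span {π})) (p : OL p L) = 0 :=
        Ideal.Quotient.eq_zero_iff_mem.2 (p_mem_span hπ)
      rw [map_natCast] at hp
      rw [derivative_sub, derivative_X_pow, derivative_X, eval_sub, eval_mul, eval_C, map_sub,
        map_mul, map_natCast, Nat.cast_pow, hp, zero_pow (resDeg_pos hπ).ne', zero_mul, zero_sub,
        eval_one, map_one]
      exact isUnit_one.neg)
  refine ⟨y, ?_, hyx⟩
  simpa [Polynomial.IsRoot, sub_eq_zero] using hy

end LocalField

/-! ### The maximal unramified subring. -/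

section Unramified

open IsLocalRing

theorem formallyUnramified_sup {R A : Type*} [CommRing R] [CommRing A] [Algebra R A]
    {S T : Subalgebra R A} (hS : Algebra.FormallyUnramified R S)
    (hT : Algebra.FormallyUnramified R T) : Algebra.FormallyUnramified R ↥(S ⊔ T) := by
  have h1 : Algebra.FormallyUnramified R (S ⊗[R] T) := Algebra.FormallyUnramified.comp R S _
  have h2 : (Algebra.TensorProduct.productMap S.val T.val).range = S ⊔ T := by
    rw [Algebra.TensorProduct.productMap_range, Subalgebra.range_val, Subalgebra.range_val]
  rw [← h2]
  exact Algebra.FormallyUnramified.of_surjective _ (AlgHom.rangeRestrict_surjective _)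

theorem formallyUnramified_bot {R A : Type*} [CommRing R] [CommRing A] [Algebra R A] :
    Algebra.FormallyUnramified R (⊥ : Subalgebra R A) :=
  Algebra.FormallyUnramified.of_surjective (Algebra.ofId R (⊥ : Subalgebra R A)) fun x => by
    obtain ⟨r, hr⟩ := Algebra.mem_bot.1 x.2
    exact ⟨r, Subtype.ext hr⟩

/-- The family of formally unramified subalgebras is closed under binary suprema, so by the
ascending chain condition it contains its supremum. -/
theorem formallyUnramified_sSup {R A : Type*} [CommRing R] [CommRing A] [Algebra R A]
    [IsNoetherian R A] : Algebra.FormallyUnramified R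
      ↥(sSup {S : Subalgebra R A | Algebra.FormallyUnramified R S}) := by
  have hwf : WellFoundedGT (Subalgebra R A) :=
    (Subalgebra.toSubmodule (R := R) (A := A)).strictMono.wellFoundedGT
  exact CompleteLattice.WellFoundedGT.isSupClosedCompact _ hwf
    {S : Subalgebra R A | Algebra.FormallyUnramified R S} ⟨⊥, formallyUnramified_bot⟩
    fun S hS T hT => formallyUnramified_sup hS hT

/-- Two lifts of `y` through a square-zero ideal differ by some `ε` with `ε ^ 2 = 0`. Expanding `y ^
q = y` gives `(1 - q y ^ (q - 1)) ε = 0`, and the first factor is a unit since `q` is in the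
Jacobson radical. -/
theorem formallyUnramified_adjoin {R A : Type*} [CommRing R] [CommRing A] [Algebra R A] {y : A}
    {q : ℕ} (hy : y ^ q = y)
    (hq : (q : Algebra.adjoin R {y}) ∈ Ideal.jacobson (⊥ : Ideal (Algebra.adjoin R {y}))) :
    Algebra.FormallyUnramified R (Algebra.adjoin R {y}) := by
  rw [Algebra.FormallyUnramified.iff_comp_injective]
  intro B _ _ I hI g₁ g₂ hg
  refine AlgHom.adjoin_ext ?_
  rintro x rfl
  set s : Algebra.adjoin R {x} := ⟨x, Algebra.subset_adjoin rfl⟩ with hs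
  have hsq : s ^ q = s := Subtype.ext hy
  have hε : g₁ s - g₂ s ∈ I := by
    rw [← Ideal.Quotient.eq]
    exact DFunLike.congr_fun hg s
  have hε2 : (g₁ s - g₂ s) ^ 2 = 0 := by
    have := Ideal.pow_mem_pow hε 2
    rwa [hI] at this
  obtain ⟨b, hb⟩ := (Polynomial.X ^ q : Polynomial B).binomExpansion (g₂ s) (g₁ s - g₂ s)
  rw [hε2, mul_zero, add_zero, add_sub_cancel] at hb
  simp only [Polynomial.eval_pow, Polynomial.eval_X, Polynomial.derivative_X_pow,
    Polynomial.eval_mul, Polynomial.eval_C] at hb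
  rw [← map_pow, ← map_pow, hsq] at hb
  have hu : IsUnit (1 - (q : Algebra.adjoin R {x}) * s ^ (q - 1)) := by
    have := Ideal.mem_jacobson_bot.1 hq (-s ^ (q - 1))
    convert this using 1
    ring
  have hu2 := hu.map g₂
  have : g₂ (1 - (q : Algebra.adjoin R {x}) * s ^ (q - 1)) * (g₁ s - g₂ s) = 0 := by
    rw [map_sub, map_mul, map_pow, map_one, map_natCast, sub_mul, one_mul]
    nth_rewrite 1 [hb]
    ring
  exact sub_eq_zero.1 (hu2.mul_right_eq_zero.1 this)

variable {p : ℕ} [Fact p.Prime] {L : Type*} [Field L] [Algebra ℚ_[p] L] [FiniteDimensional ℚ_[p] L]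
  [Algebra ℤ_[p] L] [IsScalarTower ℤ_[p] ℚ_[p] L]

theorem finite_subalgebra (S : Subalgebra ℤ_[p] (OL p L)) : Module.Finite ℤ_[p] S := by
  have := finite_OL p L
  exact inferInstanceAs (Module.Finite ℤ_[p] (Subalgebra.toSubmodule S))

theorem isIntegral_subalgebra (S : Subalgebra ℤ_[p] (OL p L)) : Algebra.IsIntegral ℤ_[p] S := by
  have := finite_subalgebra S
  exact Algebra.IsIntegral.of_finite _ _

theorem isLocalHom_subalgebra (S : Subalgebra ℤ_[p] (OL p L)) :
    IsLocalHom (algebraMap S (OL p L)) := by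
  have : Algebra.IsIntegral S (OL p L) := Algebra.IsIntegral.tower_top ℤ_[p]
  exact Algebra.IsIntegral.isLocalHom S (OL p L)

theorem isLocalRing_subalgebra (S : Subalgebra ℤ_[p] (OL p L)) : IsLocalRing S := by
  have := isLocalRing_OL p L
  have := isLocalHom_subalgebra S
  exact RingHom.domain_isLocalRing (algebraMap S (OL p L))

variable (p L) in
theorem formallyUnramified_ONr : Algebra.FormallyUnramified ℤ_[p] (ONr p L) := by
  have := finite_OL p L
  exact formallyUnramified_sSup

variable {π : OL p L}

theorem mem_ONr_of_pow_eq {y : OL p L} {n : ℕ} (hn : n ≠ 0) (hy : y ^ p ^ n = y) : y ∈ ONr p L := by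
  refine (le_sSup (a := Algebra.adjoin ℤ_[p] {y}) ?_) (Algebra.subset_adjoin rfl)
  have := isIntegral_subalgebra (Algebra.adjoin ℤ_[p] {y})
  refine formallyUnramified_adjoin hy ?_
  rw [Nat.cast_pow]
  exact Ideal.pow_mem_of_mem _ (natCast_p_mem_jacobson p _) _ (Nat.pos_of_ne_zero hn)

/-- `O_{L^nr}` contains the Teichmüller lifts, so it has the same residue field as `O_L`. -/
theorem exists_ONr_sub_mem (hπ : Irreducible π) (x : OL p L) :
    ∃ y : ONr p L, (y : OL p L) - x ∈ Ideal.span {π} := by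
  obtain ⟨y, hy, hyx⟩ := exists_teichmuller hπ x
  exact ⟨⟨y, mem_ONr_of_pow_eq (resDeg_pos hπ).ne' hy⟩, hyx⟩

/-- An unramified local extension of `ℤ_p` has maximal ideal generated by `p`, and `y` is not a
unit. -/
theorem dvd_of_mem_span (hπ : Irreducible π) {y : ONr p L} (hy : (y : OL p L) ∈ Ideal.span {π}) :
    (p : ONr p L) ∣ y := by
  have := isLocalRing_subalgebra (ONr p L)
  have := isIntegral_subalgebra (ONr p L)
  have := finite_subalgebra (ONr p L)
  have := faithfulSMul_OL p L
  have : FaithfulSMul ℤ_[p] (ONr p L) := by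
    rw [faithfulSMul_iff_algebraMap_injective]
    intro a b hab
    exact FaithfulSMul.algebraMap_injective ℤ_[p] (OL p L) (congrArg Subtype.val hab)
  have := Algebra.IsIntegral.isLocalHom ℤ_[p] (ONr p L)
  have := formallyUnramified_ONr p L
  have h := Algebra.FormallyUnramified.map_maximalIdeal (R := ℤ_[p]) (S := ONr p L)
  rw [← span_p_eq_maximalIdeal, Ideal.map_span, Set.image_singleton, map_natCast] at h
  rw [← Ideal.mem_span_singleton, h, IsLocalRing.mem_maximalIdeal]
  intro hu
  exact (isMaximal_span hπ).ne_top (Ideal.eq_top_of_isUnit_mem _ hy (hu.map (algebraMap _ (OL p L))))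

end Unramified

/-! ### The embeddings form one orbit of length `f` under Frobenius. -/

section Embeddings

variable {p : ℕ} [Fact p.Prime] {k : Type*} [Field k] [CharP k p] [PerfectRing k p]

/-- Modulo `p ^ n` every `p`-adic integer is an ordinary integer, and `W(k)` is `p`-adically
separated. This makes ring homomorphisms `ℤ_p`-linear. -/
theorem padicInt_ringHom_ext (φ ψ : ℤ_[p] →+* WittVector p k) : φ = ψ := by
  ext1 x
  have hH : IsHausdorff (Ideal.span {(p : WittVector p k)}) (WittVector p k) := inferInstance
  rw [← sub_eq_zero]
  refine hH.haus _ fun n => SModEq.zero.2 ?_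
  rw [smul_eq_mul, Ideal.mul_top, Ideal.span_singleton_pow]
  have hmem (χ : ℤ_[p] →+* WittVector p k) :
      χ x - (x.appr n : WittVector p k) ∈ Ideal.span {(p : WittVector p k) ^ n} := by
    have := Ideal.mem_map_of_mem χ (PadicInt.appr_spec n x)
    rwa [Ideal.map_span, Set.image_singleton, map_pow, map_sub, map_natCast, map_natCast] at this
  have := Ideal.sub_mem _ (hmem φ) (hmem ψ)
  rwa [sub_sub_sub_cancel_right] at this

variable {L : Type*} [Field L] [Algebra ℚ_[p] L] [FiniteDimensional ℚ_[p] L]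
  [Algebra ℤ_[p] L] [IsScalarTower ℤ_[p] ℚ_[p] L]

/-- Unramifiedness: algebra maps that agree modulo `p` agree modulo every power of `p`. Questions
about embeddings thus reduce to maps of residue fields. -/
theorem emb_ext {τ₁ τ₂ : Emb p k L} (h : ∀ a, (τ₁ a).coeff 0 = (τ₂ a).coeff 0) : τ₁ = τ₂ := by
  let : Algebra ℤ_[p] (WittVector p k) := (τ₁.comp (algebraMap ℤ_[p] (ONr p L))).toAlgebra
  let g₁ : ONr p L →ₐ[ℤ_[p]] WittVector p k := { τ₁ with commutes' := fun _ => rfl }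
  let g₂ : ONr p L →ₐ[ℤ_[p]] WittVector p k :=
    { τ₂ with
      commutes' := fun a => DFunLike.congr_fun
        (padicInt_ringHom_ext (τ₂.comp (algebraMap ℤ_[p] (ONr p L)))
          (τ₁.comp (algebraMap ℤ_[p] (ONr p L)))) a }
  have := formallyUnramified_ONr p L
  have hH : IsHausdorff (Ideal.span {(p : WittVector p k)}) (WittVector p k) := inferInstance
  have hI := hH.iInf_pow_smul
  simp only [smul_eq_mul, Ideal.mul_top] at hI
  have hg : g₁ = g₂ := by
    refine Algebra.FormallyUnramified.ext_of_iInf (Ideal.span {(p : WittVector p k)}) hI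
      fun x => ?_
    rw [Ideal.Quotient.eq, ← WittVector.ker_constantCoeff, RingHom.mem_ker, map_sub, sub_eq_zero]
    exact h x
  ext1 a
  exact DFunLike.congr_fun hg a

variable {π : OL p L}

theorem coeff_zero_eq_zero_of_mem (hπ : Irreducible π) (τ : Emb p k L) {a : ONr p L}
    (ha : (a : OL p L) ∈ Ideal.span {π}) : (τ a).coeff 0 = 0 := by
  obtain ⟨b, rfl⟩ := dvd_of_mem_span hπ ha
  change WittVector.constantCoeff (τ (p * b)) = 0
  rw [map_mul, map_mul, map_natCast, map_natCast, CharP.cast_eq_zero, zero_mul]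

theorem exists_residueEmb (hπ : Irreducible π) (τ : Emb p k L) :
    ∃ ρ : OL p L ⧸ Ideal.span {π} →+* k,
      ∀ a : ONr p L, ρ (Ideal.Quotient.mk _ (a : OL p L)) = (τ a).coeff 0 := by
  let g : ONr p L →+* OL p L ⧸ Ideal.span {π} :=
    (Ideal.Quotient.mk (Ideal.span {π})).comp (algebraMap (ONr p L) (OL p L))
  have hg : Function.Surjective g := by
    intro x
    obtain ⟨x, rfl⟩ := Ideal.Quotient.mk_surjective x
    obtain ⟨y, hy⟩ := exists_ONr_sub_mem hπ x
    exact ⟨y, Ideal.Quotient.eq.2 hy⟩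
  refine ⟨RingHom.liftOfSurjective g hg ⟨WittVector.constantCoeff.comp τ, fun a ha =>
    coeff_zero_eq_zero_of_mem hπ τ (Ideal.Quotient.eq_zero_iff_mem.1 ha)⟩, fun a => ?_⟩
  exact RingHom.liftOfRightInverse_comp_apply g _ _ _ a

theorem coeff_zero_pow_resDeg (hπ : Irreducible π) (τ : Emb p k L) (a : ONr p L) :
    (τ a).coeff 0 ^ p ^ resDeg π = (τ a).coeff 0 := by
  obtain ⟨ρ, hρ⟩ := exists_residueEmb hπ τ
  rw [← hρ, ← map_pow, ← map_pow]
  congr 1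
  exact Ideal.Quotient.eq.2 (pow_sub_mem_span hπ _)

open FCrystalOL

theorem sigmaInv_coeff_zero (τ : Emb p k L) (a : ONr p L) :
    (sigmaInv τ a).coeff 0 ^ p = (τ a).coeff 0 := by
  rw [← WittVector.coeff_frobenius_charP]
  congr 1
  exact frobenius_frobeniusEquiv_symm (τ a)

theorem sigmaInv_iterate_coeff_zero (τ : Emb p k L) (a : ONr p L) (i : ℕ) :
    (sigmaInv^[i] τ a).coeff 0 ^ p ^ i = (τ a).coeff 0 := by
  induction i with
  | zero => simp
  | succ i ih => rw [Function.iterate_succ_apply', pow_succ', pow_mul, sigmaInv_coeff_zero, ih]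

theorem sigmaInv_injective : Function.Injective (sigmaInv : Emb p k L → Emb p k L) := by
  intro τ₁ τ₂ h
  refine emb_ext fun a => ?_
  rw [← sigmaInv_coeff_zero τ₁, ← sigmaInv_coeff_zero τ₂, h]

theorem sigmaInv_iterate_resDeg (hπ : Irreducible π) (τ : Emb p k L) :
    sigmaInv^[resDeg π] τ = τ :=
  emb_ext fun a => by rw [← coeff_zero_pow_resDeg hπ, sigmaInv_iterate_coeff_zero]

theorem finite_residue (hπ : Irreducible π) : Finite (OL p L ⧸ Ideal.span {π}) :=
  Nat.finite_of_card_ne_zero (by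
    rw [natCard_residue hπ]
    exact pow_ne_zero _ (Fact.out : p.Prime).ne_zero)

theorem card_le_of_forall_pow_eq {K : Type*} [CommRing K] (hK : IsField K) [Finite K] {q : ℕ}
    (hq : 1 < q) (h : ∀ x : K, x ^ q = x) : Nat.card K ≤ q := by
  let : Field K := hK.toField
  classical
  have := Fintype.ofFinite K
  rw [Nat.card_eq_fintype_card]
  have h0 := FiniteField.X_pow_card_sub_X_ne_zero K hq
  have h1 := Polynomial.card_roots' (Polynomial.X ^ q - Polynomial.X : Polynomial K)
  rw [FiniteField.X_pow_card_sub_X_natDegree_eq K hq] at h1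
  refine le_trans ?_ h1
  refine le_trans (Finset.card_le_card (s := Finset.univ) (t := Multiset.toFinset
    (Polynomial.X ^ q - Polynomial.X : Polynomial K).roots) fun x _ => ?_)
    (Multiset.toFinset_card_le _)
  rw [Multiset.mem_toFinset, Polynomial.mem_roots h0]
  simp [h x]

/-- Otherwise all `p ^ f` elements of the residue field would be roots of `X ^ (p ^ i) - X`. -/
theorem sigmaInv_iterate_ne (hπ : Irreducible π) (τ : Emb p k L) {i : ℕ} (hi : 0 < i)
    (hi' : i < resDeg π) : sigmaInv^[i] τ ≠ τ := by
  intro h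
  have hK := (Ideal.Quotient.maximal_ideal_iff_isField_quotient _).1 (isMaximal_span hπ)
  have := finite_residue hπ
  have hp := (Fact.out : p.Prime).one_lt
  obtain ⟨ρ, hρ⟩ := exists_residueEmb hπ τ
  have hinj : Function.Injective ρ := by
    let := hK.toField
    exact ρ.injective
  have := card_le_of_forall_pow_eq hK (q := p ^ i)
    (Nat.one_lt_pow hi.ne' hp) fun x => by
      refine hinj ?_
      obtain ⟨x, rfl⟩ := Ideal.Quotient.mk_surjective x
      obtain ⟨y, hy⟩ := exists_ONr_sub_mem hπ x
      rw [← Ideal.Quotient.eq.2 hy, map_pow, hρ]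
      conv_lhs => rw [← h]
      exact sigmaInv_iterate_coeff_zero τ y i
  rw [natCard_residue hπ] at this
  exact absurd (Nat.pow_lt_pow_right hp hi') this.not_gt

/-- Two homomorphisms from a finite field to a field differ by a power of the Frobenius. -/
theorem exists_eq_pow_of_finite {K : Type*} [CommRing K] (hK : IsField K) [Finite K]
    (ρ₁ ρ₂ : K →+* k) : ∃ i : ℕ, ∀ x, ρ₂ x = ρ₁ x ^ p ^ i := by
  let : Field K := hK.toField
  classical
  have := Fintype.ofFinite K
  have : CharP K p := ρ₁.charP ρ₁.injective p
  -- With `q = |K|`, the image of `ρ₁` already exhausts the at most `q` roots of `X ^ q - X` in `k`,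
  -- and the values of `ρ₂` are such roots. So `ρ₁⁻¹ ∘ ρ₂` is an automorphism of `K`, a power of
  -- Frobenius.
  have hroots : ∀ x : K, ∃ y : K, ρ₁ y = ρ₂ x := by
    intro x
    have hq := Fintype.one_lt_card (α := K)
    have h0 := FiniteField.X_pow_card_sub_X_ne_zero k hq
    have hmem (ρ : K →+* k) (x : K) : ρ x ∈ (Polynomial.X ^ Fintype.card K - Polynomial.X :
        Polynomial k).roots.toFinset := by
      rw [Multiset.mem_toFinset, Polynomial.mem_roots h0]
      simp [← map_pow, FiniteField.pow_card]
    have hcard : (Polynomial.X ^ Fintype.card K - Polynomial.X :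
        Polynomial k).roots.toFinset.card ≤ (Finset.univ.image ρ₁).card := by
      rw [Finset.card_image_of_injective _ ρ₁.injective, Finset.card_univ]
      refine (Multiset.toFinset_card_le _).trans ((Polynomial.card_roots' _).trans ?_)
      rw [FiniteField.X_pow_card_sub_X_natDegree_eq k hq]
    have h := Finset.eq_of_subset_of_card_le (fun y hy => by
      obtain ⟨x, -, rfl⟩ := Finset.mem_image.1 hy
      exact hmem ρ₁ x) hcard
    have h2 := hmem ρ₂ x
    rw [← h] at h2
    obtain ⟨y, -, hy⟩ := Finset.mem_image.1 h2
    exact ⟨y, hy⟩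
  choose g hg using hroots
  let g' : K →+* K :=
    { toFun := g
      map_one' := ρ₁.injective (by simp [hg])
      map_mul' := fun x y => ρ₁.injective (by simp [hg])
      map_zero' := ρ₁.injective (by simp [hg])
      map_add' := fun x y => ρ₁.injective (by simp [hg]) }
  let : Algebra (ZMod p) K := ZMod.algebra K p
  let g'' : K →ₐ[ZMod p] K :=
    { g' with
      commutes' := fun a => DFunLike.congr_fun
        ((g'.comp (algebraMap (ZMod p) K)).ext_zmod (algebraMap (ZMod p) K)) a }
  obtain ⟨i, hi⟩ := FiniteField.exists_forall_apply_eq_pow (ZMod p) p K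
    (AlgEquiv.ofBijective g'' (Finite.injective_iff_bijective.1 g''.toRingHom.injective))
  refine ⟨i, fun x => ?_⟩
  rw [Nat.card_zmod] at hi
  rw [← hg, ← map_pow, ← hi x]
  rfl

theorem exists_sigmaInv_iterate_eq (hπ : Irreducible π) (τ τ' : Emb p k L) :
    ∃ i < resDeg π, sigmaInv^[i] τ = τ' := by
  have hK := (Ideal.Quotient.maximal_ideal_iff_isField_quotient _).1 (isMaximal_span hπ)
  have := finite_residue hπ
  have hf := resDeg_pos hπ
  obtain ⟨ρ, hρ⟩ := exists_residueEmb hπ τ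
  obtain ⟨ρ', hρ'⟩ := exists_residueEmb hπ τ'
  obtain ⟨i, hi⟩ := exists_eq_pow_of_finite (p := p) hK ρ ρ'
  -- The residue maps give `τ' = σ ^ i τ`. Since `σ ^ f` fixes `τ`, `σ ^ i` acts as `σ ^ (-(f - 1)
  -- i)`, a power of `sigmaInv`.
  have h : sigmaInv^[(resDeg π - 1) * i] τ = τ' := by
    refine emb_ext fun a => ?_
    rw [← hρ', hi, hρ,
      ← sigmaInv_iterate_coeff_zero τ a ((resDeg π - 1) * i), ← pow_mul, ← pow_add, ← Nat.succ_mul,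
      Nat.succ_eq_add_one, Nat.sub_add_cancel hf]
    have (n : ℕ) (τ : Emb p k L) : (τ a).coeff 0 ^ p ^ (resDeg π * n) = (τ a).coeff 0 := by
      induction n with
      | zero => simp
      | succ n ih => rw [Nat.mul_succ, pow_add, pow_mul, ih, coeff_zero_pow_resDeg hπ]
    rw [this]
  refine ⟨(resDeg π - 1) * i % resDeg π, Nat.mod_lt _ hf, ?_⟩
  have hper : Function.IsPeriodicPt sigmaInv (resDeg π) τ := sigmaInv_iterate_resDeg hπ τ
  rw [hper.iterate_mod_apply, h]

/-- This makes `𝒯` finite with `f` elements, so that the `finsum`s defining the polygons are true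
sums, taken along the orbit of any one embedding. -/
theorem bijective_sigmaInv_iterate (hπ : Irreducible π) (τ : Emb p k L) :
    Function.Bijective fun i : Fin (resDeg π) => sigmaInv^[i.val] τ := by
  constructor
  · have key (i j : Fin (resDeg π)) (hij : i < j) (h : sigmaInv^[i.val] τ = sigmaInv^[j.val] τ) :
        False := by
      obtain ⟨c, hc⟩ := Nat.exists_eq_add_of_lt hij
      rw [hc, add_assoc, Function.iterate_add_apply] at h
      exact sigmaInv_iterate_ne hπ τ (Nat.succ_pos c) (by omega)
        (sigmaInv_injective.iterate _ h).symm
    intro i j h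
    rcases lt_trichotomy i j with hij | hij | hij
    · exact (key i j hij h).elim
    · exact hij
    · exact (key j i hij h.symm).elim
  · intro τ'
    obtain ⟨i, hi, h⟩ := exists_sigmaInv_iterate_eq hπ τ τ'
    exact ⟨⟨i, hi⟩, h⟩

theorem finsum_emb (hπ : Irreducible π) (τ : Emb p k L) {G : Type*} [AddCommMonoid G]
    (g : Emb p k L → G) :
    ∑ᶠ τ', g τ' = ∑ i : Fin (resDeg π), g (sigmaInv^[i.val] τ) := by
  rw [← finsum_eq_sum_of_fintype]
  exact (finsum_eq_of_bijective _ (bijective_sigmaInv_iterate hπ τ) fun _ => rfl).symm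

end Embeddings

/-! ### Noetherian local rings with principal maximal ideal. -/

section Principal

open IsLocalRing

variable {A : Type*} [CommRing A] [IsNoetherianRing A] [IsLocalRing A] {ϖ : A}

/-- By Krull's intersection theorem a nonzero `x` lies in a last power of the maximal ideal. -/
theorem exists_unit_mul_pow (h : maximalIdeal A = Ideal.span {ϖ}) {x : A} (hx : x ≠ 0) :
    ∃ (n : ℕ) (u : Aˣ), x = u * ϖ ^ n := by
  classical
  have hinf := Ideal.iInf_pow_eq_bot_of_isLocalRing (maximalIdeal A) Ideal.IsPrime.ne_top'
  have hex : ∃ n, x ∉ maximalIdeal A ^ n := by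
    by_contra! hall
    exact hx (by simpa [hinf] using (Submodule.mem_iInf _).2 hall)
  have h0 : Nat.find hex ≠ 0 := by
    intro h0
    have := Nat.find_spec hex
    rw [h0] at this
    simp at this
  obtain ⟨n, hn⟩ := Nat.exists_eq_succ_of_ne_zero h0
  have h1 : x ∈ maximalIdeal A ^ n := not_not.1 (Nat.find_min hex (hn ▸ Nat.lt_succ_self n))
  have h2 : x ∉ maximalIdeal A ^ (n + 1) := by
    have := Nat.find_spec hex
    rwa [hn] at this
  rw [h, Ideal.span_singleton_pow, Ideal.mem_span_singleton] at h1 h2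
  obtain ⟨y, rfl⟩ := h1
  have hy : IsUnit y := by
    by_contra hy
    have : y ∈ maximalIdeal A := hy
    rw [h, Ideal.mem_span_singleton] at this
    exact h2 (by rw [pow_succ]; exact mul_dvd_mul_left _ this)
  exact ⟨n, hy.unit, mul_comm _ _⟩

theorem isDomain_of_maximalIdeal_eq_span (h : maximalIdeal A = Ideal.span {ϖ})
    (hnil : ¬ IsNilpotent ϖ) : IsDomain A := by
  have : NoZeroDivisors A := by
    refine ⟨fun {x y} hxy => ?_⟩
    by_contra! hne
    obtain ⟨m, u, rfl⟩ := exists_unit_mul_pow h hne.1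
    obtain ⟨n, v, rfl⟩ := exists_unit_mul_pow h hne.2
    refine hnil ⟨m + n, ?_⟩
    have h1 : ((u * v : Aˣ) : A) * ϖ ^ (m + n) = 0 := by
      rw [← hxy, Units.val_mul]
      ring
    exact (Units.mul_right_eq_zero _).1 h1
  exact NoZeroDivisors.to_isDomain A

theorem irreducible_of_maximalIdeal_eq_span [IsDomain A] (h : maximalIdeal A = Ideal.span {ϖ})
    (h0 : ϖ ≠ 0) : Irreducible ϖ := by
  refine Prime.irreducible ((Ideal.span_singleton_prime h0).1 ?_)
  rw [← h]
  infer_instance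

theorem isDiscreteValuationRing_of_maximalIdeal_eq_span [IsDomain A]
    (h : maximalIdeal A = Ideal.span {ϖ}) (h0 : ϖ ≠ 0) : IsDiscreteValuationRing A :=
  IsDiscreteValuationRing.ofHasUnitMulPowIrreducibleFactorization
    ⟨ϖ, irreducible_of_maximalIdeal_eq_span h h0, fun hx => by
      obtain ⟨n, u, rfl⟩ := exists_unit_mul_pow h hx
      exact ⟨n, u, mul_comm _ _⟩⟩

end Principal

/-! ### Finiteness and freeness of the twisted tensor product. -/

section Twist

variable {A W O : Type*} [CommRing A] [CommRing W] [CommRing O] [Algebra A O] (τ : A →+* W)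

theorem isScalarTower_twist : IsScalarTower W (Twist τ) (Twist τ ⊗[A] O) := by
  have : IsScalarTower W (Twist τ) (Twist τ) := inferInstanceAs (IsScalarTower W W W)
  exact TensorProduct.isScalarTower_left

theorem finite_twist [Module.Finite A O] : Module.Finite W (Twist τ ⊗[A] O) := by
  have : Module.Finite W (Twist τ) := inferInstanceAs (Module.Finite W W)
  have := isScalarTower_twist (O := O) τ
  exact Module.Finite.trans (Twist τ) (Twist τ ⊗[A] O)

theorem free_twist [Module.Free A O] : Module.Free W (Twist τ ⊗[A] O) := by
  have : Module.Free W (Twist τ) := inferInstanceAs (Module.Free W W)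
  have := isScalarTower_twist (O := O) τ
  exact Module.Free.trans (S := Twist τ)

end Twist

/-! ### `W_τ` is a complete discrete valuation ring with uniformizer `π` and residue field `k`. -/

section Coefficients

open IsLocalRing

variable {p : ℕ} [Fact p.Prime] {k : Type*} [Field k] [CharP k p] [PerfectRing k p]
  {L : Type*} [Field L] [Algebra ℚ_[p] L] [FiniteDimensional ℚ_[p] L]
  [Algebra ℤ_[p] L] [IsScalarTower ℤ_[p] ℚ_[p] L] {π : OL p L}

theorem isPrincipalIdealRing_ONr (hπ : Irreducible π) : IsPrincipalIdealRing (ONr p L) := by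
  have := isLocalRing_subalgebra (ONr p L)
  have := finite_subalgebra (ONr p L)
  have : IsNoetherianRing (ONr p L) := IsNoetherianRing.of_finite ℤ_[p] (ONr p L)
  have h0 : (p : ONr p L) ≠ 0 := fun h => natCast_p_ne_zero p L (congrArg Subtype.val h)
  have hmax : maximalIdeal (ONr p L) = Ideal.span {(p : ONr p L)} := by
    refine le_antisymm (fun y hy => Ideal.mem_span_singleton.2 (dvd_of_mem_span hπ ?_)) ?_
    · have := isLocalRing_OL p L
      have := isLocalHom_subalgebra (ONr p L)
      rw [span_eq_maximalIdeal hπ]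
      exact map_nonunit (algebraMap (ONr p L) (OL p L)) y hy
    · have := isIntegral_subalgebra (ONr p L)
      rw [Ideal.span_singleton_le_iff_mem, ← jacobson_eq_maximalIdeal _ bot_ne_top]
      exact natCast_p_mem_jacobson p (ONr p L)
  have := isDiscreteValuationRing_of_maximalIdeal_eq_span hmax h0
  infer_instance

/-- This makes `W_τ` free over `W(k)`, which is how `p` is seen not to be nilpotent there. -/
theorem free_OL (hπ : Irreducible π) : Module.Free (ONr p L) (OL p L) := by
  have := isPrincipalIdealRing_ONr hπ
  have := finite_OL p L
  have : Module.Finite (ONr p L) (OL p L) := Module.Finite.of_restrictScalars_finite ℤ_[p] _ _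
  infer_instance

namespace WOL

variable (τ : Emb p k L)

theorem tmul_eq (w : WittVector p k) (a : OL p L) :
    tmul τ w a = algebraMap (WittVector p k) (WOL τ) w * ofOL τ a := by
  have := Algebra.TensorProduct.tmul_mul_tmul (R := ONr p L) (show Twist τ from w)
    (show Twist τ from (1 : WittVector p k)) (1 : OL p L) a
  rw [one_mul] at this
  refine Eq.trans ?_ this.symm
  have h1 : (show Twist τ from w) * (show Twist τ from (1 : WittVector p k)) =
    (show Twist τ from w) := mul_one w
  rw [h1]
  rfl

theorem ofOL_coe (c : ONr p L) :
    ofOL τ (c : OL p L) = algebraMap (WittVector p k) (WOL τ) (τ c) := by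
  exact (Algebra.TensorProduct.includeRight :
    OL p L →ₐ[ONr p L] Twist τ ⊗[ONr p L] OL p L).commutes c

theorem tmul_induction {P : WOL τ → Prop} (x : WOL τ) (htmul : ∀ w a, P (tmul τ w a))
    (hadd : ∀ x y, P x → P y → P (x + y)) : P x := by
  refine TensorProduct.induction_on x ?_ htmul hadd
  have := htmul 0 0
  rw [tmul_eq, map_zero, zero_mul] at this
  exact this

theorem finite : Module.Finite (WittVector p k) (WOL τ) := by
  have := finite_OL p L
  have : Module.Finite (ONr p L) (OL p L) := Module.Finite.of_restrictScalars_finite ℤ_[p] _ _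
  exact finite_twist τ

theorem free (hπ : Irreducible π) : Module.Free (WittVector p k) (WOL τ) := by
  have := free_OL hπ
  exact free_twist τ

theorem exists_residue (hπ : Irreducible π) : ∃ χ : WOL τ →+* k, χ (ofOL τ π) = 0 ∧
    ∀ w, χ (algebraMap (WittVector p k) (WOL τ) w) = w.coeff 0 := by
  obtain ⟨ρ, hρ⟩ := exists_residueEmb hπ τ
  let : Algebra (ONr p L) k := (WittVector.constantCoeff.comp τ).toAlgebra
  let f : Twist τ →ₐ[ONr p L] k :=
    { (WittVector.constantCoeff : WittVector p k →+* k) with commutes' := fun _ => rfl }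
  let g : OL p L →ₐ[ONr p L] k :=
    { ρ.comp (Ideal.Quotient.mk (Ideal.span {π})) with commutes' := hρ }
  refine ⟨(Algebra.TensorProduct.lift f g fun _ _ => Commute.all _ _).toRingHom, ?_, fun w => ?_⟩
  · refine (Algebra.TensorProduct.lift_tmul _ _ _ _ _).trans ?_
    have : g π = 0 := by
      change ρ (Ideal.Quotient.mk (Ideal.span {π}) π) = 0
      rw [Ideal.Quotient.eq_zero_iff_mem.2 (Ideal.mem_span_singleton_self π), map_zero]
    rw [this, mul_zero]
  · refine (Algebra.TensorProduct.lift_tmul _ _ _ _ _).trans ?_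
    rw [map_one, mul_one]
    rfl

/-- On a pure tensor `w ⊗ a`, replace `a` modulo `π` by an element of `O_{L^nr}`, which moves across
the tensor sign. So `W(k)` surjects onto `W_τ / π`. -/
theorem exists_eq_add (hπ : Irreducible π) (x : WOL τ) :
    ∃ w b, x = algebraMap (WittVector p k) (WOL τ) w + ofOL τ π * b := by
  refine tmul_induction τ (P := fun x => ∃ w b, x =
    algebraMap (WittVector p k) (WOL τ) w + ofOL τ π * b) x (fun w a => ?_) fun x y hx hy => ?_
  · obtain ⟨c, hc⟩ := exists_ONr_sub_mem hπ a
    obtain ⟨b, hb⟩ := Ideal.mem_span_singleton.1 hc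
    refine ⟨w * τ c, -(algebraMap (WittVector p k) (WOL τ) w * ofOL τ b), ?_⟩
    rw [tmul_eq, ← sub_sub_cancel (c : OL p L) a, hb, map_sub, ofOL_coe, map_mul, map_mul]
    ring
  · obtain ⟨w, b, rfl⟩ := hx
    obtain ⟨w', b', rfl⟩ := hy
    refine ⟨w + w', b + b', ?_⟩
    rw [map_add]
    ring

theorem exists_p_eq (hπ : Irreducible π) : ∃ (n : ℕ) (u : (WOL τ)ˣ), 0 < n ∧
    algebraMap (WittVector p k) (WOL τ) p = u * ofOL τ π ^ n := by
  obtain ⟨n, u, hn, h⟩ := PRCrystal.exists_p_eq hπ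
  refine ⟨n, Units.map (ofOL τ : OL p L →* WOL τ) u, hn, ?_⟩
  rw [map_natCast, ← map_natCast (ofOL τ), h, map_mul, map_pow]
  rfl

theorem ker_residue (hπ : Irreducible π) {χ : WOL τ →+* k} (h0 : χ (ofOL τ π) = 0)
    (hχ : ∀ w, χ (algebraMap (WittVector p k) (WOL τ) w) = w.coeff 0) :
    RingHom.ker χ = Ideal.span {ofOL τ π} := by
  refine le_antisymm (fun x hx => ?_) ?_
  · obtain ⟨w, b, rfl⟩ := exists_eq_add τ hπ x
    rw [RingHom.mem_ker, map_add, map_mul, h0, zero_mul, add_zero, hχ] at hx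
    have hw : w ∈ RingHom.ker (WittVector.constantCoeff : WittVector p k →+* k) := hx
    rw [WittVector.ker_constantCoeff, Ideal.mem_span_singleton] at hw
    obtain ⟨w, rfl⟩ := hw
    obtain ⟨n, u, hn, h⟩ := exists_p_eq τ hπ
    refine add_mem ?_ (Ideal.mul_mem_right _ _ (Ideal.mem_span_singleton_self _))
    rw [map_mul, h]
    exact Ideal.mul_mem_right _ _ (Ideal.mul_mem_left _ _
      (Ideal.pow_mem_of_mem _ (Ideal.mem_span_singleton_self _) n hn))
  · rwa [Ideal.span_singleton_le_iff_mem, RingHom.mem_ker]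

theorem residue_surjective {χ : WOL τ →+* k}
    (hχ : ∀ w, χ (algebraMap (WittVector p k) (WOL τ) w) = w.coeff 0) :
    Function.Surjective χ := fun x => ⟨algebraMap _ _ (WittVector.teichmuller p x), by simp [hχ]⟩

theorem isMaximal_span (hπ : Irreducible π) : (Ideal.span {ofOL τ π}).IsMaximal := by
  obtain ⟨χ, h0, hχ⟩ := exists_residue τ hπ
  rw [← ker_residue τ hπ h0 hχ]
  exact RingHom.ker_isMaximal_of_surjective χ (residue_surjective τ hχ)

theorem isNoetherianRing : IsNoetherianRing (WOL τ) := by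
  have := finite τ
  exact IsNoetherianRing.of_finite (WittVector p k) (WOL τ)

theorem ofOL_mem (hπ : Irreducible π) (P : Ideal (WOL τ)) (hP : P.IsMaximal) : ofOL τ π ∈ P := by
  have := finite τ
  have h1 : (Ideal.comap (algebraMap (WittVector p k) (WOL τ)) P).IsMaximal :=
    Ideal.isMaximal_comap_of_isIntegral_of_isMaximal P
  have h2 : (p : WittVector p k) ∈ Ideal.comap (algebraMap (WittVector p k) (WOL τ)) P := by
    rw [IsLocalRing.eq_maximalIdeal h1, IsLocalRing.mem_maximalIdeal]
    exact (WittVector.irreducible p).not_isUnit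
  obtain ⟨n, u, hn, h⟩ := exists_p_eq τ hπ
  rw [Ideal.mem_comap, h] at h2
  exact hP.isPrime.mem_of_pow_mem n ((hP.isPrime.mem_or_mem h2).resolve_left fun hu =>
    hP.ne_top (Ideal.eq_top_of_isUnit_mem _ hu u.isUnit))

theorem eq_span (hπ : Irreducible π) (P : Ideal (WOL τ)) (hP : P.IsMaximal) :
    P = Ideal.span {ofOL τ π} :=
  ((isMaximal_span τ hπ).eq_of_le hP.ne_top
    ((Ideal.span_singleton_le_iff_mem _).2 (ofOL_mem τ hπ P hP))).symm

theorem isLocalRing (hπ : Irreducible π) : IsLocalRing (WOL τ) :=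
  IsLocalRing.of_unique_max_ideal ⟨_, isMaximal_span τ hπ, fun P hP => eq_span τ hπ P hP⟩

/-- Otherwise `p`, a unit times a positive power of `π`, would be nilpotent in a nonzero free
`W(k)`-module. -/
theorem not_isNilpotent (hπ : Irreducible π) : ¬ IsNilpotent (ofOL τ π) := by
  rintro ⟨m, hm⟩
  have := free τ hπ
  have := isLocalRing τ hπ
  obtain ⟨n, u, hn, h⟩ := exists_p_eq τ hπ
  have h1 : algebraMap (WittVector p k) (WOL τ) (p ^ m) = 0 := by
    rw [map_pow, h, mul_pow, ← pow_mul, mul_comm n, pow_mul, hm, zero_pow hn.ne', mul_zero]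
  have h2 := (FaithfulSMul.algebraMap_injective (WittVector p k) (WOL τ)) (h1.trans (map_zero _).symm)
  exact pow_ne_zero m (WittVector.irreducible p (k := k)).ne_zero h2

theorem isDomain (hπ : Irreducible π) : IsDomain (WOL τ) := by
  have := isNoetherianRing τ
  have := isLocalRing τ hπ
  exact isDomain_of_maximalIdeal_eq_span
    (eq_span τ hπ _ (IsLocalRing.maximalIdeal.isMaximal _)) (not_isNilpotent τ hπ)

theorem isDiscreteValuationRing [IsDomain (WOL τ)] (hπ : Irreducible π) :
    IsDiscreteValuationRing (WOL τ) := by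
  have := isNoetherianRing τ
  have := isLocalRing τ hπ
  exact isDiscreteValuationRing_of_maximalIdeal_eq_span
    (eq_span τ hπ _ (IsLocalRing.maximalIdeal.isMaximal _)) fun h =>
      not_isNilpotent τ hπ (h ▸ IsNilpotent.zero)

theorem irreducible (hπ : Irreducible π) : Irreducible (ofOL τ π) := by
  have := isNoetherianRing τ
  have := isLocalRing τ hπ
  have := isDomain τ hπ
  exact irreducible_of_maximalIdeal_eq_span
    (eq_span τ hπ _ (IsLocalRing.maximalIdeal.isMaximal _)) fun h =>
      not_isNilpotent τ hπ (h ▸ IsNilpotent.zero)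

theorem isPrecomplete (hπ : Irreducible π) : IsPrecomplete (Ideal.span {ofOL τ π}) (WOL τ) := by
  have := finite τ
  have h1 : IsPrecomplete (Ideal.span {(p : WittVector p k)}) (WOL τ) := IsPrecomplete.of_finite _
  obtain ⟨n, u, hn, h⟩ := exists_p_eq τ hπ
  rw [← IsPrecomplete.map_algebraMap_iff (S := WOL τ), Ideal.map_span, Set.image_singleton, h,
    Ideal.span_singleton_mul_left_unit u.isUnit] at h1
  exact IsPrecomplete.of_pow hn

/-- `W_τ / π` is `k`, on which `W(k)` acts by reduction. Lengths over `W(k)` therefore count both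
`π`-adic valuations and `k`-dimensions. -/
theorem length_residue (hπ : Irreducible π) :
    Module.length (WittVector p k) (WOL τ ⧸ Ideal.span {ofOL τ π}) = 1 := by
  have hmax := isMaximal_span τ hπ
  have : Nontrivial (WOL τ ⧸ Ideal.span {ofOL τ π}) :=
    Ideal.Quotient.nontrivial_iff.2 hmax.ne_top
  rw [Module.length_eq_one_iff]
  obtain ⟨χ, h0, hχ⟩ := exists_residue τ hπ
  have hker := ker_residue τ hπ h0 hχ
  refine isSimpleModule_iff_toSpanSingleton_surjective.2 ⟨this, fun x hx y => ?_⟩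
  obtain ⟨x, rfl⟩ := Ideal.Quotient.mk_surjective x
  obtain ⟨y, rfl⟩ := Ideal.Quotient.mk_surjective y
  have hx0 : χ x ≠ 0 := by
    intro hx0
    have : x ∈ RingHom.ker χ := hx0
    rw [hker] at this
    exact hx (Ideal.Quotient.eq_zero_iff_mem.2 this)
  refine ⟨WittVector.teichmuller p (χ y / χ x), ?_⟩
  rw [LinearMap.toSpanSingleton_apply, Algebra.smul_def,
    IsScalarTower.algebraMap_apply (WittVector p k) (WOL τ), Ideal.Quotient.algebraMap_eq,
    ← map_mul, Ideal.Quotient.eq, ← hker, RingHom.mem_ker, map_sub, map_mul, hχ,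
    WittVector.teichmuller_coeff_zero, div_mul_cancel₀ _ hx0, sub_self]

end WOL

end Coefficients

/-! ### Coefficient rings of Frobenius-conjugate embeddings. -/

section TwistCongr

variable {A W O : Type*} [CommRing A] [CommRing W] [CommRing O] [Algebra A O]

/-- The isomorphism `W ⊗_{A, τ'} O ≃ W ⊗_{A, τ} O` induced by an automorphism `σ` of `W` such that
`σ ∘ τ' = τ`. -/
def twistCongr {τ' τ : A →+* W} (σ : W ≃+* W) (h : ∀ a, σ (τ' a) = τ a) :
    Twist τ' ⊗[A] O ≃+* Twist τ ⊗[A] O :=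
  (Algebra.TensorProduct.congr
    (AlgEquiv.ofRingEquiv (f := (show Twist τ' ≃+* Twist τ from σ)) h)
    (AlgEquiv.refl : O ≃ₐ[A] O)).toRingEquiv

theorem twistCongr_tmul {τ' τ : A →+* W} (σ : W ≃+* W) (h : ∀ a, σ (τ' a) = τ a) (w : W) (b : O) :
    twistCongr σ h ((show Twist τ' from w) ⊗ₜ[A] b) = (show Twist τ from σ w) ⊗ₜ[A] b := rfl

end TwistCongr

section RestrictScalars

theorem relLength_restrictScalars {R A M : Type*} [CommRing R] [CommRing A] [Algebra R A]
    [AddCommGroup M] [Module R M] [Module A M] [IsScalarTower R A M] (B C : Submodule A M) :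
    relLength R (B.restrictScalars R) (C.restrictScalars R) = relLength R B C :=
  (Submodule.Quotient.restrictScalarsEquiv R (C.submoduleOf B)).length_eq

end RestrictScalars

/-! ### The components `M_τ` and the Frobenius between them. -/

section Components

variable {p : ℕ} [Fact p.Prime] {k : Type*} [Field k] [CharP k p] [PerfectRing k p]
  {L : Type*} [Field L] [Algebra ℚ_[p] L] [FiniteDimensional ℚ_[p] L]
  [Algebra ℤ_[p] L] [IsScalarTower ℤ_[p] ℚ_[p] L] {π : OL p L}
  {M : Type*} [AddCommGroup M] [Module (WittVector p k) M]
  [Module.Free (WittVector p k) M] [Module.Finite (WittVector p k) M]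
  (X : FCrystalOL p k L M)

namespace FCrystalOL

theorem finite_comp (τ : Emb p k L) : Module.Finite (WOL τ) (X.comp τ) :=
  Module.Finite.of_restrictScalars_finite (WittVector p k) _ _

/-- An element killed by `π ^ n` is killed by `p ^ n`, and `M` is free over `W(k)`. -/
theorem isTorsionFree_comp (hπ : Irreducible π) (τ : Emb p k L) :
    Module.IsTorsionFree (WOL τ) (X.comp τ) := by
  have := WOL.isDomain τ hπ
  have := WOL.isDiscreteValuationRing τ hπ
  refine Module.IsTorsionFree.of_smul_eq_zero fun c x hcx => ?_
  by_contra! hne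
  obtain ⟨n, u, rfl⟩ :=
    IsDiscreteValuationRing.eq_unit_mul_pow_irreducible hne.1 (WOL.irreducible τ hπ)
  obtain ⟨m, v, hm, hv⟩ := WOL.exists_p_eq τ hπ
  obtain ⟨m, rfl⟩ := Nat.exists_eq_succ_of_ne_zero hm.ne'
  have h1 : algebraMap (WittVector p k) (WOL τ) (p ^ n) • x = 0 := by
    have : algebraMap (WittVector p k) (WOL τ) (p ^ n) =
        ((v : WOL τ) ^ n * ofOL τ π ^ (m * n) * ↑u⁻¹) * (u * ofOL τ π ^ n) := by
      rw [map_pow, hv, mul_pow, ← pow_mul, Nat.succ_mul, pow_add]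
      have hu : (u : WOL τ) * ↑u⁻¹ = 1 := u.mul_inv
      linear_combination -((v : WOL τ) ^ n * ofOL τ π ^ (m * n) * ofOL τ π ^ n) * hu
    rw [this, mul_smul, hcx, smul_zero]
  rw [algebraMap_smul] at h1
  exact hne.2 ((smul_eq_zero.1 h1).resolve_left
    (pow_ne_zero n (WittVector.irreducible p (k := k)).ne_zero))

/-- An additive endomorphism of `M` that is semilinear with respect to the automorphism `σ` of
`W(k)` and commutes with the action of `O_L`. -/
structure IsTwisted (σ : WittVector p k ≃+* WittVector p k) (Φ : AddMonoid.End M) : Prop where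
  map_smul : ∀ (w : WittVector p k) (x : M), Φ (w • x) = σ w • Φ x
  map_act : ∀ (a : OL p L) (x : M), Φ (X.act a x) = X.act a (Φ x)

variable {X}

section Twisted

variable {σ : WittVector p k ≃+* WittVector p k} {Φ : AddMonoid.End M} {τ' τ : Emb p k L}

theorem IsTwisted.map_mem (hΦ : X.IsTwisted σ Φ) (h : ∀ a, σ (τ' a) = τ a) {x : M}
    (hx : x ∈ X.comp τ') : Φ x ∈ X.comp τ := by
  intro a
  rw [← hΦ.map_act, hx a, hΦ.map_smul, h]

/-- The map `M_{τ'} → M_τ` induced by a twisted endomorphism. -/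
def IsTwisted.compMap (hΦ : X.IsTwisted σ Φ) (h : ∀ a, σ (τ' a) = τ a) :
    X.comp τ' →+ X.comp τ where
  toFun x := ⟨Φ x, hΦ.map_mem h x.2⟩
  map_zero' := Subtype.ext (map_zero Φ)
  map_add' x y := Subtype.ext (map_add Φ (x : M) (y : M))

theorem IsTwisted.coe_compMap (hΦ : X.IsTwisted σ Φ) (h : ∀ a, σ (τ' a) = τ a) (x : X.comp τ') :
    (hΦ.compMap h x : M) = Φ (x : M) := rfl

theorem IsTwisted.compMap_injective (hΦ : X.IsTwisted σ Φ) (h : ∀ a, σ (τ' a) = τ a)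
    (hinj : Function.Injective Φ) : Function.Injective (hΦ.compMap h) := fun _ _ hxy =>
  Subtype.ext (hinj (congrArg Subtype.val hxy))

/-- The isomorphism of coefficient rings induced by an automorphism of `W(k)`. -/
def wolCongr (σ : WittVector p k ≃+* WittVector p k) (h : ∀ a, σ (τ' a) = τ a) :
    WOL τ' ≃+* WOL τ := twistCongr σ h

theorem wolCongr_ofOL (h : ∀ a, σ (τ' a) = τ a) (a : OL p L) :
    wolCongr σ h (ofOL τ' a) = ofOL τ a := by
  refine (twistCongr_tmul (τ' := τ') (τ := τ) σ h 1 a).trans ?_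
  rw [map_one]
  rfl

theorem IsTwisted.compMap_smul (hΦ : X.IsTwisted σ Φ) (h : ∀ a, σ (τ' a) = τ a) (c : WOL τ')
    (x : X.comp τ') : hΦ.compMap h (c • x) = wolCongr σ h c • hΦ.compMap h x := by
  refine WOL.tmul_induction τ' (P := fun c =>
    hΦ.compMap h (c • x) = wolCongr σ h c • hΦ.compMap h x) c (fun w a => ?_) fun c d hc hd => ?_
  · apply Subtype.ext
    rw [IsTwisted.coe_compMap, X.tmul_smul, hΦ.map_smul, hΦ.map_act]
    exact (X.tmul_smul τ (σ w) a (hΦ.compMap h x)).symm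
  · rw [add_smul, map_add, hc, hd, ← add_smul, map_add]

/-- The image of a submodule of `M_{τ'}` in `M_τ`. -/
def IsTwisted.mapSubmodule (hΦ : X.IsTwisted σ Φ) (h : ∀ a, σ (τ' a) = τ a)
    (B : Submodule (WOL τ') (X.comp τ')) : Submodule (WOL τ) (X.comp τ) where
  carrier := hΦ.compMap h '' B
  zero_mem' := ⟨0, zero_mem _, map_zero _⟩
  add_mem' := by
    rintro _ _ ⟨x, hx, rfl⟩ ⟨y, hy, rfl⟩
    exact ⟨x + y, add_mem hx hy, map_add _ _ _⟩
  smul_mem' := by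
    rintro c _ ⟨x, hx, rfl⟩
    refine ⟨(wolCongr σ h).symm c • x, B.smul_mem _ hx, ?_⟩
    rw [hΦ.compMap_smul, RingEquiv.apply_symm_apply]

theorem IsTwisted.mapSubmodule_mono (hΦ : X.IsTwisted σ Φ) (h : ∀ a, σ (τ' a) = τ a)
    {B C : Submodule (WOL τ') (X.comp τ')} (hBC : B ≤ C) :
    hΦ.mapSubmodule h B ≤ hΦ.mapSubmodule h C := Set.image_mono hBC

theorem IsTwisted.relLength_mapSubmodule (hΦ : X.IsTwisted σ Φ) (h : ∀ a, σ (τ' a) = τ a)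
    (hinj : Function.Injective Φ) (B C : Submodule (WOL τ') (X.comp τ')) :
    relLength (WittVector p k) (hΦ.mapSubmodule h B) (hΦ.mapSubmodule h C) =
      relLength (WittVector p k) B C := by
  let F : X.comp τ' →ₛₗ[(σ : WittVector p k →+* WittVector p k)] X.comp τ :=
    { hΦ.compMap h with
      map_smul' := fun w x => Subtype.ext (hΦ.map_smul w x) }
  have : RingHomSurjective (σ : WittVector p k →+* WittVector p k) := ⟨σ.surjective⟩
  have key := relLength_semilinear F (hΦ.compMap_injective h hinj)
    (B.restrictScalars (WittVector p k)) (C.restrictScalars (WittVector p k))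
  rw [relLength_restrictScalars] at key
  rw [← key, ← relLength_restrictScalars]
  rfl

theorem IsTwisted.finrank_le (hΦ : X.IsTwisted σ Φ) (h : ∀ a, σ (τ' a) = τ a)
    (hinj : Function.Injective Φ) (hπ : Irreducible π) {B : Submodule (WOL τ') (X.comp τ')}
    {C : Submodule (WOL τ) (X.comp τ)} (hBC : hΦ.mapSubmodule h B ≤ C) :
    Module.finrank (WOL τ') B ≤ Module.finrank (WOL τ) C := by
  have := WOL.isDomain τ hπ
  have := X.finite_comp τ
  have := WOL.isNoetherianRing τ
  let j : B →+ C :=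
    { toFun := fun x => ⟨hΦ.compMap h x, hBC ⟨x, x.2, rfl⟩⟩
      map_zero' := Subtype.ext (map_zero _)
      map_add' := fun x y => Subtype.ext (map_add _ _ _) }
  refine Cardinal.toNat_le_toNat (rank_le_of_surjective_injective (wolCongr σ h) j
    (wolCongr σ h).surjective (fun x y hxy => Subtype.ext (hΦ.compMap_injective h hinj
      (congrArg Subtype.val hxy))) fun c x => Subtype.ext (hΦ.compMap_smul h c x)) ?_
  exact Module.rank_lt_aleph0 (WOL τ) C

end Twisted

variable (X) in
/-- The Frobenius of `M` as an additive endomorphism. -/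
def frob : AddMonoid.End M := X.F.toAddMonoidHom

variable (X) in
theorem isTwisted_frob_pow (n : ℕ) :
    X.IsTwisted (WittVector.frobeniusEquiv p k ^ n) (X.frob ^ n) := by
  induction n with
  | zero => exact ⟨fun w x => rfl, fun a x => rfl⟩
  | succ n ih =>
    refine ⟨fun w x => ?_, fun a x => ?_⟩
    · rw [pow_succ', pow_succ', addEnd_mul_apply, addEnd_mul_apply, ih.map_smul]
      exact X.F.map_smulₛₗ _ _
    · rw [pow_succ', addEnd_mul_apply, addEnd_mul_apply, ih.map_act]
      exact X.F_act _ _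

variable (X) in
theorem frob_pow_injective (n : ℕ) : Function.Injective (X.frob ^ n) := by
  rw [AddMonoid.End.coe_pow]
  exact X.injective.iterate n

variable (X) in
theorem coe_frob_pow (n : ℕ) (x : M) : (X.frob ^ n) x = X.F^[n] x := by
  rw [AddMonoid.End.coe_pow]
  rfl

theorem frobeniusEquiv_pow_sigmaInv (τ : Emb p k L) (n : ℕ) (a : ONr p L) :
    (WittVector.frobeniusEquiv p k ^ n) (sigmaInv^[n] τ a) = τ a := by
  induction n generalizing τ with
  | zero => rfl
  | succ n ih =>
    rw [Function.iterate_succ_apply, pow_succ', RingAut.mul_apply, ih]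
    exact frobenius_frobeniusEquiv_symm (τ a)

theorem frobeniusEquiv_pow_resDeg (hπ : Irreducible π) (τ : Emb p k L) (a : ONr p L) :
    (WittVector.frobeniusEquiv p k ^ resDeg π) (τ a) = τ a := by
  conv_lhs => rw [← sigmaInv_iterate_resDeg hπ τ]
  exact frobeniusEquiv_pow_sigmaInv τ _ a

variable (X) in
/-- The image under `F^n` of a submodule of `M_{σ^{-n}τ}` in `M_τ`. -/
def frobMap (n : ℕ) (τ : Emb p k L)
    (B : Submodule (WOL (sigmaInv^[n] τ)) (X.comp (sigmaInv^[n] τ))) :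
    Submodule (WOL τ) (X.comp τ) :=
  (X.isTwisted_frob_pow n).mapSubmodule (frobeniusEquiv_pow_sigmaInv τ n) B

theorem mem_frobMap {n : ℕ} {τ : Emb p k L}
    {B : Submodule (WOL (sigmaInv^[n] τ)) (X.comp (sigmaInv^[n] τ))} {y : X.comp τ} :
    y ∈ X.frobMap n τ B ↔ ∃ x ∈ B, X.F^[n] (x : M) = y := by
  refine exists_congr fun x => and_congr_right fun _ => ?_
  rw [Subtype.ext_iff, IsTwisted.coe_compMap, coe_frob_pow]

theorem imF_eq_frobMap (τ : Emb p k L) : X.imF τ = X.frobMap 1 τ ⊤ := by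
  ext y
  rw [mem_frobMap]
  constructor
  · rintro ⟨x, hx, hxy⟩
    exact ⟨⟨x, hx⟩, trivial, hxy⟩
  · rintro ⟨x, -, hxy⟩
    exact ⟨x, x.2, hxy⟩

variable (X) in
/-- The linearization `F^f` of the Frobenius on `M_τ`. -/
def frobEnd (hπ : Irreducible π) (τ : Emb p k L) : AddMonoid.End (X.comp τ) :=
  (X.isTwisted_frob_pow (resDeg π)).compMap (frobeniusEquiv_pow_resDeg hπ τ)

variable (X) in
theorem coe_frobEnd (hπ : Irreducible π) (τ : Emb p k L) (x : X.comp τ) :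
    (X.frobEnd hπ τ x : M) = X.F^[resDeg π] x := X.coe_frob_pow _ _

variable (X) in
theorem coe_frobEnd_pow (hπ : Irreducible π) (τ : Emb p k L) (s : ℕ) (x : X.comp τ) :
    ((X.frobEnd hπ τ ^ s) x : M) = X.F^[resDeg π * s] x := by
  induction s with
  | zero => rfl
  | succ s ih =>
    rw [pow_succ', addEnd_mul_apply, coe_frobEnd, ih, ← Function.iterate_add_apply, Nat.mul_succ,
      add_comm]

variable (X) in
theorem isSemilinear_frobEnd (hπ : Irreducible π) (τ : Emb p k L) :
    IsSemilinear (ofOL τ π) (X.frobEnd hπ τ) :=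
  ⟨wolCongr _ (frobeniusEquiv_pow_resDeg hπ τ), wolCongr_ofOL _ π,
    (X.isTwisted_frob_pow (resDeg π)).compMap_smul _⟩

variable (X) in
theorem frobEnd_injective (hπ : Irreducible π) (τ : Emb p k L) :
    Function.Injective (X.frobEnd hπ τ) :=
  (X.isTwisted_frob_pow _).compMap_injective _ (X.frob_pow_injective _)

theorem relLength_map_frobEnd (hπ : Irreducible π) (τ : Emb p k L)
    (B C : Submodule (WOL τ) (X.comp τ)) :
    relLength (WittVector p k) ((X.isSemilinear_frobEnd hπ τ).map B)
      ((X.isSemilinear_frobEnd hπ τ).map C) = relLength (WittVector p k) B C :=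
  (X.isTwisted_frob_pow _).relLength_mapSubmodule (frobeniusEquiv_pow_resDeg hπ τ)
    (X.frob_pow_injective _) B C

-- Connects the definition with the abstract slope theory, taking `φ = F^f` and the normalization `κ
-- = e f`.
open scoped Pointwise in
theorem slopePart_eq (hπ : Irreducible π) (τ : Emb p k L) (t : ℚ) :
    X.slopePart π τ t =
      isoclinicPart (X.isSemilinear_frobEnd hπ τ) (ramIdx π * resDeg π) t := by
  unfold slopePart isoclinicPart
  congr 1
  ext Λ
  refine exists_congr fun s => exists_congr fun m => and_congr_right fun _ =>
    and_congr_right fun _ => ?_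
  have h1 : (fun x : X.comp τ => X.F^[resDeg π * s] (x : M)) '' Λ =
      Subtype.val '' (((X.isSemilinear_frobEnd hπ τ).pow s).map Λ : Set (X.comp τ)) := by
    rw [IsSemilinear.coe_map, ← Set.image_comp]
    exact Set.image_congr fun x _ => (X.coe_frobEnd_pow hπ τ s x).symm
  have h2 : (fun x : X.comp τ => ((ofOL τ π ^ m • x : X.comp τ) : M)) '' Λ =
      Subtype.val '' ((ofOL τ π ^ m • Λ : Submodule (WOL τ) (X.comp τ)) : Set (X.comp τ)) := by
    rw [Submodule.coe_pointwise_smul, ← Set.image_smul, ← Set.image_comp]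
    rfl
  rw [h1, h2, Set.image_eq_image Subtype.val_injective, SetLike.coe_set_eq]

/-- A function on the embeddings that does not decrease along `σ` is constant. -/
theorem eq_of_sigmaInv_le (hπ : Irreducible π) {g : Emb p k L → ℕ}
    (hg : ∀ τ, g (sigmaInv τ) ≤ g τ) (τ τ' : Emb p k L) : g τ' = g τ := by
  have key (τ : Emb p k L) (i : ℕ) : g (sigmaInv^[i] τ) ≤ g τ := by
    induction i with
    | zero => exact le_rfl
    | succ i ih => exact (Function.iterate_succ_apply' sigmaInv i τ ▸ hg _).trans ih
  obtain ⟨i, -, h⟩ := exists_sigmaInv_iterate_eq hπ τ τ'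
  obtain ⟨j, -, h'⟩ := exists_sigmaInv_iterate_eq hπ τ' τ
  exact le_antisymm (h ▸ key τ i) (h' ▸ key τ' j)

/-- Injectivity of `F` makes the rank nondecreasing along `σ`, and the embeddings form a single
cycle. -/
theorem finrank_eq_of_frobMap_le (hπ : Irreducible π)
    (N : (τ : Emb p k L) → Submodule (WOL τ) (X.comp τ))
    (hN : ∀ τ, X.frobMap 1 τ (N (sigmaInv τ)) ≤ N τ) (τ τ' : Emb p k L) :
    Module.finrank (WOL τ') (N τ') = Module.finrank (WOL τ) (N τ) :=
  eq_of_sigmaInv_le hπ (g := fun τ => Module.finrank (WOL τ) (N τ)) (fun τ =>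
    (X.isTwisted_frob_pow 1).finrank_le (frobeniusEquiv_pow_sigmaInv τ 1) (X.frob_pow_injective 1)
      hπ (hN τ)) τ τ'

theorem HasRank.finrank_eq {h : ℕ} (hrank : X.HasRank h) (hπ : Irreducible π) (τ : Emb p k L) :
    Module.finrank (WOL τ) (X.comp τ) = h := by
  obtain ⟨τ', hτ'⟩ := hrank
  have := X.finrank_eq_of_frobMap_le hπ (fun τ => ⊤) (fun τ => le_top) τ' τ
  rwa [finrank_top, finrank_top, hτ'] at this

theorem HasRank.finrank_imF {h : ℕ} (hrank : X.HasRank h) (hπ : Irreducible π) (τ : Emb p k L) :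
    Module.finrank (WOL τ) (X.imF τ) = h := by
  have := WOL.isDomain τ hπ
  have := X.finite_comp τ
  refine le_antisymm ?_ ?_
  · exact hrank.finrank_eq hπ τ ▸ Submodule.finrank_le _
  · have := (X.isTwisted_frob_pow 1).finrank_le (frobeniusEquiv_pow_sigmaInv τ 1)
      (X.frob_pow_injective 1) hπ (B := ⊤) (C := X.imF τ) (imF_eq_frobMap τ).ge
    rwa [finrank_top, hrank.finrank_eq hπ] at this

theorem frobMap_succ (N : (τ : Emb p k L) → Submodule (WOL τ) (X.comp τ)) (τ : Emb p k L) (n : ℕ) :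
    X.frobMap (n + 1) τ (N (sigmaInv^[n + 1] τ)) =
      X.frobMap n τ (X.frobMap 1 (sigmaInv^[n] τ) (N (sigmaInv (sigmaInv^[n] τ)))) := by
  -- `M_τ` depends on `τ`, so membership is expressed over any `τ'` equal to the iterate, which
  -- allows the two forms of `σ^{-(n+1)} τ` to be exchanged.
  have hG (n : ℕ) (τ τ' : Emb p k L) (hτ : sigmaInv^[n] τ = τ') (y : X.comp τ) :
      y ∈ X.frobMap n τ (N (sigmaInv^[n] τ)) ↔ ∃ x ∈ N τ', X.F^[n] (x : M) = y := by
    subst hτ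
    exact mem_frobMap
  ext y
  rw [hG (n + 1) τ _ (Function.iterate_succ_apply' sigmaInv n τ), mem_frobMap]
  constructor
  · rintro ⟨x, hx, hxy⟩
    refine ⟨⟨X.F x, X.F_mem_comp _ x.2⟩, mem_frobMap.2 ⟨x, hx, rfl⟩, ?_⟩
    rw [← hxy, Function.iterate_succ_apply]
  · rintro ⟨z, hz, hzy⟩
    obtain ⟨x, hx, hxz⟩ := mem_frobMap.1 hz
    refine ⟨x, hx, ?_⟩
    rw [← hzy, ← hxz, Function.iterate_succ_apply]
    rfl

/-- The length of `N_τ / F^n N_{σ^{-n}τ}` for a family of submodules `N` stable under `F`. -/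
theorem relLength_frobMap (N : (τ : Emb p k L) → Submodule (WOL τ) (X.comp τ))
    (hN : ∀ τ, X.frobMap 1 τ (N (sigmaInv τ)) ≤ N τ) (τ : Emb p k L) (n : ℕ) :
    X.frobMap n τ (N (sigmaInv^[n] τ)) ≤ N τ ∧
    relLength (WittVector p k) (N τ) (X.frobMap n τ (N (sigmaInv^[n] τ))) =
      ∑ i : Fin n, relLength (WittVector p k) (N (sigmaInv^[i.val] τ))
        (X.frobMap 1 (sigmaInv^[i.val] τ) (N (sigmaInv (sigmaInv^[i.val] τ)))) := by
  induction n with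
  | zero =>
    have h0 : X.frobMap 0 τ (N (sigmaInv^[0] τ)) = N τ := by
      ext y
      rw [mem_frobMap]
      exact ⟨fun ⟨x, hx, hxy⟩ => Subtype.ext hxy ▸ hx, fun hy => ⟨y, hy, rfl⟩⟩
    rw [h0, relLength_self]
    simp
  | succ n ih =>
    have hle : X.frobMap (n + 1) τ (N (sigmaInv^[n + 1] τ)) ≤
        X.frobMap n τ (N (sigmaInv^[n] τ)) := by
      rw [frobMap_succ]
      exact IsTwisted.mapSubmodule_mono _ _ (hN _)
    refine ⟨hle.trans ih.1, ?_⟩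
    -- The new layer `F^n N / F^{n+1} N` has the length of `N / F N` at `σ^{-n} τ`, because `F^n`
    -- preserves lengths.
    rw [relLength_add hle ih.1, ih.2, Fin.sum_univ_castSucc, frobMap_succ]
    congr 1
    exact IsTwisted.relLength_mapSubmodule _ _ (X.frob_pow_injective n) _ _

theorem relLength_map_frobEnd_self (hπ : Irreducible π)
    (N : (τ : Emb p k L) → Submodule (WOL τ) (X.comp τ))
    (hN : ∀ τ, X.frobMap 1 τ (N (sigmaInv τ)) ≤ N τ) (τ : Emb p k L) :
    (X.isSemilinear_frobEnd hπ τ).map (N τ) ≤ N τ ∧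
    relLength (WittVector p k) (N τ) ((X.isSemilinear_frobEnd hπ τ).map (N τ)) =
      ∑ i : Fin (resDeg π), relLength (WittVector p k) (N (sigmaInv^[i.val] τ))
        (X.frobMap 1 (sigmaInv^[i.val] τ) (N (sigmaInv (sigmaInv^[i.val] τ)))) := by
  have h : (X.isSemilinear_frobEnd hπ τ).map (N τ) =
      X.frobMap (resDeg π) τ (N (sigmaInv^[resDeg π] τ)) := by
    have hG (τ' : Emb p k L) (hτ : sigmaInv^[resDeg π] τ = τ') (y : X.comp τ) :
        y ∈ X.frobMap (resDeg π) τ (N (sigmaInv^[resDeg π] τ)) ↔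
          ∃ x ∈ N τ', X.F^[resDeg π] (x : M) = y := by
      subst hτ
      exact mem_frobMap
    ext y
    rw [hG τ (sigmaInv_iterate_resDeg hπ τ)]
    refine exists_congr fun x => and_congr_right fun _ => ?_
    rw [Subtype.ext_iff, coe_frobEnd]
  rw [h]
  exact relLength_frobMap N hN τ _

end FCrystalOL

end Components

/-! ### The length of `B / φ B` in terms of slopes. -/

section SlopeBound

open scoped Pointwise

variable {R A N : Type*} [CommRing R] [CommRing A] [Algebra R A] [IsDomain A]
  [IsDiscreteValuationRing A] {ϖ : A} [AddCommGroup N] [Module R N] [Module A N]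
  [IsScalarTower R A N] {φ : AddMonoid.End N}

theorem IsSemilinear.map_pow_succ (hφ : IsSemilinear ϖ φ) (s : ℕ) (B : Submodule A N) :
    (hφ.pow (s + 1)).map B = hφ.map ((hφ.pow s).map B) := by
  apply SetLike.coe_injective
  rw [coe_map, coe_map, coe_map, ← Set.image_comp, pow_succ']
  rfl

theorem IsSemilinear.map_le_iff (hφ : IsSemilinear ϖ φ) {B C : Submodule A N} :
    hφ.map B ≤ C ↔ B ≤ hφ.comap C := Set.image_subset_iff

theorem relLength_map_pow (hφ : IsSemilinear ϖ φ)
    (hmap : ∀ B C : Submodule A N, relLength R (hφ.map B) (hφ.map C) = relLength R B C)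
    (s : ℕ) (B C : Submodule A N) :
    relLength R ((hφ.pow s).map B) ((hφ.pow s).map C) = relLength R B C := by
  induction s with
  | zero =>
    have h (B : Submodule A N) : (hφ.pow 0).map B = B :=
      SetLike.coe_injective (by rw [IsSemilinear.coe_map, pow_zero]; exact Set.image_id _)
    rw [h, h]
  | succ s ih => rw [hφ.map_pow_succ, hφ.map_pow_succ, hmap, ih]

/-- Each of the `s` layers `φ ^ i B / φ ^ (i + 1) B` has the same length. -/
theorem relLength_map_pow_self (hφ : IsSemilinear ϖ φ)
    (hmap : ∀ B C : Submodule A N, relLength R (hφ.map B) (hφ.map C) = relLength R B C)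
    {B : Submodule A N} (hB : hφ.map B ≤ B) (s : ℕ) :
    (hφ.pow s).map B ≤ B ∧
      relLength R B ((hφ.pow s).map B) = s * relLength R B (hφ.map B) := by
  induction s with
  | zero =>
    have h : (hφ.pow 0).map B = B :=
      SetLike.coe_injective (by rw [IsSemilinear.coe_map, pow_zero]; exact Set.image_id _)
    rw [h, relLength_self]
    simp
  | succ s ih =>
    have h1 : (hφ.pow (s + 1)).map B ≤ hφ.map B := by
      rw [hφ.map_pow_succ]
      exact hφ.map_mono ih.1
    refine ⟨h1.trans hB, ?_⟩
    rw [relLength_add h1 hB, hφ.map_pow_succ, hmap, ih.2]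
    push_cast
    ring

variable [Module.Finite A N] [Module.IsTorsionFree A N]

theorem relLength_ne_top (hlen : Module.length R (A ⧸ Ideal.span {ϖ}) ≤ 1) {B C : Submodule A N}
    (h : ∀ x ∈ B, ∃ c : ℕ, ϖ ^ c • x ∈ C) : relLength R B C ≠ ⊤ := by
  obtain ⟨c, hc⟩ := exists_pow_smul_top_le_of_forall (ϖ := ϖ) (B := C.submoduleOf B)
    fun x => h x x.2
  have h1 : ϖ ^ c • B ≤ C := by
    rintro _ ⟨x, hx, rfl⟩
    exact hc (mem_smul_top.2 ⟨⟨x, hx⟩, rfl⟩)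
  refine ne_top_of_le_ne_top ?_ ((relLength_anti_right B h1).trans (relLength_pow_smul_le hlen B c))
  exact_mod_cast ENat.natCast_ne_top (c * Module.finrank A B)

/-- One power of `φ` acts on each isoclinic part in `T` as a power of `ϖ` up to bijection. The
relation between `m` and `t` is multiplied by the rank so that it also holds when the part is zero.
-/
theorem exists_common_pow (hφ : IsSemilinear ϖ φ) {κ : ℚ} (hκ : 0 < κ) (T : Finset ℚ) :
    ∃ s : ℕ, 0 < s ∧ ∀ t ∈ T, ∃ m : ℕ,
      (hφ.pow s).map (isoclinicPart hφ κ t) = ϖ ^ m • isoclinicPart hφ κ t ∧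
      (m : ℚ) * Module.finrank A (isoclinicPart hφ κ t) =
        κ * s * (t * Module.finrank A (isoclinicPart hφ κ t)) := by
  classical
  induction T using Finset.induction_on with
  | empty => exact ⟨1, one_pos, by simp⟩
  | insert t T ht ih =>
    obtain ⟨s, hs, hT⟩ := ih
    obtain ⟨s', hs', m', hm', hm''⟩ : ∃ s' : ℕ, 0 < s' ∧ ∃ m' : ℕ,
        (hφ.pow s').map (isoclinicPart hφ κ t) = ϖ ^ m' • isoclinicPart hφ κ t ∧
        (m' : ℚ) * Module.finrank A (isoclinicPart hφ κ t) =
          κ * s' * (t * Module.finrank A (isoclinicPart hφ κ t)) := by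
      rcases isoclinicPart_spec hφ hκ t with h | ⟨s', m', hs', ht', h⟩
      · refine ⟨1, one_pos, 0, ?_, by rw [h]; simp⟩
        rw [h, pow_zero, one_smul, eq_bot_iff, IsSemilinear.map_le_iff]
        exact bot_le
      · refine ⟨s', hs', m', h, ?_⟩
        have hs0 : (s' : ℚ) ≠ 0 := by exact_mod_cast hs'.ne'
        rw [ht']
        field_simp
    refine ⟨s * s', Nat.mul_pos hs hs', fun u hu => ?_⟩
    rcases Finset.mem_insert.1 hu with rfl | hu
    · refine ⟨m' * s, ?_, ?_⟩
      · have := map_pow_mul_eq hφ hm' s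
        rwa [mul_comm s' s] at this
      · push_cast
        linear_combination (s : ℚ) * hm''
    · obtain ⟨m, hm, hm2⟩ := hT u hu
      refine ⟨m * s', map_pow_mul_eq hφ hm s', ?_⟩
      push_cast
      linear_combination (s' : ℚ) * hm2

/-- If `B` is stable under `φ` and contains the sum of the parts of slopes in `T` as a lattice, then
the length of `B / φ B` is at most the sum of these slopes, counted with multiplicity. -/
theorem exists_relLength_map_eq
    (hlen : Module.length R (A ⧸ Ideal.span {ϖ}) ≤ 1) (hφ : IsSemilinear ϖ φ)
    (hmap : ∀ B C : Submodule A N, relLength R (hφ.map B) (hφ.map C) = relLength R B C)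
    {κ : ℚ} (hκ : 0 < κ) (T : Finset ℚ) {B : Submodule A N} (hB : hφ.map B ≤ B)
    (hSB : ⨆ t ∈ T, isoclinicPart hφ κ t ≤ B)
    (h : ∀ x ∈ B, ∃ c : ℕ, ϖ ^ c • x ∈ ⨆ t ∈ T, isoclinicPart hφ κ t) :
    ∃ n : ℕ, relLength R B (hφ.map B) = n ∧
      (n : ℚ) ≤ κ * ∑ t ∈ T, t * Module.finrank A (isoclinicPart hφ κ t) := by
  classical
  obtain ⟨s, hs, hT⟩ := exists_common_pow hφ hκ T
  choose! m hm hm' using hT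
  set S := ⨆ t ∈ T, isoclinicPart hφ κ t with hS
  have hpart (t : ℚ) (ht : t ∈ T) : isoclinicPart hφ κ t ≤ S :=
    le_iSup₂_of_le t ht le_rfl
  have hsub (t : ℚ) : ϖ ^ m t • isoclinicPart hφ κ t ≤ isoclinicPart hφ κ t := by
    rintro _ ⟨x, hx, rfl⟩
    exact Submodule.smul_mem _ _ hx
  have hSS : (hφ.pow s).map S ≤ S := by
    rw [IsSemilinear.map_le_iff]
    refine iSup₂_le fun t ht => ?_
    rw [← IsSemilinear.map_le_iff, hm t ht]
    exact (hsub t).trans (hpart t ht)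
  have hS1 : relLength R S ((hφ.pow s).map S) ≤
      ((∑ t ∈ T, m t * Module.finrank A (isoclinicPart hφ κ t) : ℕ) : ℕ∞) := by
    have h1 : ⨆ t ∈ T, ϖ ^ m t • isoclinicPart hφ κ t ≤ (hφ.pow s).map S := by
      refine iSup₂_le fun t ht => ?_
      rw [← hm t ht]
      exact (hφ.pow s).map_mono (hpart t ht)
    refine (relLength_anti_right S h1).trans ((relLength_iSup_iSup_le T _ _ hsub).trans ?_)
    push_cast
    exact Finset.sum_le_sum fun t _ => relLength_pow_smul_le hlen _ _
  obtain ⟨hBs, hBs'⟩ := relLength_map_pow_self hφ hmap hB s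
  have hfin : relLength R B S ≠ ⊤ := relLength_ne_top hlen h
  -- Both `e1` and `e2` compute the length of `B / φ ^ s S`, through `φ ^ s B` and through `S`.
  -- Since `φ ^ s B / φ ^ s S` and `B / S` have the same finite length, `B / φ ^ s B` and `S / φ ^ s
  -- S` have equal length.
  have e1 := relLength_add (R := R) ((hφ.pow s).map_mono hSB) hBs
  have e2 := relLength_add (R := R) hSS hSB
  rw [relLength_map_pow hφ hmap, hBs'] at e1
  rw [e1, add_comm] at e2
  rw [add_comm (relLength R B S), add_comm (relLength R B S)] at e2
  have e3 := ENat.add_left_injective_of_ne_top hfin e2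
  rw [← e3] at hS1
  have hfin2 : relLength R B (hφ.map B) ≠ ⊤ := by
    intro htop
    rw [htop, ENat.mul_top (by exact_mod_cast hs.ne')] at hS1
    exact ENat.natCast_ne_top _ (top_le_iff.1 hS1)
  obtain ⟨n, hn⟩ := ENat.ne_top_iff_exists.1 hfin2
  refine ⟨n, hn.symm, ?_⟩
  rw [← hn] at hS1
  have hS2 : s * n ≤ ∑ t ∈ T, m t * Module.finrank A (isoclinicPart hφ κ t) := by
    exact_mod_cast hS1
  have hS3 : (s : ℚ) * n ≤ ∑ t ∈ T, (m t : ℚ) * Module.finrank A (isoclinicPart hφ κ t) := by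
    exact_mod_cast hS2
  rw [Finset.sum_congr rfl fun t ht => hm' t ht, ← Finset.mul_sum, mul_comm κ, mul_assoc] at hS3
  exact le_of_mul_le_mul_left hS3 (by exact_mod_cast hs)

end SlopeBound

/-! ### Elementary divisors and lengths of quotients. -/

section ElementaryDivisors

variable {R A : Type*} [CommRing R] [CommRing A] [Algebra R A] [IsDomain A]
  [IsDiscreteValuationRing A] {ϖ : A}

theorem relLength_span_pow (hϖ : Irreducible ϖ) (hlen : Module.length R (A ⧸ Ideal.span {ϖ}) = 1)
    (n : ℕ) : relLength R (Ideal.span {ϖ ^ n}) (Ideal.span {ϖ ^ (n + 1)}) = 1 := by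
  have hinj : Function.Injective (LinearMap.mulLeft R (ϖ ^ n)) :=
    mul_right_injective₀ (pow_ne_zero n hϖ.ne_zero)
  have key := relLength_semilinear (LinearMap.mulLeft R (ϖ ^ n)) hinj
    ((⊤ : Ideal A).restrictScalars R) ((Ideal.span {ϖ}).restrictScalars R)
  rw [relLength_restrictScalars, relLength_top, hlen] at key
  rw [← key, ← relLength_restrictScalars]
  congr 1
  · ext x
    simp [Ideal.mem_span_singleton', mul_comm, eq_comm]
  · ext x
    simp only [Submodule.restrictScalars_mem, Ideal.mem_span_singleton', Submodule.mem_map,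
      LinearMap.mulLeft_apply]
    constructor
    · rintro ⟨a, rfl⟩
      exact ⟨a * ϖ, ⟨a, rfl⟩, by ring⟩
    · rintro ⟨_, ⟨a, rfl⟩, rfl⟩
      exact ⟨a, by ring⟩

theorem length_quotient_span_pow (hϖ : Irreducible ϖ)
    (hlen : Module.length R (A ⧸ Ideal.span {ϖ}) = 1) (n : ℕ) :
    Module.length R (A ⧸ Ideal.span {ϖ ^ n}) = n := by
  induction n with
  | zero =>
    rw [pow_zero, Ideal.span_singleton_one, ← relLength_top, relLength_self, Nat.cast_zero]
  | succ n ih =>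
    rw [← relLength_top] at ih ⊢
    rw [relLength_add (C := Ideal.span {ϖ ^ n}) ?_ le_top, ih, relLength_span_pow hϖ hlen]
    · push_cast
      rfl
    · rw [Ideal.span_singleton_le_span_singleton]
      exact pow_dvd_pow _ n.le_succ

theorem length_quotient_span (hϖ : Irreducible ϖ)
    (hlen : Module.length R (A ⧸ Ideal.span {ϖ}) = 1) {a : A} (ha : a ≠ 0) :
    Module.length R (A ⧸ Ideal.span {a}) = multiplicity ϖ a := by
  obtain ⟨n, u, rfl⟩ := IsDiscreteValuationRing.eq_unit_mul_pow_irreducible ha hϖ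
  rw [Ideal.span_singleton_mul_left_unit u.isUnit, length_quotient_span_pow hϖ hlen]
  congr 1
  refine (multiplicity_eq_of_dvd_of_not_dvd (Dvd.intro_left _ rfl) fun h => ?_).symm
  rw [pow_succ', mul_comm (u : A), mul_comm ϖ] at h
  have := (mul_dvd_mul_iff_left (pow_ne_zero n hϖ.ne_zero)).1 h
  exact hϖ.not_isUnit (isUnit_of_dvd_unit this u.isUnit)

/-- `A` itself has quotients `A / ϖ ^ (n + 1)` of every length. This excludes `a = 0`, at which
`multiplicity` takes a default value. -/
theorem ne_zero_of_length_ne_top (hϖ : Irreducible ϖ)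
    (hlen : Module.length R (A ⧸ Ideal.span {ϖ}) = 1) {a : A}
    (ha : Module.length R (A ⧸ Ideal.span {a}) ≠ ⊤) : a ≠ 0 := by
  rintro rfl
  obtain ⟨n, hn⟩ := ENat.ne_top_iff_exists.1 ha
  have h1 : relLength R (⊤ : Ideal A) (Ideal.span {ϖ ^ (n + 1)}) ≤
      relLength R ⊤ (Ideal.span {(0 : A)}) := relLength_anti_right _ (by simp)
  rw [relLength_top, relLength_top, length_quotient_span_pow hϖ hlen, ← hn] at h1
  have : n + 1 ≤ n := by exact_mod_cast h1
  omega

variable {h : ℕ} {a : Fin h → A}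

theorem length_pi_quotient (hϖ : Irreducible ϖ)
    (hlen : Module.length R (A ⧸ Ideal.span {ϖ}) = 1) (ha : ∀ j, a j ≠ 0)
    {P : Fin h → Prop} [DecidablePred P] :
    Module.length R (Π j : {j // P j}, A ⧸ Ideal.span {a j}) =
      ((∑ j with P j, multiplicity ϖ (a j) : ℕ) : ℕ∞) := by
  rw [Module.length_pi_of_fintype]
  simp_rw [length_quotient_span hϖ hlen (ha _)]
  rw [← Nat.cast_sum]
  congr 1
  exact (Finset.sum_subtype (Finset.univ.filter P) (by simp) fun j => multiplicity ϖ (a j)).symm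

theorem span_range_single {ι : Type*} [Fintype ι] [DecidableEq ι] (I : ι → Ideal A) :
    Submodule.span A (Set.range fun j : ι => (Pi.single j 1 : Π j, A ⧸ I j)) = ⊤ := by
  rw [eq_top_iff]
  rintro x -
  rw [← Finset.univ_sum_single x]
  refine Submodule.sum_mem _ fun j _ => ?_
  obtain ⟨b, hb⟩ := Ideal.Quotient.mk_surjective (x j)
  have : Pi.single j (x j) = b • (Pi.single j 1 : Π j, A ⧸ I j) := by
    rw [← Pi.single_smul, ← hb, Algebra.smul_def, mul_one]
    rfl
  rw [this]
  exact Submodule.smul_mem _ _ (Submodule.subset_span ⟨j, rfl⟩)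

theorem card_filter_le (i : ℕ) (hi : i ≤ h) :
    Fintype.card {j : Fin h // i ≤ j.val} = h - i := by
  rw [Fintype.card_subtype]
  have : (Finset.univ.filter fun j : Fin h => i ≤ j.val) =
      Finset.univ.filter fun j : Fin h => ¬ j.val < i := by simp
  rw [this, Finset.filter_not, Finset.card_sdiff_of_subset (Finset.filter_subset _ _),
    Fin.card_filter_val_lt]
  simp [hi]

/-- The Hodge polygon lies above the polygon of a filtration with elementary subquotients. -/
theorem sum_multiplicity_le_sum_min (hϖ : Irreducible ϖ)
    (hlen : Module.length R (A ⧸ Ideal.span {ϖ}) = 1) (ha : ∀ j, a j ≠ 0)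
    {N : Type*} [AddCommGroup N] [Module R N] [Module A N] [IsScalarTower R A N]
    {r : ℕ} (B : Fin (r + 1) → Submodule A N)
    (e : (N ⧸ B 0) ≃ₗ[A] (Π j, A ⧸ Ideal.span {a j})) (hr : B (Fin.last r) = ⊤)
    (hB : ∀ i : Fin r, B i.castSucc ≤ B i.succ)
    (hB' : ∀ i : Fin r, ∀ x ∈ B i.succ, ϖ • x ∈ B i.castSucc) (d : Fin r → ℕ)
    (hd : ∀ i, relLength R (B i.succ) (B i.castSucc) ≤ d i) {i : ℕ} (hi : i ≤ h) :
    ∑ j with i ≤ j.val, multiplicity ϖ (a j) ≤ ∑ l, min (d l) (h - i) := by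
  classical
  -- The projection to the factors with index at least `i`, generated by `h - i` unit vectors; the
  -- order of the exponents is irrelevant here.
  let pr : (Π j, A ⧸ Ideal.span {a j}) →ₗ[A]
      (Π j : {j : Fin h // i ≤ j.val}, A ⧸ Ideal.span {a j}) :=
    LinearMap.pi fun j => LinearMap.proj j.1
  have hpr : Function.Surjective pr := fun y => by
    refine ⟨fun j => if hj : i ≤ j.val then y ⟨j, hj⟩ else 0, ?_⟩
    ext j
    simp [pr, j.2]
  let E := Fintype.equivFinOfCardEq (card_filter_le i hi)
  have key := length_le_sum_min hlen.le (pr ∘ₗ e.toLinearMap ∘ₗ (B 0).mkQ)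
    (hpr.comp (e.surjective.comp (Submodule.mkQ_surjective _)))
    ((fun j : {j : Fin h // i ≤ j.val} =>
      (Pi.single j 1 : Π j : {j : Fin h // i ≤ j.val}, A ⧸ Ideal.span {a j})) ∘ E.symm)
    (by rw [EquivLike.range_comp]; exact span_range_single _) B
    (fun x hx => by
      rw [LinearMap.mem_ker, LinearMap.comp_apply, LinearMap.comp_apply, Submodule.mkQ_apply,
        (Submodule.Quotient.mk_eq_zero _).2 hx, map_zero, map_zero]) hr hB hB' d hd
  rw [length_pi_quotient hϖ hlen ha] at key
  exact_mod_cast key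

theorem relLength_le_card {N : Type*} [AddCommGroup N] [Module R N] [Module A N]
    [IsScalarTower R A N] (hlen : Module.length R (A ⧸ Ideal.span {ϖ}) ≤ 1) {ι : Type*} [Fintype ι]
    (v : ι → N) {B C : Submodule A N} (hv : Submodule.span A (Set.range v) = B)
    (hC : ∀ x ∈ B, ϖ • x ∈ C) : relLength R B C ≤ Fintype.card ι := by
  have hmem (i : ι) : v i ∈ B := hv ▸ Submodule.subset_span ⟨i, rfl⟩
  have h1 : Submodule.span A (Set.range fun i => (⟨v i, hmem i⟩ : B)) = ⊤ := by
    refine Submodule.map_injective_of_injective B.subtype_injective ?_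
    rw [Submodule.map_span, ← Set.range_comp, Submodule.map_subtype_top]
    exact hv
  refine length_le_card_of_span_eq_top hlen
    (fun i => (C.submoduleOf B).mkQ ⟨v i, hmem i⟩) ?_ fun x => ?_
  · have := congrArg (Submodule.map (C.submoduleOf B).mkQ) h1
    rwa [Submodule.map_span, ← Set.range_comp, Submodule.map_top, Submodule.range_mkQ] at this
  · obtain ⟨x, rfl⟩ := Submodule.mkQ_surjective _ x
    rw [← map_smul]
    exact (Submodule.Quotient.mk_eq_zero _).2 (hC x x.2)

theorem pow_mem_span_of_multiplicity_le (hϖ : Irreducible ϖ) {b : A} (hb : b ≠ 0) {t : ℕ}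
    (ht : multiplicity ϖ b ≤ t) : ϖ ^ t ∈ Ideal.span {b} := by
  obtain ⟨n, u, rfl⟩ := IsDiscreteValuationRing.eq_unit_mul_pow_irreducible hb hϖ
  have hn : ϖ ^ n ∣ ↑u * ϖ ^ n := Dvd.intro_left _ rfl
  have hfin : FiniteMultiplicity ϖ (↑u * ϖ ^ n) := FiniteMultiplicity.of_prime_left hϖ.prime hb
  rw [Ideal.span_singleton_mul_left_unit u.isUnit, Ideal.mem_span_singleton]
  exact pow_dvd_pow _ ((hfin.le_multiplicity_of_pow_dvd hn).trans ht)

open scoped Pointwise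

/-- The layer is generated by the vectors `ϖ ^ t e_j`, which vanish unless `t < multiplicity ϖ (a
j)`. -/
theorem relLength_pow_smul_top_pi (hϖ : Irreducible ϖ)
    (hlen : Module.length R (A ⧸ Ideal.span {ϖ}) = 1) (ha : ∀ j, a j ≠ 0) (t : ℕ) :
    relLength R (ϖ ^ t • ⊤ : Submodule A (Π j, A ⧸ Ideal.span {a j})) (ϖ ^ (t + 1) • ⊤) ≤
      ((Finset.univ.filter fun j => t < multiplicity ϖ (a j)).card : ℕ∞) := by
  classical
  rw [← Fintype.card_subtype]
  refine relLength_le_card hlen.le (fun j : {j // t < multiplicity ϖ (a j)} =>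
    ϖ ^ t • (Pi.single j.1 1 : Π j, A ⧸ Ideal.span {a j})) ?_ ?_
  · refine le_antisymm (Submodule.span_le.2 ?_) ?_
    · rintro _ ⟨j, rfl⟩
      exact mem_smul_top.2 ⟨_, rfl⟩
    · rw [← span_range_single, Submodule.smul_span, Submodule.span_le]
      rintro _ ⟨_, ⟨j, rfl⟩, rfl⟩
      by_cases hj : t < multiplicity ϖ (a j)
      · exact Submodule.subset_span ⟨⟨j, hj⟩, rfl⟩
      · have h0 : ϖ ^ t • (Pi.single j 1 : Π j, A ⧸ Ideal.span {a j}) = 0 := by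
          rw [← Pi.single_smul, Algebra.smul_def, mul_one, Ideal.Quotient.algebraMap_eq,
            Ideal.Quotient.eq_zero_iff_mem.2
              (pow_mem_span_of_multiplicity_le hϖ (ha j) (not_lt.1 hj)), Pi.single_zero]
        change ϖ ^ t • (Pi.single j 1 : Π j, A ⧸ Ideal.span {a j}) ∈ _
        rw [h0]
        exact zero_mem _
  · intro x hx
    obtain ⟨y, rfl⟩ := mem_smul_top.1 hx
    exact mem_smul_top.2 ⟨y, by rw [pow_succ', mul_smul]⟩

/-- If some exponent before place `i` exceeds `t`, monotonicity makes all `h - i` later ones exceed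
it. If none does, every index counted on the left is at least `i`. -/
theorem min_card_filter_lt_le {n : Fin h → ℕ} (hn : Monotone n) {i : ℕ} (hi : i ≤ h) (t : ℕ) :
    min (Finset.univ.filter fun j => t < n j).card (h - i) ≤
      (Finset.univ.filter fun j : Fin h => i ≤ j.val ∧ t < n j).card := by
  by_cases hex : ∃ j : Fin h, j.val < i ∧ t < n j
  · obtain ⟨j₀, hj₀, hn₀⟩ := hex
    refine (min_le_right _ _).trans ?_
    rw [← card_filter_le i hi, Fintype.card_subtype]
    refine Finset.card_le_card fun j hj => ?_
    simp only [Finset.mem_filter, Finset.mem_univ, true_and] at hj ⊢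
    exact ⟨hj, hn₀.trans_le (hn (Fin.le_def.2 (hj₀.le.trans hj)))⟩
  · push Not at hex
    refine (min_le_left _ _).trans (Finset.card_le_card fun j hj => ?_)
    simp only [Finset.mem_filter, Finset.mem_univ, true_and] at hj ⊢
    exact ⟨not_lt.1 fun hlt => (hex j hlt).not_gt hj, hj⟩

/-- Double counting of the pairs `(t, j)` with `t < n j`. -/
theorem sum_card_filter_lt_le (n : Fin h → ℕ) (i r : ℕ) :
    ∑ t ∈ Finset.range r, (Finset.univ.filter fun j : Fin h => i ≤ j.val ∧ t < n j).card ≤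
      ∑ j with i ≤ j.val, n j := by
  simp_rw [← Finset.filter_filter, Finset.card_filter]
  rw [Finset.sum_comm]
  refine Finset.sum_le_sum fun j _ => ?_
  rw [← Finset.card_filter]
  refine (Finset.card_le_card (t := Finset.range (n j)) fun t ht => ?_).trans
    (Finset.card_range _).le
  exact Finset.mem_range.2 (Finset.mem_filter.1 ht).2

/-- A quotient of `∏ A / a_j` that can be generated by `h - i` elements has at most the length of
the product of the `h - i` largest factors. -/
theorem length_le_sum_multiplicity (hϖ : Irreducible ϖ)
    (hlen : Module.length R (A ⧸ Ideal.span {ϖ}) = 1) (ha : ∀ j, a j ≠ 0)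
    (hmono : Monotone fun j => multiplicity ϖ (a j))
    {Q : Type*} [AddCommGroup Q] [Module R Q] [Module A Q] [IsScalarTower R A Q]
    (g : (Π j, A ⧸ Ideal.span {a j}) →ₗ[A] Q) (hg : Function.Surjective g) {i : ℕ} (hi : i ≤ h)
    (v : Fin (h - i) → Q) (hv : Submodule.span A (Set.range v) = ⊤) :
    Module.length R Q ≤ ((∑ j with i ≤ j.val, multiplicity ϖ (a j) : ℕ) : ℕ∞) := by
  -- `ϖ ^ r` kills the product, so the filtration by the powers `ϖ ^ (r - l)`, for `l = 0, …, r`,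
  -- starts at zero and exhausts it; `length_le_sum_min` applies to it.
  set r := ∑ j, multiplicity ϖ (a j) with hr
  have hsub (l : Fin r) : r - l.castSucc.val = r - 1 - l.val + 1 := by
    have := l.2
    simp only [Fin.val_castSucc]
    omega
  have hsub' (l : Fin r) : r - l.succ.val = r - 1 - l.val := by
    have := l.2
    simp only [Fin.val_succ]
    omega
  have key := length_le_sum_min hlen.le g hg v hv
    (fun l : Fin (r + 1) => (ϖ ^ (r - l.val) • ⊤ : Submodule A (Π j, A ⧸ Ideal.span {a j})))
    (by
      intro x hx
      obtain ⟨y, rfl⟩ := mem_smul_top.1 hx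
      have : ϖ ^ r • y = 0 := by
        ext j
        obtain ⟨b, hb⟩ := Ideal.Quotient.mk_surjective (y j)
        rw [Pi.smul_apply, ← hb, Algebra.smul_def, Ideal.Quotient.algebraMap_eq,
          Ideal.Quotient.eq_zero_iff_mem.2 (pow_mem_span_of_multiplicity_le hϖ (ha j)
            (Finset.single_le_sum (f := fun j => multiplicity ϖ (a j)) (fun _ _ => Nat.zero_le _)
              (Finset.mem_univ j))), zero_mul]
        rfl
      rw [LinearMap.mem_ker]
      change g (ϖ ^ r • y) = 0
      rw [this, map_zero])
    (by simp) (fun l => by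
      rw [hsub, hsub']
      exact pow_smul_top_anti ϖ (Nat.le_succ _)) (fun l x hx => by
      rw [hsub'] at hx
      rw [hsub]
      obtain ⟨y, rfl⟩ := mem_smul_top.1 hx
      exact mem_smul_top.2 ⟨y, by rw [pow_succ', mul_smul]⟩)
    (fun l => (Finset.univ.filter fun j => r - 1 - l.val < multiplicity ϖ (a j)).card) (fun l => by
      rw [hsub, hsub']
      exact relLength_pow_smul_top_pi hϖ hlen ha _)
  refine key.trans ?_
  rw [← Nat.cast_sum, Nat.cast_le]
  calc ∑ l : Fin r, min (Finset.univ.filter fun j => r - 1 - l.val < multiplicity ϖ (a j)).card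
        (h - i)
      ≤ ∑ l : Fin r, (Finset.univ.filter fun j : Fin h =>
          i ≤ j.val ∧ r - 1 - l.val < multiplicity ϖ (a j)).card :=
        Finset.sum_le_sum fun l _ => min_card_filter_lt_le hmono hi _
    _ = ∑ t ∈ Finset.range r, (Finset.univ.filter fun j : Fin h =>
          i ≤ j.val ∧ t < multiplicity ϖ (a j)).card := by
        rw [Fin.sum_univ_eq_sum_range (fun l => (Finset.univ.filter fun j : Fin h =>
          i ≤ j.val ∧ r - 1 - l < multiplicity ϖ (a j)).card) r]
        exact Finset.sum_range_reflect (fun t => (Finset.univ.filter fun j : Fin h =>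
          i ≤ j.val ∧ t < multiplicity ϖ (a j)).card) r
    _ ≤ _ := sum_card_filter_lt_le _ i r

end ElementaryDivisors

/-! ### Comparison of convex polygons. -/

section Polygons

/-- If the inequality between the sums of two increasing sequences holds at the break points of the
second one, then it holds everywhere. -/
theorem sum_le_sum_of_breakPoints {h : ℕ} {g q : Fin h → ℚ} (hg : Monotone g) (hq : Monotone q)
    (hbreak : ∀ D : Finset (Fin h), (∀ j ∈ D, ∀ j' ∉ D, q j < q j') → ∑ j ∈ D, g j ≤ ∑ j ∈ D, q j)
    (i : ℕ) : ∑ j with j.val < i, g j ≤ ∑ j with j.val < i, q j := by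
  classical
  rcases le_or_gt h i with hi | hi
  · have : (Finset.univ.filter fun j : Fin h => j.val < i) = Finset.univ :=
      Finset.filter_true_of_mem fun j _ => j.2.trans_le hi
    rw [this]
    exact hbreak _ (by simp)
  set I := Finset.univ.filter fun j : Fin h => j.val < i with hI
  let i' : Fin h := ⟨i, hi⟩
  have hmem (j : Fin h) : j ∈ I ↔ j < i' := by simp [hI, i', Fin.lt_def]
  -- Let `q i'` be the slope after place `i`. If `g i'` is at least as large, compare at the right
  -- end of the block of slope `q i'` and remove terms with `g ≥ q`. Otherwise compare at its left
  -- end and add terms with `g ≤ q`.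
  rcases le_or_gt (q i') (g i') with hle | hlt
  · set B := Finset.univ.filter fun j => q j ≤ q i' with hB
    have hmemB (j : Fin h) : j ∈ B ↔ q j ≤ q i' := by simp [hB]
    have hIB : I ⊆ B := fun j hj => (hmemB j).2 (hq ((hmem j).1 hj).le)
    have h1 := hbreak B fun j hj j' hj' =>
      ((hmemB j).1 hj).trans_lt (not_le.1 fun h => hj' ((hmemB j').2 h))
    have h2 : ∑ j ∈ B \ I, q j ≤ ∑ j ∈ B \ I, g j := by
      refine Finset.sum_le_sum fun j hj => ?_
      rw [Finset.mem_sdiff, hmemB, hmem, not_lt] at hj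
      exact hj.1.trans (hle.trans (hg hj.2))
    rw [← Finset.sum_sdiff hIB, ← Finset.sum_sdiff hIB] at h1
    linarith
  · set D := Finset.univ.filter fun j => q j < q i' with hD
    have hmemD (j : Fin h) : j ∈ D ↔ q j < q i' := by simp [hD]
    have hDI : D ⊆ I := fun j hj =>
      (hmem j).2 (not_le.1 fun h => ((hmemD j).1 hj).not_ge (hq h))
    have h1 := hbreak D fun j hj j' hj' =>
      ((hmemD j).1 hj).trans_le (not_lt.1 fun h => hj' ((hmemD j').2 h))
    have h2 : ∑ j ∈ I \ D, g j ≤ ∑ j ∈ I \ D, q j := by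
      refine Finset.sum_le_sum fun j hj => ?_
      rw [Finset.mem_sdiff, hmemD, hmem, not_lt] at hj
      exact (hg hj.1.le).trans (hlt.le.trans hj.2)
    rw [← Finset.sum_sdiff hDI, ← Finset.sum_sdiff hDI]
    linarith

theorem eq_filter_lt_card {h : ℕ} {q : Fin h → ℚ} (hq : Monotone q) {D : Finset (Fin h)}
    (hD : ∀ j ∈ D, ∀ j' ∉ D, q j < q j') :
    D = Finset.univ.filter fun j : Fin h => j.val < D.card := by
  classical
  have hlow (j : Fin h) (hj : j ∈ D) : Finset.Iic j ⊆ D := fun j' hj' => by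
    by_contra hne
    exact ((hD j hj j' hne).trans_le (hq (Finset.mem_Iic.1 hj'))).false
  refine Finset.eq_of_subset_of_card_le (fun j hj => ?_) ?_
  · have := Finset.card_le_card (hlow j hj)
    rw [Fin.card_Iic] at this
    exact Finset.mem_filter.2 ⟨Finset.mem_univ _, this⟩
  · rw [Fin.card_filter_val_lt]
    exact min_le_right _ _

/-- Each `t` is repeated `m t` times and the resulting list is sorted. -/
theorem exists_monotone_card_fiber {h : ℕ} (T : Finset ℚ) (m : ℚ → ℕ) (hm : ∀ t ∉ T, m t = 0)
    (hsum : ∑ t ∈ T, m t = h) :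
    ∃ q : Fin h → ℚ, Monotone q ∧ ∀ t, Finset.card {j | q j = t} = m t := by
  classical
  have hcard : Fintype.card (Σ t : T, Fin (m t)) = h := by
    rw [Fintype.card_sigma, ← hsum, ← Finset.sum_coe_sort T]
    simp
  let E := Fintype.equivFinOfCardEq hcard
  let q₀ : Fin h → ℚ := fun j => (E.symm j).1
  refine ⟨q₀ ∘ Tuple.sort q₀, Tuple.monotone_sort q₀, fun t => ?_⟩
  let E' : (Σ t : T, Fin (m t)) ≃ Fin h := E.trans (Tuple.sort q₀).symm
  rw [← Fintype.card_subtype]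
  have hE : Fintype.card {j : Fin h // (q₀ ∘ Tuple.sort q₀) j = t} =
      Fintype.card {y : Σ t : T, Fin (m t) // (y.1 : ℚ) = t} := by
    refine Fintype.card_congr (E'.symm.subtypeEquiv fun j => ?_)
    rfl
  rw [hE]
  by_cases ht : t ∈ T
  · rw [← Fintype.card_fin (m t)]
    refine Fintype.card_congr ⟨fun y => Fin.cast (congrArg m y.2) y.1.2,
      fun i => ⟨⟨⟨t, ht⟩, i⟩, rfl⟩, ?_, fun i => rfl⟩
    rintro ⟨⟨⟨u, hu⟩, i⟩, rfl⟩
    rfl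
  · rw [hm t ht, Fintype.card_eq_zero_iff]
    exact ⟨fun y => ht (y.2 ▸ y.1.1.2)⟩

end Polygons

/-! ### Ranks of sums and saturations. -/

section Rank

variable {A N : Type*} [CommRing A] [IsDomain A] [AddCommGroup N] [Module A N] [IsNoetherian A N]

theorem finrank_sup_of_disjoint {B C : Submodule A N} (h : Disjoint B C) :
    Module.finrank A ↥(B ⊔ C) = Module.finrank A B + Module.finrank A C := by
  have h1 := Submodule.rank_sup_add_rank_inf_eq B C
  rw [h.eq_bot, rank_bot, add_zero, ← Module.finrank_eq_rank, ← Module.finrank_eq_rank,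
    ← Module.finrank_eq_rank] at h1
  exact_mod_cast h1

theorem finrank_iSup_eq_sum {ι : Type*} {P : ι → Submodule A N} (hP : iSupIndep P) (T : Finset ι) :
    Module.finrank A ↥(⨆ t ∈ T, P t) = ∑ t ∈ T, Module.finrank A (P t) := by
  classical
  induction T using Finset.induction_on with
  | empty =>
    have h0 : ⨆ t ∈ (∅ : Finset ι), P t = ⊥ := by simp
    rw [Finset.sum_empty, h0]
    exact finrank_bot A N
  | insert t T ht ih =>
    rw [Finset.iSup_insert, Finset.sum_insert ht, ← ih]
    refine finrank_sup_of_disjoint ((hP t).mono_right ?_)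
    exact iSup₂_mono' fun u hu => ⟨u, fun h => ht (h ▸ hu), le_rfl⟩

/-- The elements of which some multiple by a power of `ϖ` is in `B`. -/
def saturation (ϖ : A) (B : Submodule A N) : Submodule A N where
  carrier := {x | ∃ c : ℕ, ϖ ^ c • x ∈ B}
  zero_mem' := ⟨0, by simp⟩
  add_mem' := by
    rintro x y ⟨c, hc⟩ ⟨d, hd⟩
    refine ⟨c + d, ?_⟩
    rw [smul_add]
    refine add_mem ?_ ?_
    · rw [add_comm, pow_add, mul_smul]
      exact B.smul_mem _ hc
    · rw [pow_add, mul_smul]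
      exact B.smul_mem _ hd
  smul_mem' := by
    rintro a x ⟨c, hc⟩
    exact ⟨c, by rw [smul_comm]; exact B.smul_mem a hc⟩

theorem le_saturation (ϖ : A) (B : Submodule A N) : B ≤ saturation ϖ B := fun x hx =>
  ⟨0, by simpa using hx⟩

variable [IsDiscreteValuationRing A] {ϖ : A}

/-- A single power of `ϖ` maps the saturation injectively into `B`. -/
theorem finrank_saturation (hϖ : Irreducible ϖ) [Module.IsTorsionFree A N] (B : Submodule A N) :
    Module.finrank A (saturation ϖ B) = Module.finrank A B := by
  refine le_antisymm ?_ (Submodule.finrank_mono (le_saturation ϖ B))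
  obtain ⟨c, hc⟩ := exists_pow_smul_top_le_of_forall (ϖ := ϖ)
    (B := B.submoduleOf (saturation ϖ B)) fun x => x.2
  have hle (x : saturation ϖ B) : ϖ ^ c • (x : N) ∈ B := hc (mem_smul_top.2 ⟨x, rfl⟩)
  let f : saturation ϖ B →ₗ[A] B :=
    ((LinearMap.lsmul A N (ϖ ^ c)).comp (saturation ϖ B).subtype).codRestrict B hle
  refine LinearMap.finrank_le_finrank_of_injective (f := f) fun x y hxy => ?_
  exact Subtype.ext (pow_smul_cancel hϖ (congrArg Subtype.val hxy))

theorem isTorsionFree_quotient_saturation (hϖ : Irreducible ϖ) (B : Submodule A N) :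
    Module.IsTorsionFree A (N ⧸ saturation ϖ B) := by
  refine Module.IsTorsionFree.of_smul_eq_zero fun a x hax => ?_
  obtain ⟨x, rfl⟩ := Submodule.mkQ_surjective _ x
  by_contra! hne
  obtain ⟨n, u, rfl⟩ := IsDiscreteValuationRing.eq_unit_mul_pow_irreducible hne.1 hϖ
  rw [← map_smul, Submodule.mkQ_apply, Submodule.Quotient.mk_eq_zero] at hax
  obtain ⟨c, hc⟩ := hax
  refine hne.2 ((Submodule.Quotient.mk_eq_zero _).2 ⟨c + n, ?_⟩)
  have := B.smul_mem (↑u⁻¹ : A) hc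
  rwa [smul_smul, smul_smul, show (↑u⁻¹ : A) * ϖ ^ c * (↑u * ϖ ^ n) = ϖ ^ (c + n) by
    rw [pow_add]
    linear_combination (ϖ ^ c * ϖ ^ n) * u.inv_mul] at this

/-- The quotient by a saturated submodule `B` is generated by `rank N - rank B` elements. -/
theorem exists_span_quotient_saturation_eq_top (hϖ : Irreducible ϖ) (B : Submodule A N) {c : ℕ}
    (hc : Module.finrank A (saturation ϖ B) + c = Module.finrank A N) :
    ∃ v : Fin c → N ⧸ saturation ϖ B, Submodule.span A (Set.range v) = ⊤ := by
  have := isTorsionFree_quotient_saturation hϖ B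
  have hrk : Module.finrank A (N ⧸ saturation ϖ B) = c := by
    have := Submodule.finrank_quotient_add_finrank (saturation ϖ B)
    omega
  exact ⟨_, (Module.finBasisOfFinrankEq A (N ⧸ saturation ϖ B) hrk).span_eq⟩

end Rank

/-! ### Slope parts of the crystal and the comparison of the three polygons. -/

section Main

variable {p : ℕ} [Fact p.Prime] {k : Type*} [Field k] [CharP k p] [PerfectRing k p]
  {L : Type*} [Field L] [Algebra ℚ_[p] L] [FiniteDimensional ℚ_[p] L]
  [Algebra ℤ_[p] L] [IsScalarTower ℤ_[p] ℚ_[p] L] {π : OL p L}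
  {M : Type*} [AddCommGroup M] [Module (WittVector p k) M]
  [Module.Free (WittVector p k) M] [Module.Finite (WittVector p k) M]
  {X : FCrystalOL p k L M}

namespace FCrystalOL

/-- The preimage of a submodule of `M_τ` under `F : M_{σ⁻¹τ} → M_τ`. -/
def frobComap (τ : Emb p k L) (C : Submodule (WOL τ) (X.comp τ)) :
    Submodule (WOL (sigmaInv τ)) (X.comp (sigmaInv τ)) where
  carrier := (X.isTwisted_frob_pow 1).compMap (τ' := sigmaInv τ)
    (frobeniusEquiv_pow_sigmaInv τ 1) ⁻¹' C
  zero_mem' := by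
    rw [Set.mem_preimage, map_zero]
    exact zero_mem _
  add_mem' hx hy := by
    rw [Set.mem_preimage, map_add]
    exact add_mem hx hy
  smul_mem' c x hx := (congrArg (· ∈ C) ((X.isTwisted_frob_pow 1).compMap_smul (τ' := sigmaInv τ)
    (frobeniusEquiv_pow_sigmaInv τ 1) c x)).mpr (C.smul_mem _ hx)

theorem frobMap_le_iff {τ : Emb p k L}
    {B : Submodule (WOL (sigmaInv τ)) (X.comp (sigmaInv τ))}
    {C : Submodule (WOL τ) (X.comp τ)} : X.frobMap 1 τ B ≤ C ↔ B ≤ frobComap τ C :=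
  Set.image_subset_iff

theorem F_pow_smul (τ : Emb p k L) (m : ℕ) (x : X.comp (sigmaInv τ)) :
    X.F ((ofOL (sigmaInv τ) π ^ m • x : X.comp (sigmaInv τ)) : M) =
      ((ofOL τ π ^ m • ⟨X.F x, X.F_mem_comp τ x.2⟩ : X.comp τ) : M) := by
  have h := (X.isTwisted_frob_pow 1).compMap_smul (frobeniusEquiv_pow_sigmaInv τ 1)
    (ofOL (sigmaInv τ) π ^ m) x
  have h1 : wolCongr _ (frobeniusEquiv_pow_sigmaInv τ 1) (ofOL (sigmaInv τ) π ^ m) =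
      ofOL τ π ^ m := (map_pow _ _ _).trans (congrArg (· ^ m) (wolCongr_ofOL _ π))
  exact congrArg Subtype.val (h.trans (congrArg (· • _) h1))

/-- `F` commutes with `F^{fs}` and with `π`, so it carries isoclinic submodules at `σ⁻¹τ` to
isoclinic submodules of the same slope at `τ`. -/
theorem frobMap_slopePart_le (τ : Emb p k L) (t : ℚ) :
    X.frobMap 1 τ (X.slopePart π (sigmaInv τ) t) ≤ X.slopePart π τ t := by
  refine frobMap_le_iff.2 (sSup_le ?_)
  rintro Λ ⟨s, m, hs, ht, hΛ⟩
  refine frobMap_le_iff.1 (le_sSup ⟨s, m, hs, ht, ?_⟩)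
  ext y
  constructor
  · rintro ⟨z, hz, rfl⟩
    obtain ⟨x, hx, hxz⟩ := mem_frobMap.1 hz
    obtain ⟨x', hx', h⟩ := hΛ ▸ Set.mem_image_of_mem _ hx
    refine ⟨⟨X.F x', X.F_mem_comp τ x'.2⟩, mem_frobMap.2 ⟨x', hx', rfl⟩, ?_⟩
    refine (F_pow_smul τ m x').symm.trans ((congrArg X.F h).trans ?_)
    have hxz' : X.F (x : M) = z := hxz
    change X.F (X.F^[resDeg π * s] x) = X.F^[resDeg π * s] z
    rw [← hxz', ← Function.iterate_succ_apply X.F]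
    exact (Function.iterate_succ_apply' X.F _ _).symm
  · rintro ⟨z, hz, rfl⟩
    obtain ⟨x, hx, hxz⟩ := mem_frobMap.1 hz
    obtain ⟨x', hx', h⟩ := hΛ.symm ▸ Set.mem_image_of_mem
      (fun x : X.comp (sigmaInv τ) => ((ofOL (sigmaInv τ) π ^ m • x : X.comp (sigmaInv τ)) : M)) hx
    refine ⟨⟨X.F x', X.F_mem_comp τ x'.2⟩, mem_frobMap.2 ⟨x', hx', rfl⟩, ?_⟩
    change X.F^[resDeg π * s] (X.F x') = ((ofOL τ π ^ m • z : X.comp τ) : M)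
    rw [← Function.iterate_succ_apply, Function.iterate_succ_apply']
    refine (congrArg X.F h).trans ((F_pow_smul τ m x).trans ?_)
    have : (⟨X.F x, X.F_mem_comp τ x.2⟩ : X.comp τ) = z := Subtype.ext hxz
    rw [this]

theorem frobMap_iSup_slopePart_le (T : Finset ℚ) (τ : Emb p k L) :
    X.frobMap 1 τ (⨆ t ∈ T, X.slopePart π (sigmaInv τ) t) ≤ ⨆ t ∈ T, X.slopePart π τ t := by
  refine frobMap_le_iff.2 (iSup₂_le fun t ht => frobMap_le_iff.1 ?_)
  exact (frobMap_slopePart_le τ t).trans (le_iSup₂_of_le t ht le_rfl)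

variable (X) in
theorem isNoetherian_comp (τ : Emb p k L) : IsNoetherian (WOL τ) (X.comp τ) := by
  have := X.finite_comp τ
  have := WOL.isNoetherianRing τ
  infer_instance

variable (X π) in
/-- The saturation in `M_τ` of the sum of the parts of slopes in `T`. -/
def satPart (hπ : Irreducible π) (T : Finset ℚ) (τ : Emb p k L) :
    Submodule (WOL τ) (X.comp τ) :=
  haveI := WOL.isDomain τ hπ
  haveI := X.isNoetherian_comp τ
  saturation (ofOL τ π) (⨆ t ∈ T, X.slopePart π τ t)

theorem mem_satPart {hπ : Irreducible π} {T : Finset ℚ} {τ : Emb p k L} {x : X.comp τ} :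
    x ∈ X.satPart π hπ T τ ↔ ∃ c : ℕ, ofOL τ π ^ c • x ∈ ⨆ t ∈ T, X.slopePart π τ t := Iff.rfl

theorem frobMap_satPart_le (hπ : Irreducible π) (T : Finset ℚ) (τ : Emb p k L) :
    X.frobMap 1 τ (X.satPart π hπ T (sigmaInv τ)) ≤ X.satPart π hπ T τ := by
  intro y hy
  obtain ⟨x, ⟨c, hc⟩, hxy⟩ := mem_frobMap.1 hy
  refine ⟨c, frobMap_iSup_slopePart_le T τ (mem_frobMap.2 ⟨_, hc, ?_⟩)⟩
  refine (F_pow_smul τ c x).trans ?_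
  have : (⟨X.F x, X.F_mem_comp τ x.2⟩ : X.comp τ) = y := Subtype.ext hxy
  rw [this]

variable {h : ℕ}

theorem ramIdx_mul_resDeg_pos (hπ : Irreducible π) : (0 : ℚ) < ramIdx π * resDeg π := by
  have := ramIdx_pos hπ
  have := resDeg_pos hπ
  positivity

-- The image of `F^f` has full rank because `F^f` is injective. This is the finite-cokernel
-- hypothesis of the slope decomposition.
variable (X) in
theorem exists_frobEnd_eq (hπ : Irreducible π) (τ : Emb p k L) :
    ∃ l : ℕ, ∀ x, ∃ y, X.frobEnd hπ τ y = ofOL τ π ^ l • x := by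
  have := WOL.isDomain τ hπ
  have := WOL.isDiscreteValuationRing τ hπ
  have := X.finite_comp τ
  have hrk : Module.finrank (WOL τ) ((X.isSemilinear_frobEnd hπ τ).map ⊤) =
      Module.finrank (WOL τ) (X.comp τ) := by
    refine le_antisymm (Submodule.finrank_le _) ?_
    have := (X.isTwisted_frob_pow (resDeg π)).finrank_le (frobeniusEquiv_pow_resDeg hπ τ)
      (X.frob_pow_injective _) hπ (B := ⊤) (C := (X.isSemilinear_frobEnd hπ τ).map ⊤) le_rfl
    rwa [finrank_top] at this
  obtain ⟨l, hl⟩ := exists_pow_smul_top_le_of_finrank_eq (WOL.irreducible τ hπ) hrk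
  refine ⟨l, fun x => ?_⟩
  obtain ⟨y, -, hy⟩ := hl (mem_smul_top.2 ⟨x, rfl⟩)
  exact ⟨y, hy⟩

variable (X) in
theorem iSupIndep_slopePart (hπ : Irreducible π) (τ : Emb p k L) :
    iSupIndep (X.slopePart π τ) := by
  have := WOL.isDomain τ hπ
  have := WOL.isDiscreteValuationRing τ hπ
  have := X.finite_comp τ
  have := X.isTorsionFree_comp hπ τ
  have h : X.slopePart π τ = isoclinicPart (X.isSemilinear_frobEnd hπ τ) (ramIdx π * resDeg π) :=
    funext (slopePart_eq hπ τ)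
  rw [h]
  exact iSupIndep_isoclinicPart (WOL.irreducible τ hπ) _ (X.frobEnd_injective hπ τ)
    (ramIdx_mul_resDeg_pos hπ)

/-- The slope parts are independent, so finitely many are nonzero, and their sum has saturation
`M_τ`; hence their ranks add up to `h`. Without this `newtonSlopes` could be its default value `0`.
-/
theorem HasRank.exists_isNewtonSlopes (hrank : X.HasRank h) (hπ : Irreducible π) (τ : Emb p k L) :
    ∃ q, X.IsNewtonSlopes π h τ q := by
  classical
  have := WOL.isDomain τ hπ
  have := WOL.isDiscreteValuationRing τ hπ
  have := X.finite_comp τ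
  have := X.isTorsionFree_comp hπ τ
  have := WOL.isPrecomplete τ hπ
  have := X.isNoetherian_comp τ
  have hϖ := WOL.irreducible τ hπ
  have hindep := X.iSupIndep_slopePart hπ τ
  have hfin := Submodule.finite_ne_bot_of_iSupIndep hindep
  have hT (t : ℚ) : t ∉ hfin.toFinset → X.slopePart π τ t = ⊥ := by simp
  refine exists_monotone_card_fiber hfin.toFinset
    (fun t => Module.finrank (WOL τ) (X.slopePart π τ t)) (fun t ht => ?_) ?_
  · rw [hT t ht]
    exact finrank_bot _ _
  · rw [← finrank_iSup_eq_sum hindep, ← finrank_saturation hϖ]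
    have htop : saturation (ofOL τ π) (⨆ t ∈ hfin.toFinset, X.slopePart π τ t) = ⊤ := by
      rw [eq_top_iff]
      rintro x -
      obtain ⟨l, hl⟩ := X.exists_frobEnd_eq hπ τ
      obtain ⟨c, hc⟩ := exists_pow_smul_mem_sSup_slopes hϖ _ (X.isSemilinear_frobEnd hπ τ) hl rfl x
      refine ⟨c, (?_ : sSup _ ≤ ⨆ t ∈ hfin.toFinset, X.slopePart π τ t) hc⟩
      refine sSup_le ?_
      rintro Λ ⟨s, m, hs, hΛ⟩
      have hle : Λ ≤ X.slopePart π τ (m / (ramIdx π * resDeg π * s)) := by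
        rw [slopePart_eq hπ]
        exact le_sSup ⟨s, m, hs, rfl, hΛ⟩
      by_cases hmem : (m / (ramIdx π * resDeg π * s) : ℚ) ∈ hfin.toFinset
      · exact hle.trans (le_iSup₂_of_le _ hmem le_rfl)
      · rw [hT _ hmem] at hle
        exact hle.trans bot_le
    rw [htop, finrank_top, hrank.finrank_eq hπ]

theorem HasRank.isNewtonSlopes (hrank : X.HasRank h) (hπ : Irreducible π) (τ : Emb p k L) :
    X.IsNewtonSlopes π h τ (X.newtonSlopes π h τ) := by
  have H := hrank.exists_isNewtonSlopes hπ τ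
  unfold newtonSlopes
  rw [dif_pos H]
  exact H.choose_spec

/-- Smith normal form of the full-rank submodule `F M_{σ⁻¹τ}`, followed by sorting the coefficients
by valuation. -/
theorem HasRank.exists_isElementaryDivisors (hrank : X.HasRank h) (hπ : Irreducible π)
    (τ : Emb p k L) : ∃ a, X.IsElementaryDivisors π h τ a := by
  have := WOL.isDomain τ hπ
  have := WOL.isDiscreteValuationRing τ hπ
  have := X.finite_comp τ
  have := X.isTorsionFree_comp hπ τ
  have hrk : Module.finrank (WOL τ) (X.imF τ) = Module.finrank (WOL τ) (X.comp τ) := by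
    rw [hrank.finrank_imF hπ, hrank.finrank_eq hπ]
  let b := Module.finBasisOfFinrankEq (WOL τ) (X.comp τ) (hrank.finrank_eq hπ τ)
  let a := Submodule.smithNormalFormCoeffs b hrk
  let s := Tuple.sort fun j => val τ π (a j)
  exact ⟨a ∘ s, ⟨(Submodule.quotientEquivPiSpan (X.imF τ) b hrk).trans
    (LinearEquiv.piCongrLeft' (WOL τ) (fun j => WOL τ ⧸ Ideal.span {a j}) s.symm)⟩,
    Tuple.monotone_sort fun j => val τ π (a j)⟩

theorem HasRank.isElementaryDivisors (hrank : X.HasRank h) (hπ : Irreducible π) (τ : Emb p k L) :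
    X.IsElementaryDivisors π h τ (X.elementaryDivisors π h τ) := by
  have H := hrank.exists_isElementaryDivisors hπ τ
  unfold elementaryDivisors
  rw [dif_pos H]
  exact H.choose_spec

variable (X π h) in
/-- The `π`-adic valuations of the elementary divisors. -/
def elementaryExponents (τ : Emb p k L) (j : Fin h) : ℕ :=
  multiplicity (ofOL τ π) (X.elementaryDivisors π h τ j)

theorem HasRank.length_quotient_ne_top (hrank : X.HasRank h) (hπ : Irreducible π)
    (τ : Emb p k L) : Module.length (WittVector p k) (X.comp τ ⧸ X.imF τ) ≠ ⊤ := by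
  have := WOL.isDomain τ hπ
  have := WOL.isDiscreteValuationRing τ hπ
  have := X.finite_comp τ
  have := X.isTorsionFree_comp hπ τ
  have hrk : Module.finrank (WOL τ) (X.imF τ) = Module.finrank (WOL τ) (X.comp τ) := by
    rw [hrank.finrank_imF hπ, hrank.finrank_eq hπ]
  obtain ⟨c, hc⟩ := exists_pow_smul_top_le_of_finrank_eq (WOL.irreducible τ hπ) hrk
  rw [← relLength_top]
  exact relLength_ne_top (WOL.length_residue τ hπ).le fun x _ => ⟨c, hc (mem_smul_top.2 ⟨x, rfl⟩)⟩

theorem HasRank.elementaryDivisors_ne_zero (hrank : X.HasRank h) (hπ : Irreducible π)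
    (τ : Emb p k L) (j : Fin h) : X.elementaryDivisors π h τ j ≠ 0 := by
  have := WOL.isDomain τ hπ
  have := WOL.isDiscreteValuationRing τ hπ
  obtain ⟨e⟩ := (hrank.isElementaryDivisors hπ τ).1
  refine ne_zero_of_length_ne_top (WOL.irreducible τ hπ) (WOL.length_residue τ hπ)
    (ne_top_of_le_ne_top (hrank.length_quotient_ne_top hπ τ) ?_)
  rw [(e.restrictScalars (WittVector p k)).length_eq]
  exact Module.length_le_of_surjective (LinearMap.proj j) (LinearMap.proj_surjective j)

theorem HasRank.length_quotient (hrank : X.HasRank h) (hπ : Irreducible π) (τ : Emb p k L) :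
    Module.length (WittVector p k) (X.comp τ ⧸ X.imF τ) =
      ((∑ j, X.elementaryExponents π h τ j : ℕ) : ℕ∞) := by
  have := WOL.isDomain τ hπ
  have := WOL.isDiscreteValuationRing τ hπ
  obtain ⟨e⟩ := (hrank.isElementaryDivisors hπ τ).1
  rw [(e.restrictScalars (WittVector p k)).length_eq, Module.length_pi_of_fintype, Nat.cast_sum]
  exact Finset.sum_congr rfl fun j _ => length_quotient_span (WOL.irreducible τ hπ)
    (WOL.length_residue τ hπ) (hrank.elementaryDivisors_ne_zero hπ τ j)

theorem val_elementaryDivisors (τ : Emb p k L) (j : Fin h) :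
    val τ π (X.elementaryDivisors π h τ j) = X.elementaryExponents π h τ j / ramIdx π := rfl

theorem HasRank.monotone_elementaryExponents (hrank : X.HasRank h) (hπ : Irreducible π)
    (τ : Emb p k L) : Monotone (X.elementaryExponents π h τ) := by
  intro j j' hj
  have h1 := (hrank.isElementaryDivisors hπ τ).2 hj
  simp only [val_elementaryDivisors] at h1
  have he : (0 : ℚ) < ramIdx π := by exact_mod_cast ramIdx_pos hπ
  exact_mod_cast (div_le_div_iff_of_pos_right he).1 h1

theorem sum_filter_lt_add (n : Fin h → ℕ) (i : ℕ) :
    ∑ j with j.val < i, n j + ∑ j with i ≤ j.val, n j = ∑ j, n j := by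
  rw [← Finset.sum_filter_add_sum_filter_not Finset.univ fun j : Fin h => j.val < i]
  simp

/-- The comparison of the Hodge and Pappas-Rapoport polygons relative to `τ`. -/
theorem HasRank.prAt_le_hodgeAt (hrank : X.HasRank h) (hπ : Irreducible π) {r : Emb p k L → ℕ}
    {d : (τ : Emb p k L) → Fin (r τ) → ℕ} (hPR : X.PRCondition π r d) (τ : Emb p k L) {i : ℕ}
    (hi : i ≤ h) : prAt π h d τ i ≤ X.hodgeAt π h τ i := by
  have := WOL.isDomain τ hπ
  have := WOL.isDiscreteValuationRing τ hπ
  have he : (0 : ℚ) < ramIdx π := by exact_mod_cast ramIdx_pos hπ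
  obtain ⟨Fil, h0, hlast, hstep⟩ := hPR τ
  obtain ⟨e⟩ := (hrank.isElementaryDivisors hπ τ).1
  have h1 : ∑ j with i ≤ j.val, X.elementaryExponents π h τ j ≤ ∑ l, min (d τ l) (h - i) :=
    sum_multiplicity_le_sum_min (WOL.irreducible τ hπ) (WOL.length_residue τ hπ)
      (hrank.elementaryDivisors_ne_zero hπ τ) Fil ((Submodule.quotEquivOfEq _ _ h0).trans e) hlast
      (fun l => (hstep l).1) (fun l => (hstep l).2.1) (d τ) (fun l => (hstep l).2.2.le) hi
  -- Both sides are the length of `M_τ / F M_{σ⁻¹τ}`, so the bound on the last exponents becomes a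
  -- bound on the first ones.
  have h2 : ∑ j, X.elementaryExponents π h τ j = ∑ l, d τ l := by
    have h3 := relLength_telescope (R := WittVector p k) Fil fun l => (hstep l).1
    have h4 : ∑ l : Fin (r τ), relLength (WittVector p k) (Fil l.succ) (Fil l.castSucc) =
        ∑ l, (d τ l : ℕ∞) := Finset.sum_congr rfl fun l _ => (hstep l).2.2
    rw [hlast, h0, relLength_top, hrank.length_quotient hπ, h4] at h3
    exact_mod_cast h3
  have h3 : ∑ l, d τ l ≤ ∑ j with j.val < i, X.elementaryExponents π h τ j +
      ∑ l, min (d τ l) (h - i) := by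
    rw [← h2, ← sum_filter_lt_add _ i]
    exact Nat.add_le_add_left h1 _
  unfold prAt hodgeAt
  simp only [val_elementaryDivisors]
  rw [← Finset.sum_div]
  refine (div_le_div_iff_of_pos_right he).2 ?_
  have h4 : (∑ l, (d τ l : ℚ)) ≤ ∑ j with j.val < i, (X.elementaryExponents π h τ j : ℚ) +
      ∑ l, min (d τ l : ℚ) ((h - i : ℕ) : ℚ) := by exact_mod_cast h3
  rw [← sub_le_iff_le_add, ← Finset.sum_sub_distrib] at h4
  refine le_trans (Finset.sum_le_sum fun l _ => ?_) h4
  rw [Nat.cast_sub hi]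
  -- This is the identity `d - min (d, h - i) = max (i - h + d, 0)`.
  rcases le_total (d τ l : ℚ) (h - i) with hd | hd
  · rw [min_eq_left hd, max_eq_right (by linarith), sub_self]
  · rw [min_eq_right hd, max_eq_left (by linarith)]
    linarith

theorem finrank_satPart (hπ : Irreducible π) (T : Finset ℚ) (τ : Emb p k L) :
    Module.finrank (WOL τ) (X.satPart π hπ T τ) =
      ∑ t ∈ T, Module.finrank (WOL τ) (X.slopePart π τ t) := by
  have := WOL.isDomain τ hπ
  have := WOL.isDiscreteValuationRing τ hπ
  have := X.isNoetherian_comp τ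
  have := X.isTorsionFree_comp hπ τ
  rw [← finrank_iSup_eq_sum (X.iSupIndep_slopePart hπ τ)]
  exact finrank_saturation (WOL.irreducible τ hπ) _

/-- The length of `N_τ / F N_{σ⁻¹τ}`, where `N` is the saturated subcrystal of rank `i` defined by a
set of slopes, is at least the sum of the first `i` Hodge slopes. -/
theorem HasRank.sum_elementaryExponents_le (hrank : X.HasRank h) (hπ : Irreducible π)
    (T : Finset ℚ) (τ : Emb p k L) {i : ℕ} (hi : i ≤ h)
    (hT : Module.finrank (WOL τ) (X.satPart π hπ T τ) = i) :
    ((∑ j with j.val < i, X.elementaryExponents π h τ j : ℕ) : ℕ∞) ≤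
      relLength (WittVector p k) (X.satPart π hπ T τ)
        (X.frobMap 1 τ (X.satPart π hπ T (sigmaInv τ))) := by
  have := WOL.isDomain τ hπ
  have := WOL.isDiscreteValuationRing τ hπ
  have := X.isNoetherian_comp τ
  obtain ⟨e⟩ := (hrank.isElementaryDivisors hπ τ).1
  set B := X.satPart π hπ T τ with hB
  -- Here saturation matters: `M_τ / B` is torsion-free, hence free of rank `h - i`, so it has `h -
  -- i` generators.
  obtain ⟨v, hv⟩ : ∃ v : Fin (h - i) → X.comp τ ⧸ B,
      Submodule.span (WOL τ) (Set.range v) = ⊤ := exists_span_quotient_saturation_eq_top (WOL.irreducible τ hπ)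
    (⨆ t ∈ T, X.slopePart π τ t) (c := h - i) (by
      refine (congrArg (· + (h - i)) hT).trans ?_
      rw [hrank.finrank_eq hπ]
      omega)
  let g₁ : (X.comp τ ⧸ B) →ₗ[WOL τ] X.comp τ ⧸ (B ⊔ X.imF τ) := Submodule.factor le_sup_left
  let g₂ : (X.comp τ ⧸ X.imF τ) →ₗ[WOL τ] X.comp τ ⧸ (B ⊔ X.imF τ) := Submodule.factor le_sup_right
  have hg₁ : Function.Surjective g₁ := Submodule.factor_surjective _
  have hg₂ : Function.Surjective g₂ := Submodule.factor_surjective _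
  have h1 : relLength (WittVector p k) ⊤ (B ⊔ X.imF τ) ≤
      ((∑ j with i ≤ j.val, X.elementaryExponents π h τ j : ℕ) : ℕ∞) := by
    rw [relLength_top]
    refine length_le_sum_multiplicity (WOL.irreducible τ hπ) (WOL.length_residue τ hπ)
      (hrank.elementaryDivisors_ne_zero hπ τ) (hrank.monotone_elementaryExponents hπ τ)
      (g₂ ∘ₗ e.symm.toLinearMap) (hg₂.comp e.symm.surjective) hi (g₁ ∘ v) ?_
    rw [Set.range_comp, Submodule.span_image, hv, Submodule.map_top, LinearMap.range_eq_top.2 hg₁]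
  have h2 : relLength (WittVector p k) B (X.imF τ) ≤ relLength (WittVector p k) B
      (X.frobMap 1 τ (X.satPart π hπ T (sigmaInv τ))) := by
    refine relLength_anti_right _ ?_
    rw [imF_eq_frobMap]
    exact IsTwisted.mapSubmodule_mono _ _ le_top
  -- The total of all exponents is the length of `M_τ / (B + F M)` plus that of `B / (B ∩ F M)`. The
  -- first is at most the sum of the last `h - i` exponents, which cancels.
  have h3 := relLength_add (R := WittVector p k) (B := ⊤) (C := B ⊔ X.imF τ) (D := X.imF τ)
    le_sup_right le_top
  rw [relLength_sup_right, relLength_top, hrank.length_quotient hπ,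
    ← sum_filter_lt_add _ i, Nat.cast_add] at h3
  have h4 := h3.le.trans (add_le_add h1 h2)
  rw [add_comm (((∑ j with i ≤ j.val, X.elementaryExponents π h τ j : ℕ) : ℕ∞))] at h4
  exact (ENat.add_le_add_iff_right (ENat.natCast_ne_top _)).1 h4

/-- The comparison of the Newton and Hodge polygons at the break points of the Newton polygon. -/
theorem HasRank.sum_elementaryExponents_le_sum_slopes (hrank : X.HasRank h) (hπ : Irreducible π)
    (T : Finset ℚ) (τ : Emb p k L) {i : ℕ} (hi : i ≤ h)
    (hT : ∑ t ∈ T, Module.finrank (WOL τ) (X.slopePart π τ t) = i) :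
    ((∑ l : Fin (resDeg π), ∑ j with j.val < i,
        X.elementaryExponents π h (sigmaInv^[l.val] τ) j : ℕ) : ℚ) ≤
      ramIdx π * resDeg π * ∑ t ∈ T, t * Module.finrank (WOL τ) (X.slopePart π τ t) := by
  have := WOL.isDomain τ hπ
  have := WOL.isDiscreteValuationRing τ hπ
  have := X.finite_comp τ
  have := X.isTorsionFree_comp hπ τ
  obtain ⟨hstab, hsum⟩ := X.relLength_map_frobEnd_self hπ (X.satPart π hπ T)
    (frobMap_satPart_le hπ T) τ
  have hS : ⨆ t ∈ T, X.slopePart π τ t = ⨆ t ∈ T,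
      isoclinicPart (X.isSemilinear_frobEnd hπ τ) (ramIdx π * resDeg π) t := by
    simp_rw [slopePart_eq hπ]
  obtain ⟨n, hn, hn'⟩ := exists_relLength_map_eq (WOL.length_residue τ hπ).le
    (X.isSemilinear_frobEnd hπ τ) (relLength_map_frobEnd hπ τ) (ramIdx_mul_resDeg_pos hπ) T hstab
    (hS ▸ fun x hx => ⟨0, by simpa using hx⟩) (fun x hx => hS ▸ mem_satPart.1 hx)
  have hfr : ∑ t ∈ T, t * (Module.finrank (WOL τ) (X.slopePart π τ t) : ℚ) =
      ∑ t ∈ T, t * (Module.finrank (WOL τ) (isoclinicPart (X.isSemilinear_frobEnd hπ τ)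
        (ramIdx π * resDeg π) t) : ℚ) :=
    Finset.sum_congr rfl fun t _ => by rw [slopePart_eq hπ]
  rw [hfr]
  refine le_trans ?_ hn'
  rw [hn] at hsum
  have key : ((∑ l : Fin (resDeg π), ∑ j with j.val < i,
      X.elementaryExponents π h (sigmaInv^[l.val] τ) j : ℕ) : ℕ∞) ≤ n := by
    rw [hsum, Nat.cast_sum]
    -- The rank of the saturated part is `i` at every embedding, since the family is stable under
    -- `F`.
    refine Finset.sum_le_sum fun l _ => hrank.sum_elementaryExponents_le hπ T _ hi ?_
    rw [← hT, ← finrank_satPart hπ]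
    exact finrank_eq_of_frobMap_le hπ (X.satPart π hπ T) (frobMap_satPart_le hπ T) τ _
  exact_mod_cast key

/-- The comparison of the Newton and Hodge polygons. -/
theorem HasRank.hodge_le_newtonAt (hrank : X.HasRank h) (hπ : Irreducible π) (τ : Emb p k L)
    (i : ℕ) : X.hodge π h i ≤ X.newtonAt π h τ i := by
  classical
  have he : (0 : ℚ) < ramIdx π := by exact_mod_cast ramIdx_pos hπ
  have hf : (0 : ℚ) < resDeg π := by exact_mod_cast resDeg_pos hπ
  obtain ⟨hq, hcount⟩ := hrank.isNewtonSlopes hπ τ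
  set q := X.newtonSlopes π h τ with hqdef
  -- The slopes of the averaged Hodge polygon; they increase because the exponents do at each
  -- embedding.
  let g : Fin h → ℚ := fun j => (∑ l : Fin (resDeg π),
    (X.elementaryExponents π h (sigmaInv^[l.val] τ) j : ℚ)) / (ramIdx π * resDeg π)
  have hsum (D : Finset (Fin h)) : ∑ j ∈ D, g j = ((∑ l : Fin (resDeg π), ∑ j ∈ D,
      X.elementaryExponents π h (sigmaInv^[l.val] τ) j : ℕ) : ℚ) / (ramIdx π * resDeg π) := by
    rw [← Finset.sum_div, Finset.sum_comm]
    push_cast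
    rfl
  have hhodge : X.hodge π h i = ∑ j with j.val < i, g j := by
    rw [hsum]
    unfold hodge hodgeAt
    rw [finsum_emb hπ τ]
    simp only [val_elementaryDivisors]
    push_cast
    rw [← div_div, Finset.sum_div]
    simp_rw [Finset.sum_div]
  rw [hhodge]
  refine sum_le_sum_of_breakPoints (fun j j' hj => ?_) hq (fun D hD => ?_) i
  · refine (div_le_div_iff_of_pos_right (mul_pos he hf)).2 (Finset.sum_le_sum fun l _ => ?_)
    exact_mod_cast hrank.monotone_elementaryExponents hπ _ hj
  -- A break point: every slope occurring in `D` has all its indices in `D`, so `D` corresponds to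
  -- the full slope parts for the set `D.image q`.
  · have hfib (t : ℚ) (ht : t ∈ D.image q) : (D.filter fun j => q j = t).card =
        Module.finrank (WOL τ) (X.slopePart π τ t) := by
      rw [← hcount t]
      congr 1
      ext j
      simp only [Finset.mem_filter, Finset.mem_univ, true_and, and_iff_right_iff_imp]
      intro hj
      obtain ⟨j', hj', rfl⟩ := Finset.mem_image.1 ht
      by_contra hne
      exact (hD j' hj' j hne).ne hj.symm
    have hcard : ∑ t ∈ D.image q, Module.finrank (WOL τ) (X.slopePart π τ t) = D.card := by
      rw [Finset.card_eq_sum_card_image q D]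
      exact Finset.sum_congr rfl fun t ht => (hfib t ht).symm
    have hqsum : ∑ t ∈ D.image q, t * (Module.finrank (WOL τ) (X.slopePart π τ t) : ℚ) =
        ∑ j ∈ D, q j := by
      rw [← Finset.sum_fiberwise_of_maps_to (g := q) (t := D.image q)
        (fun j hj => Finset.mem_image_of_mem q hj) q]
      refine Finset.sum_congr rfl fun t ht => ?_
      rw [Finset.sum_congr rfl fun j hj => (Finset.mem_filter.1 hj).2, Finset.sum_const, hfib t ht,
        nsmul_eq_mul, mul_comm]
    have key := hrank.sum_elementaryExponents_le_sum_slopes hπ (D.image q) τ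
      (by simpa using Finset.card_le_univ D) hcard
    rw [hqsum, ← eq_filter_lt_card hq hD] at key
    rw [hsum, div_le_iff₀ (mul_pos he hf), mul_comm]
    exact key

end FCrystalOL

end Main

end PRCrystal

end

theorem mainTheorem1 {p : ℕ} [Fact p.Prime]
    {k : Type*} [Field k] [CharP k p] [PerfectRing k p]
    {L : Type*} [Field L] [Algebra ℚ_[p] L] [FiniteDimensional ℚ_[p] L]
    [Algebra ℤ_[p] L] [IsScalarTower ℤ_[p] ℚ_[p] L]
    (π : PRCrystal.OL p L) (hπ : Irreducible π)
    (hk : Nonempty (PRCrystal.OL p L ⧸ Ideal.span {π} →+* k))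
    {M : Type*} [AddCommGroup M] [Module (WittVector p k) M]
    [Module.Free (WittVector p k) M] [Module.Finite (WittVector p k) M]
    (X : PRCrystal.FCrystalOL p k L M) (h : ℕ) (hrank : X.HasRank h)
    (r : PRCrystal.Emb p k L → ℕ) (hr : ∀ τ, 1 ≤ r τ)
    (d : (τ : PRCrystal.Emb p k L) → Fin (r τ) → ℕ) (hd : ∀ τ i, d τ i ≤ h)
    (hPR : X.PRCondition π r d) :
    ∀ i : ℕ, i ≤ h →
      (∀ τ : PRCrystal.Emb p k L, X.hodge π h i ≤ X.newtonAt π h τ i) ∧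
      PRCrystal.pr π h d i ≤ X.hodge π h i := by
  intro i hi
  refine ⟨fun τ => hrank.hodge_le_newtonAt hπ τ i, ?_⟩
  -- `HasRank` provides an embedding, from which the orbit `𝒯` is enumerated.
  obtain ⟨τ, -⟩ := id hrank
  unfold PRCrystal.pr PRCrystal.FCrystalOL.hodge
  rw [PRCrystal.finsum_emb hπ τ, PRCrystal.finsum_emb hπ τ]
  exact div_le_div_of_nonneg_right
    (Finset.sum_le_sum fun l _ => hrank.prAt_le_hodgeAt hπ hPR _ hi) (Nat.cast_nonneg _)
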